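/- **Setting.** Let $G=(V,E)$ be a graph with finitely many edges, embedded by specifying, for every vertex, the clockwise cyclic order of its incident edges (planarity is not required). Let $L$ be a finite family of simple paths in $G$, called lines; the endpoints of a line are its terminals. Write $L_e$ for the set of lines that use the edge $e$, and $E'=\{e\in E : |L_e|\ge 2\}$. Assume * (path terminal property) every line terminates at vertices of degree one, and no two lines terminate at the same vertex; * (path intersection property) for any two lines, the vertices and edges they have in common form a path (possibly empty or a single vertex). A *block move* exchanges two consecutive nonempty blocks of a sequence. A *feasible solution* assigns to every edge $e=uv$ a sequence $\pi^0(e),\dots,\pi^{t(e)}(e)$ of orderings of $L_e$, where $\pi^0(e)$ is the left-to-right order of the lines on $e$ close to $u$, $\pi^{t(e)}(e)$ is the order close to $v$, and each $\pi^{i+1}(e)$ arises from $\pi^i(e)$ by a block move, such that the orders are consistent at every vertex: for every edge $e$ incident to a vertex $v$, the order of the lines of $L_e$ continuing beyond $v$ is, close to $v$, the same on $e$ as their combined order on the other edges incident to $v$, these edges being taken in clockwise order starting after $e$. The number of block crossings is $\sum_{e\in E}t(e)$. The solution uses only *monotone* block moves if, whenever a move on $e$ exchanges blocks $B$ and $C$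 (with $B$ before $C$), each line of $B$ comes after each line of $C$ in the final order $\pi^{t(e)}(e)$, and if altogether, over all edges, no two lines cross twice. **Algorithm.** Treat the edges one by one, in an arbitrary order. On an edge with at most one line there is nothing to do. To treat an edge $e=uv$ with $|L_e|>1$: 1. On each side of $e$, follow the lines of $L_e$ away from $e$. They form a tree, which is cut at terminals and at edges that have already been treated. The lines of $L_e$ ending at a common leaf form a *group*. The order of the lines on this side of $e$ is obtained by visiting the leaves in the cyclic order of the edges around the vertices of the tree; inside a group at an already treated edge, the lines have the order they have on that edge at its end nearer to $e$. 2. Merge the lines that are in a common group on the left side and also in a common group on the right side of $e$ into a single element. 3. Choose a group, on either side, that contains the largest number of elements after merging. Its elements keep their relative order and are consecutive on that side. Insert all other elements into it one by one, the nearest ones first, each with at most one block move, which brings it to its correct position. (If the chosen group is on the side of $v$, this is done backwards, from the order at $v$ to the order at $u$.) 4. Undo the merging. **Theorem.** There is an absolute constant $C$ such that for every such instance, for every order in which the edges are treated and every choice of their orientations, the algorithm computes a feasible solution that uses only monotone block moves and has at most $C\,|L|\sqrt{|E'|}$ block crossings; moreover, if $L\neq\emptyset$, it can be carried out in at most $C\,|E|^2|L|$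 elementary steps (unit-cost comparisons, array accesses and list operations of constant size). -/

import Mathlib

/-! ## Computations with a step count

A `Timed α` is a result together with the number of elementary steps that were spent on it.  The
procedures below are random access machine programs over lists and arrays.  The charges are:

* one step (`tick`) for every call of a procedure, where one call may look at, take apart or
  build a constant number of list cells and increment or decrement a counter;
* one step (`same`, `less`) for every comparison of two identifiers or two numbers;
* one step (`load`, `store`) for every access to a memory cell of an array.

Nothing that takes more than constant time on such a machine is left uncharged: all list
operations (append, reverse, length, ...) are themselves procedures in the list below.  As usual,
the memory is blank at the beginning, so that a blank array is available without charge. -/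

/-- A value together with the number of elementary steps used for computing it. -/
structure Timed (α : Type) where
  val : α
  steps : ℕ

namespace Timed

instance : Monad Timed where
  pure a := ⟨a, 0⟩
  bind x f := ⟨(f x.val).val, x.steps + (f x.val).steps⟩

/-- One elementary step. -/
def tick : Timed Unit := ⟨(), 1⟩

/-- Equality test of two identifiers or numbers. -/
def same {α : Type} [DecidableEq α] (a b : α) : Timed Bool := ⟨decide (a = b), 1⟩

/-- Comparison of two numbers. -/
def less (a b : ℕ) : Timed Bool := ⟨decide (a < b), 1⟩

/-- Reading the cell `i` of the array `A`. -/
def load {ι α : Type} (A : ι → α) (i : ι) : Timed α := ⟨A i, 1⟩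

/-- Writing `x` into the cell `i` of the array `A`. -/
def store {ι α : Type} [DecidableEq ι] (A : ι → α) (i : ι) (x : α) : Timed (ι → α) :=
  ⟨Function.update A i x, 1⟩

variable {α β : Type}

def append : List α → List α → Timed (List α)
  | [], ys => do
    tick
    return ys
  | x :: xs, ys => do
    tick
    let zs ← append xs ys
    return x :: zs

/-- `xs` reversed, followed by `ys`. -/
def reverseOnto : List α → List α → Timed (List α)
  | [], ys => do
    tick
    return ys
  | x :: xs, ys => do
    tick
    reverseOnto xs (x :: ys)

def reverse (xs : List α) : Timed (List α) := do
  tick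
  reverseOnto xs []

def length : List α → Timed ℕ
  | [] => do
    tick
    return 0
  | _ :: xs => do
    tick
    let n ← length xs
    return n + 1

/-- Calls `f` on all entries of a list. -/
def map (f : α → Timed β) : List α → Timed (List β)
  | [] => do
    tick
    return []
  | x :: xs => do
    tick
    let y ← f x
    let ys ← map f xs
    return y :: ys

/-- Calls `f` on all entries of a list and concatenates the results. -/
def flatMap (f : α → Timed (List β)) : List α → Timed (List β)
  | [] => do
    tick
    return []
  | x :: xs => do
    tick
    let ys ← f x
    let zs ← flatMap f xs
    append ys zs

/-- Concatenation of a list of lists. -/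
def flatten (xss : List (List α)) : Timed (List α) := do
  tick
  flatMap (fun xs => pure xs) xss

end Timed

/-! ## The algorithm -/

namespace LineOrdering

open Timed

variable {V L : Type} [DecidableEq V] [DecidableEq L]

/-- For every ordered pair `(u, v)` of adjacent vertices, the list `[π⁰, ..., πᵗ]` of line orders
on the edge `uv`, as met when travelling from `u` to `v`; every `πⁱ` lists the lines from left
to right with respect to this direction of travel.  The empty list means that the edge has not
been treated. -/
abbrev Table (V L : Type) : Type := V × V → List (List L)

/-! ### Following the lines -/

/-- Walks along a line (given by its vertices, of which those in `back` have been passed, the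
last passed one first) until it meets the edge `uv`.  If the line uses this edge, the result is
the pair of the two remaining parts of the line: the vertices beyond `u` and the vertices
beyond `v`, both read away from the edge. -/
def cutLine (u v : V) : List V → List V → Timed (Option (List V × List V))
  | back, a :: b :: rest => do
    tick
    if (← same a u) && (← same b v) then
      return some (back, rest)
    else if (← same a v) && (← same b u) then
      return some (rest, back)
    else
      cutLine u v (a :: back) (b :: rest)
  | _, _ => do
    tick
    return none

/-- The lines among `ls` that use the edge `uv`, each with its two remaining parts. -/
def linesThrough (path : L → List V) (u v : V) :
    List L → Timed (List (L × List V × List V))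
  | [] => do
    tick
    return []
  | l :: ls => do
    tick
    let p ← load path l
    let c ← cutLine u v [] p
    let rest ← linesThrough path u v ls
    match c with
    | some (x, y) => return (l, x, y) :: rest
    | none => return rest

/-- Splits the cyclic list of neighbours at `u`: the neighbours behind `u` in cyclic order,
without `u`; `seen` holds the entries passed so far in reverse order. -/
def turnFrom (u : V) : List V → List V → Timed (List V)
  | seen, [] => do
    tick
    reverse seen
  | seen, w :: ws => do
    tick
    if ← same w u then
      let front ← reverse seen
      append ws front
    else
      turnFrom u (w :: seen) ws

/-- The lines that continue to `w`, each with the vertices after `w`. -/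
def toward (w : V) : List (L × List V) → Timed (List (L × List V))
  | [] => do
    tick
    return []
  | (_, []) :: is => do
    tick
    toward w is
  | (l, x :: p) :: is => do
    tick
    let rest ← toward w is
    if ← same x w then
      return (l, p) :: rest
    else
      return rest

/-- The lines that end here; each of them forms a group of its own. -/
def ending : List (L × List V) → Timed (List (List L))
  | [] => do
    tick
    return []
  | (l, []) :: is => do
    tick
    let rest ← ending is
    return [l] :: rest
  | (_, _ :: _) :: is => do
    tick
    ending is

/-- Does the line `l` occur in the list? -/
def occurs (l : L) : List (L × List V) → Timed Bool
  | [] => do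
    tick
    return false
  | (k, _) :: is => do
    tick
    if ← same k l then
      return true
    else
      occurs l is

/-- The sublist of those entries of an order that occur in `is`. -/
def restrict (is : List (L × List V)) : List L → Timed (List L)
  | [] => do
    tick
    return []
  | l :: ls => do
    tick
    let rest ← restrict is ls
    if ← occurs l is then
      return l :: rest
    else
      return rest

/-- The tree of the lines `is`, which have just been followed from `u` to `v`, is searched in
the cyclic order of the edges around its vertices, and it is cut at the edges that have been
treated before.  The result is the list of the groups at its leaves from left to right.  A leaf
is a terminal or an edge `vw` that has been treated; in the latter case the group inherits its
order from the order on `vw` close to `v`.  The first argument bounds the depth of the search. -/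
def groups (rot : V → List V) (T : Table V L) :
    ℕ → V → V → List (L × List V) → Timed (List (List L))
  | 0, _, _, _ => do
    tick
    return []
  | n + 1, u, v, is => do
    tick
    let ends ← ending is
    let nbrs ← load rot v
    let ws ← turnFrom u [] nbrs
    let rest ← flatMap (fun w => do
      let sub ← toward w is
      match sub with
      | [] => return []
      | _ :: _ =>
        let orders ← load T (v, w)
        match orders with
        | near :: _ =>
          let g ← restrict sub near
          return [g]
        | [] => groups rot T n v w sub) ws
    append ends rest

/-! ### Sorting the lines on one edge -/

/-- Writes the number `k` into the cells of all lines of a list. -/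
def labelList (k : ℕ) : List L → (L → ℕ) → Timed (L → ℕ)
  | [], A => do
    tick
    return A
  | l :: ls, A => do
    tick
    let A' ← store A l k
    labelList k ls A'

/-- Writes into the cell of every line the index of the list containing it; indices start
at `k`. -/
def labelLists : ℕ → List (List L) → (L → ℕ) → Timed (L → ℕ)
  | _, [], A => do
    tick
    return A
  | k, g :: gs, A => do
    tick
    let A' ← labelList k g A
    labelLists (k + 1) gs A'

/-- Merging: cuts a group into maximal blocks of consecutive lines that have the same label,
that is, that are in the same group on the other side as well. -/
def merge (lab : L → ℕ) : List L → Timed (List (List L))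
  | [] => do
    tick
    return []
  | a :: as => do
    tick
    let blocks ← merge lab as
    match blocks with
    | (b :: bs) :: rest =>
      let i ← load lab a
      let j ← load lab b
      if ← same i j then
        return (a :: b :: bs) :: rest
      else
        return [a] :: (b :: bs) :: rest
    | _ => return [[a]]

/-- The size of the largest group. -/
def maxSize {β : Type} : List (List β) → Timed ℕ
  | [] => do
    tick
    return 0
  | g :: gs => do
    tick
    let k ← length g
    let m ← maxSize gs
    if ← less m k then
      return k
    else
      return m

/-- Finds the first group of size `n`.  The result consists of everything to the left of it
(nearest entry first), the group, and everything to the right of it. -/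
def locate {β : Type} (n : ℕ) : List β → List (List β) → Timed (List β × List β × List β)
  | left, [] => do
    tick
    return (left, [], [])
  | left, g :: gs => do
    tick
    let k ← length g
    if ← same k n then
      let right ← flatten gs
      return (left, g, right)
    else
      let left' ← reverseOnto g left
      locate n left' gs

/-- The target position of a merged block, which is represented by its first line. -/
def rank (pos : L → ℕ) : List L → Timed ℕ
  | [] => do
    tick
    return 0
  | a :: _ => do
    tick
    load pos a

/-- Splits a sequence of blocks at the first block whose target position is at least `r`. -/
def splitBelow (pos : L → ℕ) (r : ℕ) :
    List (List L) → Timed (List (List L) × List (List L))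
  | [] => do
    tick
    return ([], [])
  | b :: bs => do
    tick
    let k ← rank pos b
    if ← less k r then
      let (front, back) ← splitBelow pos r bs
      return (b :: front, back)
    else
      return ([], b :: bs)

/-- The current order of all blocks: `xs` reversed, then `s`, then `ys`. -/
def snapshot {β : Type} (xs s ys : List β) : Timed (List β) := do
  tick
  let tail ← append s ys
  reverseOnto xs tail

/-- Inserts the blocks `xs` to the left of the sorted sequence `s` (nearest block first) one by
one into `s`; `ys` is what stands to the right of `s`.  Returns the new sorted sequence and the
orders after the block moves that were made. -/
def insertLeft (pos : L → ℕ) (ys : List (List L)) :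
    List (List L) → List (List L) → Timed (List (List L) × List (List (List L)))
  | [], s => do
    tick
    return (s, [])
  | x :: xs, s => do
    tick
    let r ← rank pos x
    let (front, back) ← splitBelow pos r s
    let s' ← append front (x :: back)
    let (s'', moves) ← insertLeft pos ys xs s'
    match front with
    | [] => return (s'', moves)
    | _ :: _ =>
      let o ← snapshot xs s' ys
      return (s'', o :: moves)

/-- The same for the blocks to the right of the sorted sequence `s`. -/
def insertRight (pos : L → ℕ) :
    List (List L) → List (List L) → Timed (List (List (List L)))
  | [], _ => do
    tick
    return []
  | y :: ys, s => do
    tick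
    let r ← rank pos y
    let (front, back) ← splitBelow pos r s
    let s' ← append front (y :: back)
    let moves ← insertRight pos ys s'
    match back with
    | [] => return moves
    | _ :: _ =>
      let o ← snapshot [] s' ys
      return o :: moves

/-- Sorts the merged groups `gs` into the order `target` by inserting all other blocks into the
first group of size `n`.  Returns the list of all orders of blocks, from the initial one to the
final one. -/
def sortInto (n : ℕ) (gs target : List (List (List L))) :
    Timed (List (List (List L))) := do
  tick
  let start ← flatten gs
  let goal ← flatten target
  let pos ← labelLists 0 goal (fun _ => 0)
  let (xs, s, ys) ← locate n [] gs
  let (s', moves) ← insertLeft pos ys xs s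
  let moves' ← insertRight pos ys s'
  let all ← append moves moves'
  return start :: all

/-- The line orders on an edge whose groups on the two sides are `gl` and `gr`: merge, insert
everything into a largest group (if it is on the far side, then backwards from there), and undo
the merging. -/
def sortEdge (gl gr : List (List L)) : Timed (List (List L)) := do
  tick
  let labL ← labelLists 0 gl (fun _ => 0)
  let labR ← labelLists 0 gr (fun _ => 0)
  let ml ← map (merge labR) gl
  let mr ← map (merge labL) gr
  let nl ← maxSize ml
  let nr ← maxSize mr
  if ← less nl nr then
    let orders ← sortInto nr mr ml
    let orders' ← reverse orders
    map flatten orders'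
  else
    let orders ← sortInto nl ml mr
    map flatten orders

/-- Stores the line orders of an edge for both directions of travel. -/
def record (T : Table V L) (u v : V) (orders : List (List L)) : Timed (Table V L) := do
  tick
  let T' ← store T (u, v) orders
  let flipped ← map reverse orders
  let back ← reverse flipped
  store T' (v, u) back

/-- Treats the edge `uv`.  If it has at most one line, there is only one order. -/
def treatEdge (rot : V → List V) (path : L → List V) (ls : List L) (depth : ℕ)
    (T : Table V L) (u v : V) : Timed (Table V L) := do
  tick
  let is ← linesThrough path u v ls
  match is with
  | [] => record T u v [[]]
  | [(l, _)] => record T u v [[l]]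
  | _ :: _ :: _ =>
    let beyondV ← map (fun i => do tick; return (i.1, i.2.2)) is
    let beyondU ← map (fun i => do tick; return (i.1, i.2.1)) is
    let gr ← groups rot T depth u v beyondV
    let gu ← groups rot T depth v u beyondU
    let gu' ← map reverse gu
    let gl ← reverse gu'
    let orders ← sortEdge gl gr
    record T u v orders

/-- Treats the edges of a list one after the other. -/
def treatEdges (rot : V → List V) (path : L → List V) (ls : List L) (depth : ℕ) :
    List (V × V) → Table V L → Timed (Table V L)
  | [], T => do
    tick
    return T
  | (u, v) :: es, T => do
    tick
    let T' ← treatEdge rot path ls depth T u v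
    treatEdges rot path ls depth es T'

/-- The algorithm.  Input: for every vertex the list of its neighbours in clockwise order, for
every line the list of its vertices, the list of all lines, and the list of all edges in the
order in which they are to be treated, each with an orientation. -/
def orderLines (rot : V → List V) (path : L → List V) (ls : List L) (es : List (V × V)) :
    Timed (Table V L) := do
  tick
  let depth ← length es
  treatEdges rot path ls depth es (fun _ => [])

end LineOrdering

/-! ## Metro networks and line orders -/

/-- An embedded graph with a family of lines.  The embedding enters through the clockwise cyclic
order of the edges around every vertex `v`; it is given by a list `rot v` of the neighbours
of `v`, which starts at an arbitrary one of them.  No planarity is required. -/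
structure MetroNetwork (V L : Type) where
  graph : SimpleGraph V
  rot : V → List V
  rot_nodup : ∀ v, (rot v).Nodup
  mem_rot : ∀ v w, w ∈ rot v ↔ graph.Adj v w
  src : L → V
  dst : L → V
  line : ∀ l, graph.Path (src l) (dst l)

namespace MetroNetwork

open LineOrdering

variable {V L : Type} (N : MetroNetwork V L)

/-- The vertices of a line, in order. -/
def vertices (l : L) : List V := (N.line l).1.support

/-- The edges of a line, in order. -/
def edges (l : L) : List (Sym2 V) := (N.line l).1.edges

/-- All lines terminate at vertices of degree one, no two lines at the same vertex. -/
def PathTerminalProperty : Prop :=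
  (∀ l, (N.graph.neighborSet (N.src l)).ncard = 1 ∧ (N.graph.neighborSet (N.dst l)).ncard = 1) ∧
  ∀ l k, l ≠ k → Disjoint ({N.src l, N.dst l} : Set V) {N.src k, N.dst k}

/-- The vertices and edges that two lines have in common form a path, possibly an empty one or a
single vertex. -/
def PathIntersectionProperty : Prop :=
  ∀ l k, l ≠ k →
    (∀ x, ¬ (x ∈ N.vertices l ∧ x ∈ N.vertices k)) ∨
    ∃ (a b : V) (p : N.graph.Path a b),
      (∀ x, x ∈ p.1.support ↔ x ∈ N.vertices l ∧ x ∈ N.vertices k) ∧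
      (∀ e, e ∈ p.1.edges ↔ e ∈ N.edges l ∧ e ∈ N.edges k)

/-- `es` lists every edge of the graph exactly once, with one of its two orientations. -/
def IsEdgeList (es : List (V × V)) : Prop :=
  (es.map fun e => s(e.1, e.2)).Nodup ∧
  ∀ e : Sym2 V, e ∈ (es.map fun e => s(e.1, e.2)) ↔ e ∈ N.graph.edgeSet

/-- The edges that are used by at least two lines. -/
def sharedEdges : Set (Sym2 V) :=
  {e ∈ N.graph.edgeSet | ∃ l k, l ≠ k ∧ e ∈ N.edges l ∧ e ∈ N.edges k}

/-- The neighbours of `v` other than `u` in clockwise order, starting after `u`: for a traveller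
who arrives from `u`, from left to right. -/
def turn [DecidableEq V] (u v : V) : List V :=
  (N.rot v).drop ((N.rot v).idxOf u + 1) ++ (N.rot v).take ((N.rot v).idxOf u)

/-- The line order on the edge `uv` close to `u`, seen when travelling from `u` to `v`. -/
def startOrder (T : Table V L) (u v : V) : List L := (T (u, v)).headD []

/-- The line order on the edge `uv` close to `v`, seen when travelling from `u` to `v`. -/
def endOrder (T : Table V L) (u v : V) : List L := (T (u, v)).getLastD []

/-- The exchange of two consecutive nonempty blocks `b` and `c`. -/
def IsBlockMove (π ρ : List L) : Prop :=
  ∃ a b c d, b ≠ [] ∧ c ≠ [] ∧ π = a ++ b ++ c ++ d ∧ ρ = a ++ c ++ b ++ d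

/-- A block move which is monotone with respect to the target order `τ`: all lines of the first
block come after all lines of the second block in `τ`. -/
def IsMonotoneBlockMove (τ π ρ : List L) : Prop :=
  ∃ a b c d, b ≠ [] ∧ c ≠ [] ∧ π = a ++ b ++ c ++ d ∧ ρ = a ++ c ++ b ++ d ∧
    ∀ x ∈ b, ∀ y ∈ c, [y, x].Sublist τ

/-- The order of the lines of the edge `uv` that continue beyond `v` is, close to `v`, the same
on `uv` and on the other edges around `v`, taken together. -/
def ConsistentAt [DecidableEq V] (T : Table V L) (u v : V) : Prop :=
  (endOrder T u v).filter (fun l => decide (v ≠ N.src l ∧ v ≠ N.dst l)) =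
    (N.turn u v).flatMap fun w =>
      (startOrder T v w).filter fun l => decide (s(u, v) ∈ N.edges l)

/-- A feasible solution: on every edge a nonempty sequence of orders of its lines, each obtained
from the previous one by a block move, such that the orders are consistent in all vertices. -/
structure IsFeasible [DecidableEq V] (T : Table V L) : Prop where
  nonempty : ∀ u v, N.graph.Adj u v → T (u, v) ≠ []
  order : ∀ u v, N.graph.Adj u v → ∀ π ∈ T (u, v),
    π.Nodup ∧ ∀ l, l ∈ π ↔ s(u, v) ∈ N.edges l
  moves : ∀ u v, N.graph.Adj u v → (T (u, v)).IsChain IsBlockMove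
  flip : ∀ u v, N.graph.Adj u v → T (v, u) = ((T (u, v)).map List.reverse).reverse
  consistent : ∀ u v, N.graph.Adj u v → N.ConsistentAt T u v

/-- The lines `l` and `k` are in different relative orders in `π` and `ρ`. -/
def Swapped (l k : L) (π ρ : List L) : Prop :=
  ([l, k].Sublist π ∧ [k, l].Sublist ρ) ∨ ([k, l].Sublist π ∧ [l, k].Sublist ρ)

instance [DecidableEq L] (l k : L) (π ρ : List L) : Decidable (Swapped l k π ρ) :=
  inferInstanceAs (Decidable (_ ∨ _))

/-- How often the lines `l` and `k` cross on the edges of the list `es`. -/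
def pairCrossings [DecidableEq L] (T : Table V L) (es : List (V × V)) (l k : L) : ℕ :=
  (es.map fun e => ((T e).zip (T e).tail).countP fun p => decide (Swapped l k p.1 p.2)).sum

/-- The solution uses only monotone block moves: on every edge all moves are monotone with respect
to the final order on this edge, and altogether no two lines cross twice. -/
def IsMonotone [DecidableEq L] (T : Table V L) (es : List (V × V)) : Prop :=
  (∀ u v, N.graph.Adj u v → (T (u, v)).IsChain (IsMonotoneBlockMove (endOrder T u v))) ∧
  ∀ l k, l ≠ k → pairCrossings T es l k ≤ 1

/-- The total number of block crossings on the edges of the list `es`. -/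
def blockCrossings (T : Table V L) (es : List (V × V)) : ℕ :=
  (es.map fun e => (T e).length - 1).sum

end MetroNetwork

/-! Correctness rests on an invariant of the partially filled table (`IsGood`): at the end of a
treated edge, two lines stand in the order in which they separate beyond that end or, if they reach
another treated edge together first, in the order stored there (`Precedes`). Untreated edges are
transparent. Suppose that an untreated edge `e` is taken next and that two lines are in a common
group on one side of it. The treated edge `f` at which this group is cut then already orders the two
lines, and by the invariant it does so according to what lies beyond `e`. So the two sides of `e`
agree on every pair in a common group (`precedes_of_sameGroup`, `Compatible`). Storing the two
computed orders preserves the invariant, because a walk that now stops early at `e` reads there the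
order seen when looking back (`IsGood.update`). When all edges have been treated, the invariant
yields consistency at every vertex.

By the path intersection property, two lines that share `e` and a treated edge run together from one
to the other, so they are in a common group on some side of `e` (`sameGroup_of_treated`). Hence such
a pair has the same order at both ends of `e`. A sorting by monotone moves crosses only pairs that
stand in different orders at its two ends, and each of these once (`countP_swapped`). So two lines
can cross only on the first treated edge that they share, and there at most once.

For the number of moves, regard the groups on the two sides of `e` as the vertices of a bipartite
graph and the merged blocks as its edges; a block is a nonempty intersection of a left group with a
right group. If there are `k` blocks and the largest group has `n` of them, at most `k - n` moves
are made. By `sq_card_sub_le_card_disjoint`, `(k - n) ^ 2` is at most twice the number of ordered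
pairs of disjoint graph edges. Representatives of such blocks form a pair of lines in no common
group on either side, so the pair shares `e` but no edge treated before. Pairs charged to different
edges are therefore different, and the squares of the move numbers sum to at most `2 * |L| ^ 2`.
Only shared edges need moves, so Cauchy–Schwarz gives the bound `√2 * |L| * √|E'|`.

For the running time, following the lines on one edge costs the degrees along each line, which sum
to at most `2 * |E|`. Everything else costs `O(|L| * |E| + |L| ^ 2)`, and `|L| ≤ 2 * |E|` since the
lines start at distinct vertices, each incident to an edge. So each edge costs `O(|E| * |L|)`. -/

namespace Timed

/-! ### Results and step counts of the elementary list procedures -/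

variable {α β : Type}

@[simp] theorem val_pure (a : α) : (pure a : Timed α).val = a := rfl
@[simp] theorem steps_pure (a : α) : (pure a : Timed α).steps = 0 := rfl
@[simp] theorem val_bind (x : Timed α) (f : α → Timed β) : (x >>= f).val = (f x.val).val := rfl
@[simp] theorem steps_bind (x : Timed α) (f : α → Timed β) :
    (x >>= f).steps = x.steps + (f x.val).steps := rfl
@[simp] theorem val_tick : tick.val = () := rfl
@[simp] theorem steps_tick : tick.steps = 1 := rfl
@[simp] theorem val_same [DecidableEq α] (a b : α) : (same a b).val = decide (a = b) := rfl
@[simp] theorem steps_same [DecidableEq α] (a b : α) : (same a b).steps = 1 := rfl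
@[simp] theorem val_less (a b : ℕ) : (less a b).val = decide (a < b) := rfl
@[simp] theorem steps_less (a b : ℕ) : (less a b).steps = 1 := rfl
@[simp] theorem val_load (A : α → β) (i : α) : (load A i).val = A i := rfl
@[simp] theorem steps_load (A : α → β) (i : α) : (load A i).steps = 1 := rfl
@[simp] theorem val_store [DecidableEq α] (A : α → β) (i : α) (x : β) :
    (store A i x).val = Function.update A i x := rfl
@[simp] theorem steps_store [DecidableEq α] (A : α → β) (i : α) (x : β) :
    (store A i x).steps = 1 := rfl

@[simp] theorem val_append (xs ys : List α) : (append xs ys).val = xs ++ ys := by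
  induction xs with
  | nil => simp [append]
  | cons x xs ih => simp [append, ih]

@[simp] theorem steps_append (xs ys : List α) : (append xs ys).steps = xs.length + 1 := by
  induction xs with
  | nil => simp [append]
  | cons x xs ih => simp [append, ih]; omega

@[simp] theorem val_reverseOnto (xs ys : List α) :
    (reverseOnto xs ys).val = xs.reverse ++ ys := by
  induction xs generalizing ys with
  | nil => simp [reverseOnto]
  | cons x xs ih => simp [reverseOnto, ih]

@[simp] theorem steps_reverseOnto (xs ys : List α) :
    (reverseOnto xs ys).steps = xs.length + 1 := by
  induction xs generalizing ys with
  | nil => simp [reverseOnto]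
  | cons x xs ih => simp [reverseOnto, ih]; omega

@[simp] theorem val_reverse (xs : List α) : (reverse xs).val = xs.reverse := by simp [reverse]

@[simp] theorem steps_reverse (xs : List α) : (reverse xs).steps = xs.length + 2 := by
  simp [reverse]; omega

@[simp] theorem val_length (xs : List α) : (length xs).val = xs.length := by
  induction xs with
  | nil => simp [length]
  | cons x xs ih => simp [length, ih]

@[simp] theorem steps_length (xs : List α) : (length xs).steps = xs.length + 1 := by
  induction xs with
  | nil => simp [length]
  | cons x xs ih => simp [length, ih]; omega

@[simp] theorem val_map (f : α → Timed β) (xs : List α) :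
    (map f xs).val = xs.map fun x => (f x).val := by
  induction xs with
  | nil => simp [map]
  | cons x xs ih => simp [map, ih]

theorem steps_map (f : α → Timed β) (xs : List α) :
    (map f xs).steps = (xs.map fun x => (f x).steps + 1).sum + 1 := by
  induction xs with
  | nil => simp [map]
  | cons x xs ih => simp [map, ih]; omega

@[simp] theorem val_flatMap (f : α → Timed (List β)) (xs : List α) :
    (flatMap f xs).val = xs.flatMap fun x => (f x).val := by
  induction xs with
  | nil => simp [flatMap]
  | cons x xs ih => simp [flatMap, ih]

theorem steps_flatMap (f : α → Timed (List β)) (xs : List α) :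
    (flatMap f xs).steps = (xs.map fun x => (f x).steps + (f x).val.length + 2).sum + 1 := by
  induction xs with
  | nil => simp [flatMap]
  | cons x xs ih => simp [flatMap, ih]; omega

@[simp] theorem val_flatten (xss : List (List α)) : (flatten xss).val = xss.flatten := by
  simp [flatten, List.flatMap_id']

theorem steps_flatten (xss : List (List α)) :
    (flatten xss).steps = xss.flatten.length + 2 * xss.length + 2 := by
  simp only [flatten, steps_bind, steps_tick, steps_flatMap, steps_pure, val_pure]
  induction xss with
  | nil => simp
  | cons x xs ih => simp at ih ⊢; omega

end Timed

open Timed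

/-! ### The relative order of two entries of a list -/

namespace List

variable {α β : Type}

/-- `[x, y].Sublist l` is the encoding of "x stands before y" used throughout. On the entries of a
duplicate-free list it is a strict total order, and it determines the list. -/
theorem pair_sublist_cons {x y z : α} {l : List α} :
    [x, y].Sublist (z :: l) ↔ (x = z ∧ y ∈ l) ∨ [x, y].Sublist l := by
  rw [sublist_cons_iff]
  constructor
  · rintro (h | ⟨r, hr, h⟩)
    · exact Or.inr h
    · simp only [cons.injEq] at hr
      obtain ⟨rfl, rfl⟩ := hr
      exact Or.inl ⟨rfl, by simpa using h⟩
  · rintro (⟨rfl, h⟩ | h)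
    · exact Or.inr ⟨[y], rfl, by simpa using h⟩
    · exact Or.inl h

theorem pair_sublist_mem {x y : α} {l : List α} (h : [x, y].Sublist l) : x ∈ l ∧ y ∈ l :=
  ⟨h.subset (by simp), h.subset (by simp)⟩

theorem pair_sublist_append {x y : α} {l m : List α} :
    [x, y].Sublist (l ++ m) ↔ [x, y].Sublist l ∨ (x ∈ l ∧ y ∈ m) ∨ [x, y].Sublist m := by
  induction l with
  | nil => simp
  | cons z l ih => simp only [cons_append, pair_sublist_cons, ih, mem_append, mem_cons]; tauto

theorem pair_sublist_reverse {x y : α} {l : List α} :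
    [x, y].Sublist l.reverse ↔ [y, x].Sublist l := by
  rw [← reverse_sublist, reverse_reverse]; rfl

theorem pair_sublist_total {x y : α} {l : List α} (hx : x ∈ l) (hy : y ∈ l) (h : x ≠ y) :
    [x, y].Sublist l ∨ [y, x].Sublist l := by
  induction l with
  | nil => simp at hx
  | cons z l ih => simp only [pair_sublist_cons, mem_cons] at *; grind

theorem pair_sublist_asymm {x y : α} {l : List α} (hl : l.Nodup) (h : [x, y].Sublist l) :
    ¬ [y, x].Sublist l := by
  induction l with
  | nil => simp at h
  | cons z l ih =>
    have := fun a b => @pair_sublist_mem α a b l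
    simp only [pair_sublist_cons, nodup_cons] at *; grind

theorem pair_sublist_ne {x y : α} {l : List α} (hl : l.Nodup) (h : [x, y].Sublist l) :
    x ≠ y := by
  rintro rfl
  exact pair_sublist_asymm hl h h

theorem pair_sublist_filter {x y : α} {p : α → Bool} {l : List α} :
    [x, y].Sublist (l.filter p) ↔ p x ∧ p y ∧ [x, y].Sublist l := by
  induction l with
  | nil => simp
  | cons z l ih =>
    rw [filter_cons]
    split_ifs with hz
    · simp only [pair_sublist_cons, ih, mem_filter]; grind
    · simp only [pair_sublist_cons, ih]; grind

theorem pair_sublist_flatten {x y : α} {L : List (List α)} :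
    [x, y].Sublist L.flatten ↔
      (∃ b ∈ L, [x, y].Sublist b) ∨ ∃ b c, [b, c].Sublist L ∧ x ∈ b ∧ y ∈ c := by
  induction L with
  | nil => simp
  | cons b L ih =>
    simp only [flatten_cons, pair_sublist_append, ih, pair_sublist_cons, mem_flatten, mem_cons]
    constructor
    · rintro (h | ⟨h, c, hc, hy⟩ | ⟨c, hc, h⟩ | ⟨c, d, h, hx, hy⟩)
      · exact Or.inl ⟨b, Or.inl rfl, h⟩
      · exact Or.inr ⟨b, c, Or.inl ⟨rfl, hc⟩, h, hy⟩
      · exact Or.inl ⟨c, Or.inr hc, h⟩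
      · exact Or.inr ⟨c, d, Or.inr h, hx, hy⟩
    · rintro (⟨c, rfl | hc, h⟩ | ⟨c, d, ⟨rfl, hc⟩ | h, hx, hy⟩)
      · exact Or.inl h
      · exact Or.inr (Or.inr (Or.inl ⟨c, hc, h⟩))
      · exact Or.inr (Or.inl ⟨hx, d, hc, hy⟩)
      · exact Or.inr (Or.inr (Or.inr ⟨c, d, h, hx, hy⟩))

/-- Two duplicate-free lists are equal if they have the same entries in the same order. -/
theorem eq_of_pair_sublist {l m : List α} (hl : l.Nodup) (hm : m.Nodup)
    (hmem : ∀ x, x ∈ l ↔ x ∈ m) (h : ∀ x y, [x, y].Sublist l → [x, y].Sublist m) : l = m := by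
  have hp : l.Perm m := (perm_ext_iff_of_nodup hl hm).2 hmem
  refine hp.eq_of_pairwise (le := fun x y => [x, y].Sublist m) ?_ ?_ ?_
  · intro a b _ _ h1 h2
    exact absurd h2 (pair_sublist_asymm hm h1)
  · exact pairwise_iff_forall_sublist.2 fun {a b} hab => h a b hab
  · exact pairwise_iff_forall_sublist.2 fun {a b} hab => hab

end List

/-! ### Insertion by block moves, and labels -/

namespace LineOrdering

variable {V L : Type} [DecidableEq V] [DecidableEq L]

/-- The exchange of two consecutive nonempty blocks, the first of which has larger ranks. -/
def IsRankMove {β : Type} (r : β → ℕ) (π ρ : List β) : Prop :=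
  ∃ a b c d, b ≠ [] ∧ c ≠ [] ∧ π = a ++ b ++ c ++ d ∧ ρ = a ++ c ++ b ++ d ∧
    ∀ x ∈ b, ∀ y ∈ c, r y < r x

/-- In a sequence sorted by rank, the first block that is not below `k` is a threshold: no later
block is below `k` either. -/
theorem splitBelow_spec (pos : L → ℕ) (k : ℕ) (s : List (List L))
    (hs : s.Pairwise fun a b => (rank pos a).val < (rank pos b).val) :
    (splitBelow pos k s).val.1 ++ (splitBelow pos k s).val.2 = s ∧
    (∀ b ∈ (splitBelow pos k s).val.1, (rank pos b).val < k) ∧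
    ∀ b ∈ (splitBelow pos k s).val.2, k ≤ (rank pos b).val := by
  induction s with
  | nil => simp [splitBelow]
  | cons b s ih =>
    obtain ⟨h1, h2, h3⟩ := ih hs.of_cons
    simp only [splitBelow, val_bind, val_less]
    by_cases h : (rank pos b).val < k
    · simp [h, h1]
      exact ⟨h2, h3⟩
    · have := (List.pairwise_cons.1 hs).1
      simp [h]
      constructor
      · omega
      · intro a ha
        have := this a ha
        omega

/-- The whole current order is `xs.reverse ++ s ++ ys`, because `xs` lists the nearest block first.
A block `x` jumps over `front`, all of whose blocks have smaller rank, so the move is monotone and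
`s` stays sorted. -/
theorem insertLeft_spec (pos : L → ℕ) (ys xs s : List (List L))
    (hs : s.Pairwise fun a b => (rank pos a).val < (rank pos b).val)
    (hxs : ∀ x ∈ xs, ∀ y ∈ s, (rank pos x).val ≠ (rank pos y).val)
    (hx : xs.Pairwise fun a b => (rank pos a).val ≠ (rank pos b).val) :
    (insertLeft pos ys xs s).val.1.Perm (xs ++ s) ∧
    ((insertLeft pos ys xs s).val.1.Pairwise fun a b => (rank pos a).val < (rank pos b).val) ∧
    ((xs.reverse ++ s ++ ys) :: (insertLeft pos ys xs s).val.2).IsChain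
      (IsRankMove fun b => (rank pos b).val) ∧
    ((xs.reverse ++ s ++ ys) :: (insertLeft pos ys xs s).val.2).getLast? =
      some ((insertLeft pos ys xs s).val.1 ++ ys) ∧
    (insertLeft pos ys xs s).val.2.length ≤ xs.length := by
  induction xs generalizing s with
  | nil => simp [insertLeft, hs]
  | cons x xs ih =>
    obtain ⟨h1, h2, h3⟩ := splitBelow_spec pos (rank pos x).val s hs
    simp only [insertLeft, val_bind, val_append]
    generalize hsp : (splitBelow pos (rank pos x).val s).val = fb at *
    obtain ⟨front, back⟩ := fb
    simp only at h1 h2 h3 ⊢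
    subst h1
    have hx' := List.pairwise_cons.1 hx
    have hs' := List.pairwise_append.1 hs
    have key : (front ++ x :: back).Pairwise
        fun a b => (rank pos a).val < (rank pos b).val := by
      rw [List.pairwise_append, List.pairwise_cons]
      refine ⟨hs'.1, ⟨fun b hb => ?_, hs'.2.1⟩, fun a ha b hb => ?_⟩
      · exact lt_of_le_of_ne (h3 b hb) (hxs x (by simp) b (by simp [hb]))
      · rcases List.mem_cons.1 hb with rfl | hb
        · exact h2 a ha
        · exact hs'.2.2 a ha b hb
    obtain ⟨i1, i2, i3, i4, i5⟩ := ih (front ++ x :: back) key (by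
      intro y hy z hz
      rcases List.mem_append.1 hz with h | h
      · exact hxs y (by simp [hy]) z (by simp [h])
      · rcases List.mem_cons.1 h with rfl | h
        · exact (hx'.1 y hy).symm
        · exact hxs y (by simp [hy]) z (by simp [h])) hx'.2
    have perm : (insertLeft pos ys xs (front ++ x :: back)).val.1.Perm
        (x :: xs ++ (front ++ back)) := by
      refine i1.trans ?_
      rw [List.cons_append]
      refine (List.Perm.append_left xs List.perm_middle).trans ?_
      exact List.perm_middle
    cases front with
    -- With nothing to jump over, no order is recorded: `x` joins the sorted part where it stands,
    -- and the overall order is unchanged.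
    | nil =>
      refine ⟨perm, i2, ?_, ?_, ?_⟩
      · simpa using i3
      · simpa using i4
      · simp only [val_pure, List.length_cons]; omega
    | cons f front =>
      simp only [snapshot, val_bind, val_append, val_reverseOnto, val_pure]
      refine ⟨perm, i2, ?_, ?_, ?_⟩
      · rw [List.isChain_cons_cons]
        refine ⟨⟨xs.reverse, [x], f :: front, back ++ ys, by simp, by simp, by simp, by simp,
          ?_⟩, by simpa using i3⟩
        intro a ha b hb
        rw [List.mem_singleton.1 ha]
        exact h2 b hb
      · rw [List.getLast?_cons_cons]
        simpa using i4
      · simp only [List.length_cons]; omega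

/-- Here a block jumps leftwards over `back`. The final sequence `t` is existential, since the
procedure returns only the recorded orders. -/
theorem insertRight_spec (pos : L → ℕ) (ys s : List (List L))
    (hs : s.Pairwise fun a b => (rank pos a).val < (rank pos b).val)
    (hys : ∀ x ∈ ys, ∀ y ∈ s, (rank pos x).val ≠ (rank pos y).val)
    (hy : ys.Pairwise fun a b => (rank pos a).val ≠ (rank pos b).val) :
    ∃ t : List (List L), t.Perm (s ++ ys) ∧
    (t.Pairwise fun a b => (rank pos a).val < (rank pos b).val) ∧
    ((s ++ ys) :: (insertRight pos ys s).val).IsChain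
      (IsRankMove fun b => (rank pos b).val) ∧
    ((s ++ ys) :: (insertRight pos ys s).val).getLast? = some t ∧
    (insertRight pos ys s).val.length ≤ ys.length := by
  induction ys generalizing s with
  | nil => exact ⟨s, by simp [insertRight, hs]⟩
  | cons x ys ih =>
    obtain ⟨h1, h2, h3⟩ := splitBelow_spec pos (rank pos x).val s hs
    simp only [insertRight, val_bind, val_append]
    generalize hsp : (splitBelow pos (rank pos x).val s).val = fb at *
    obtain ⟨front, back⟩ := fb
    simp only at h1 h2 h3 ⊢
    subst h1
    have hx' := List.pairwise_cons.1 hy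
    have hs' := List.pairwise_append.1 hs
    have h3' : ∀ b ∈ back, (rank pos x).val < (rank pos b).val := fun b hb =>
      lt_of_le_of_ne (h3 b hb) (hys x (by simp) b (by simp [hb]))
    have key : (front ++ x :: back).Pairwise
        fun a b => (rank pos a).val < (rank pos b).val := by
      rw [List.pairwise_append, List.pairwise_cons]
      refine ⟨hs'.1, ⟨h3', hs'.2.1⟩, fun a ha b hb => ?_⟩
      rcases List.mem_cons.1 hb with rfl | hb
      · exact h2 a ha
      · exact hs'.2.2 a ha b hb
    obtain ⟨t, i1, i2, i3, i4, i5⟩ := ih (front ++ x :: back) key (by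
      intro y hy' z hz
      rcases List.mem_append.1 hz with h | h
      · exact hys y (by simp [hy']) z (by simp [h])
      · rcases List.mem_cons.1 h with rfl | h
        · exact (hx'.1 y hy').symm
        · exact hys y (by simp [hy']) z (by simp [h])) hx'.2
    have perm : t.Perm (front ++ back ++ x :: ys) := by
      refine i1.trans ?_
      rw [List.append_assoc, List.append_assoc]
      refine List.Perm.append_left front ?_
      rw [List.cons_append]
      exact List.perm_middle.symm
    refine ⟨t, perm, i2, ?_⟩
    cases back with
    | nil =>
      refine ⟨?_, ?_, ?_⟩
      · simpa using i3
      · simpa using i4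
      · simp only [val_pure, List.length_cons]; omega
    | cons f back =>
      simp only [snapshot, val_bind, val_append, val_reverseOnto, val_pure]
      refine ⟨?_, ?_, ?_⟩
      · rw [List.isChain_cons_cons]
        refine ⟨⟨front, f :: back, [x], ys, by simp, by simp, by simp, by simp,
          ?_⟩, by simpa using i3⟩
        intro a ha b hb
        rw [List.mem_singleton.1 hb]
        exact h3' a ha
      · rw [List.getLast?_cons_cons]
        simpa using i4
      · simp only [List.length_cons]; omega

/-- `left` is a reversed accumulator, so `left.reverse ++ gs.flatten` is invariant under the
recursion. -/
theorem locate_spec {β : Type} (n : ℕ) (left : List β) (gs : List (List β)) :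
    (locate n left gs).val.1.reverse ++ (locate n left gs).val.2.1 ++ (locate n left gs).val.2.2
      = left.reverse ++ gs.flatten ∧
    ((∃ g ∈ gs, g.length = n) →
      (locate n left gs).val.2.1 ∈ gs ∧ (locate n left gs).val.2.1.length = n) := by
  induction gs generalizing left with
  | nil => simp [locate]
  | cons g gs ih =>
    simp only [locate, val_bind, val_length, val_same]
    by_cases h : g.length = n
    · simp [h]
    · simp only [h, decide_false, Bool.false_eq_true, if_false, val_bind, val_reverseOnto]
      obtain ⟨h1, h2⟩ := ih (g.reverse ++ left)
      refine ⟨by rw [h1]; simp, ?_⟩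
      rintro ⟨g', hg', hn⟩
      have : g' ∈ gs := by
        rcases List.mem_cons.1 hg' with rfl | h'
        · exact absurd hn h
        · exact h'
      obtain ⟨h3, h4⟩ := h2 ⟨g', this, hn⟩
      exact ⟨List.mem_cons_of_mem _ h3, h4⟩

theorem maxSize_spec {β : Type} (gs : List (List β)) :
    (∀ g ∈ gs, g.length ≤ (maxSize gs).val) ∧
    (gs ≠ [] → ∃ g ∈ gs, g.length = (maxSize gs).val) := by
  induction gs with
  | nil => simp
  | cons g gs ih =>
    simp only [maxSize, val_bind, val_length, val_less]
    obtain ⟨h1, h2⟩ := ih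
    by_cases h : (maxSize gs).val < g.length
    · simp only [h, decide_true, if_true, val_pure]
      refine ⟨fun k hk => ?_, fun _ => ⟨g, by simp⟩⟩
      rcases List.mem_cons.1 hk with rfl | hk
      · exact le_rfl
      · exact (h1 k hk).trans h.le
    · simp only [h, decide_false, Bool.false_eq_true, if_false, val_pure]
      refine ⟨fun k hk => ?_, fun _ => ?_⟩
      · rcases List.mem_cons.1 hk with rfl | hk
        · omega
        · exact h1 k hk
      · by_cases hgs : gs = []
        · subst hgs
          refine ⟨g, by simp, ?_⟩
          simp only [maxSize, val_bind, val_pure] at h ⊢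
          omega
        · obtain ⟨k, hk, hk'⟩ := h2 hgs
          exact ⟨k, by simp [hk], hk'⟩

theorem labelList_val (k : ℕ) (ls : List L) (A : L → ℕ) (x : L) :
    (labelList k ls A).val x = if x ∈ ls then k else A x := by
  induction ls generalizing A with
  | nil => simp [labelList]
  | cons l ls ih =>
    simp only [labelList, val_bind, val_store, ih, Function.update_apply, List.mem_cons]
    grind

theorem labelLists_of_not_mem (k : ℕ) (gs : List (List L)) (A : L → ℕ) (x : L)
    (hx : x ∉ gs.flatten) : (labelLists k gs A).val x = A x := by
  induction gs generalizing k A with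
  | nil => simp [labelLists]
  | cons g gs ih =>
    simp only [List.flatten_cons, List.mem_append, not_or] at hx
    simp only [labelLists, val_bind, ih _ _ hx.2, labelList_val, hx.1, if_false]

/-- Since no line occurs twice, the labels written for later lists never overwrite an earlier one.
-/
theorem labelLists_of_mem (k : ℕ) (gs : List (List L)) (A : L → ℕ) (x : L)
    (hg : gs.flatten.Nodup) (i : ℕ) (hi : i < gs.length) (hx : x ∈ gs[i]) :
    (labelLists k gs A).val x = k + i := by
  induction gs generalizing k A i with
  | nil => simp at hi
  | cons g gs ih =>
    simp only [labelLists, val_bind]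
    rw [List.flatten_cons, List.nodup_append] at hg
    cases i with
    | zero =>
      have h0 : x ∈ g := by simpa using hx
      rw [labelLists_of_not_mem _ _ _ _ fun h => hg.2.2 x h0 x h rfl, labelList_val, if_pos h0]
      rfl
    | succ i =>
      rw [ih _ _ hg.2.1 i (by simpa using hi) (by simpa using hx)]
      omega

end LineOrdering

/-! ### Which pairs cross in a monotone sequence of block moves -/

namespace MetroNetwork

/-- A block move all of whose crossings are between pairs of lines that are in different relative
orders in `σ` and `τ`, and which turns the former order into the latter one. -/
def IsCrossing {L : Type} (σ τ π ρ : List L) : Prop :=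
  ∃ a b c d, b ≠ [] ∧ c ≠ [] ∧ π = a ++ b ++ c ++ d ∧ ρ = a ++ c ++ b ++ d ∧
    ∀ x ∈ b, ∀ y ∈ c, [x, y].Sublist σ ∧ [y, x].Sublist τ

/-- A sequence of block moves from `σ` to `τ` in which only those pairs cross that have to. -/
structure IsSorting {L : Type} (σ τ : List L) (O : List (List L)) : Prop where
  head : O.head? = some σ
  last : O.getLast? = some τ
  chain : O.IsChain (IsCrossing σ τ)

section

variable {L : Type} {σ τ π ρ : List L}

theorem IsCrossing.symm (h : IsCrossing σ τ π ρ) : IsCrossing τ σ ρ π := by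
  obtain ⟨a, b, c, d, hb, hc, rfl, rfl, h⟩ := h
  exact ⟨a, c, b, d, hc, hb, rfl, rfl, fun x hx y hy => (h y hy x hx).symm⟩

theorem IsCrossing.reverse (h : IsCrossing σ τ π ρ) :
    IsCrossing σ.reverse τ.reverse π.reverse ρ.reverse := by
  obtain ⟨a, b, c, d, hb, hc, rfl, rfl, h⟩ := h
  refine ⟨d.reverse, c.reverse, b.reverse, a.reverse, by simpa, by simpa, by simp, by simp, ?_⟩
  intro x hx y hy
  rw [List.pair_sublist_reverse, List.pair_sublist_reverse]
  exact h y (by simpa using hy) x (by simpa using hx)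

theorem IsCrossing.isMonotoneBlockMove (h : IsCrossing σ τ π ρ) : IsMonotoneBlockMove τ π ρ := by
  obtain ⟨a, b, c, d, hb, hc, h1, h2, h⟩ := h
  exact ⟨a, b, c, d, hb, hc, h1, h2, fun x hx y hy => (h x hx y hy).2⟩

theorem IsMonotoneBlockMove.isBlockMove (h : IsMonotoneBlockMove τ π ρ) : IsBlockMove π ρ := by
  obtain ⟨a, b, c, d, hb, hc, h1, h2, h⟩ := h
  exact ⟨a, b, c, d, hb, hc, h1, h2⟩

theorem IsBlockMove.perm (h : IsBlockMove π ρ) : ρ.Perm π := by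
  obtain ⟨a, b, c, d, -, -, rfl, rfl⟩ := h
  simp only [List.append_assoc]
  refine List.Perm.append_left a ?_
  rw [← List.append_assoc, ← List.append_assoc]
  exact List.Perm.append_right d List.perm_append_comm

theorem perm_of_isChain {O : List (List L)} (h : (σ :: O).IsChain IsBlockMove) :
    ∀ π ∈ σ :: O, π.Perm σ := by
  induction O generalizing σ with
  | nil => simp
  | cons π O ih =>
    rw [List.isChain_cons_cons] at h
    intro ρ hρ
    rcases List.mem_cons.1 hρ with rfl | hρ
    · exact List.Perm.refl _
    · exact (ih h.2 ρ hρ).trans h.1.perm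

/-- An inversion created by a block move is one of the pairs exchanged. -/
theorem IsCrossing.pair_sublist (h : IsCrossing σ τ π ρ) {x y : L} (hπ : [x, y].Sublist π) :
    [x, y].Sublist ρ ∨ ([x, y].Sublist σ ∧ [y, x].Sublist τ) := by
  obtain ⟨a, b, c, d, -, -, rfl, rfl, h⟩ := h
  have := h x
  simp only [List.pair_sublist_append, List.mem_append] at hπ ⊢
  grind

theorem IsCrossing.inverted (h : IsCrossing σ τ π ρ) (hπ : π.Nodup)
    {x y : L} (hs : [x, y].Sublist π) (hs' : [y, x].Sublist ρ) :
    [x, y].Sublist σ ∧ [y, x].Sublist τ := by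
  have hρ : ρ.Nodup := h.isMonotoneBlockMove.isBlockMove.perm.nodup_iff.2 hπ
  exact (h.pair_sublist hs).resolve_left (List.pair_sublist_asymm hρ hs')

/-- A monotone move only removes inversions with respect to `τ`. So every inversion still present,
and hence every pair exchanged, goes back to `σ`; the hypothesis `H` carries this along the chain.
-/
theorem isChain_isCrossing_of_monotone (hτ : τ.Nodup) {O : List (List L)}
    (h : (π :: O).IsChain (IsMonotoneBlockMove τ))
    (H : ∀ x y, [x, y].Sublist π → [y, x].Sublist τ → [x, y].Sublist σ) :
    (π :: O).IsChain (IsCrossing σ τ) := by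
  induction O generalizing π with
  | nil => simp
  | cons ρ O ih =>
    rw [List.isChain_cons_cons] at h ⊢
    obtain ⟨⟨a, b, c, d, hb, hc, rfl, rfl, hm⟩, h2⟩ := h
    have key : IsCrossing σ τ (a ++ b ++ c ++ d) (a ++ c ++ b ++ d) := by
      refine ⟨a, b, c, d, hb, hc, rfl, rfl, fun x hx y hy => ?_⟩
      have hyx := hm x hx y hy
      refine ⟨H x y ?_ hyx, hyx⟩
      simp only [List.pair_sublist_append, List.mem_append]
      tauto
    refine ⟨key, ih h2 fun x y h1 h3 => ?_⟩
    -- Either the pair stood this way before the move, or it has just been exchanged into the order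
    -- of `τ`; the latter contradicts `h3`.
    rcases key.symm.pair_sublist h1 with h4 | h4
    · exact H x y h4 h3
    · exact absurd h4.1 (List.pair_sublist_asymm hτ h3)

theorem IsSorting.of_monotone (hτ : τ.Nodup) {O : List (List L)} (head : O.head? = some σ)
    (last : O.getLast? = some τ) (h : O.IsChain (IsMonotoneBlockMove τ)) : IsSorting σ τ O := by
  refine ⟨head, last, ?_⟩
  cases O with
  | nil => simp
  | cons π O =>
    obtain rfl : π = σ := by simpa using head
    exact isChain_isCrossing_of_monotone hτ h fun _ _ h _ => h

namespace IsSorting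

variable {O : List (List L)}

theorem reverse (h : IsSorting σ τ O) : IsSorting τ σ O.reverse := by
  refine ⟨by simpa using h.last, by simpa using h.head, ?_⟩
  rw [List.isChain_reverse]
  exact h.chain.imp fun _ _ h => h.symm

theorem map_reverse (h : IsSorting σ τ O) :
    IsSorting σ.reverse τ.reverse (O.map List.reverse) := by
  refine ⟨by simp [h.head], by simp [h.last], ?_⟩
  rw [List.isChain_map]
  exact h.chain.imp fun _ _ h => h.reverse

theorem ne_nil (h : IsSorting σ τ O) : O ≠ [] := by
  rintro rfl
  simpa using h.head

theorem monotone (h : IsSorting σ τ O) : O.IsChain (IsMonotoneBlockMove τ) :=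
  h.chain.imp fun _ _ h => h.isMonotoneBlockMove

theorem isBlockMove (h : IsSorting σ τ O) : O.IsChain IsBlockMove :=
  h.monotone.imp fun _ _ h => h.isBlockMove

theorem perm (h : IsSorting σ τ O) : ∀ π ∈ O, π.Perm σ := by
  cases O with
  | nil => simp
  | cons π O =>
    obtain rfl : π = σ := by simpa using h.head
    exact perm_of_isChain h.isBlockMove

variable [DecidableEq L]

/-- A pair is exchanged only from its order in `σ` to its order in `τ`. The two hypotheses say that
the pair is not waiting for this in either orientation, and no move makes it wait again. This covers
pairs that need not cross as well as pairs that have crossed. -/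
theorem countP_eq_zero (hσ : σ.Nodup) (hπ : π.Nodup) (h : (π :: O).IsChain (IsCrossing σ τ)) {x y : L}
    (hxy : ¬ ([x, y].Sublist π ∧ [x, y].Sublist σ ∧ [y, x].Sublist τ))
    (hyx : ¬ ([y, x].Sublist π ∧ [y, x].Sublist σ ∧ [x, y].Sublist τ)) :
    ((π :: O).zip O).countP (fun p => decide (Swapped x y p.1 p.2)) = 0 := by
  induction O generalizing π with
  | nil => simp
  | cons ρ O ih =>
    rw [List.isChain_cons_cons] at h
    have hρ := h.1.isMonotoneBlockMove.isBlockMove.perm.nodup_iff.2 hπ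
    have h0 : ¬ Swapped x y π ρ := by
      rintro (⟨h1, h2⟩ | ⟨h1, h2⟩)
      · exact hxy ⟨h1, h.1.inverted hπ h1 h2⟩
      · exact hyx ⟨h1, h.1.inverted hπ h1 h2⟩
    rw [List.zip_cons_cons, List.countP_cons, ih hρ h.2]
    · simp [h0]
    · rintro ⟨h1, h2, h3⟩
      rcases h.1.symm.pair_sublist h1 with h4 | h4
      · exact hxy ⟨h4, h2, h3⟩
      · exact List.pair_sublist_asymm hσ h2 h4.2
    · rintro ⟨h1, h2, h3⟩
      rcases h.1.symm.pair_sublist h1 with h4 | h4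
      · exact hyx ⟨h4, h2, h3⟩
      · exact List.pair_sublist_asymm hσ h2 h4.2

/-- After its first crossing a pair is in its final order, and `countP_eq_zero` applies to the rest
of the chain. -/
theorem countP_le_one (hσ : σ.Nodup) (hπ : π.Nodup) (h : (π :: O).IsChain (IsCrossing σ τ))
    (x y : L) : ((π :: O).zip O).countP (fun p => decide (Swapped x y p.1 p.2)) ≤ 1 := by
  induction O generalizing π with
  | nil => simp
  | cons ρ O ih =>
    rw [List.isChain_cons_cons] at h
    have hρ := h.1.isMonotoneBlockMove.isBlockMove.perm.nodup_iff.2 hπ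
    rw [List.zip_cons_cons, List.countP_cons]
    by_cases h0 : Swapped x y π ρ
    · have : ((ρ :: O).zip O).countP (fun p => decide (Swapped x y p.1 p.2)) = 0 := by
        rcases h0 with ⟨h1, h2⟩ | ⟨h1, h2⟩
        · have h3 := h.1.inverted hπ h1 h2
          exact countP_eq_zero hσ hρ h.2 (fun h4 => List.pair_sublist_asymm hρ h4.1 h2)
            fun h4 => List.pair_sublist_asymm hσ h3.1 h4.2.1
        · have h3 := h.1.inverted hπ h1 h2
          exact countP_eq_zero hσ hρ h.2 (fun h4 => List.pair_sublist_asymm hσ h3.1 h4.2.1)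
            fun h4 => List.pair_sublist_asymm hρ h4.1 h2
      simp [this, h0]
    · simpa [h0] using ih hρ h.2

/-- Two lines cross at most once in a sorting, and only if they have to. -/
theorem countP_swapped (hσ : σ.Nodup) (h : IsSorting σ τ O) (x y : L) :
    (O.zip O.tail).countP (fun p => decide (Swapped x y p.1 p.2)) ≤ 1 ∧
    (([x, y].Sublist σ ↔ [x, y].Sublist τ) → ([y, x].Sublist σ ↔ [y, x].Sublist τ) →
      (O.zip O.tail).countP (fun p => decide (Swapped x y p.1 p.2)) = 0) := by
  obtain ⟨hd, -, hc⟩ := h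
  cases O with
  | nil => simp
  | cons π O =>
    obtain rfl : π = σ := by simpa using hd
    refine ⟨countP_le_one hσ hσ hc x y, fun h1 h2 => countP_eq_zero hσ hσ hc ?_ ?_⟩
    · rintro ⟨-, h3, h4⟩
      exact List.pair_sublist_asymm hσ h3 (h2.2 h4)
    · rintro ⟨-, h3, h4⟩
      exact List.pair_sublist_asymm hσ h3 (h1.2 h4)

end IsSorting

/-- Replacing every entry by a nonempty sequence of lines preserves monotone block moves. -/
theorem IsMonotoneBlockMove.flatten {G π ρ : List (List L)} (h : IsMonotoneBlockMove G π ρ)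
    (hπ : [] ∉ π) : IsMonotoneBlockMove G.flatten π.flatten ρ.flatten := by
  obtain ⟨a, b, c, d, hb, hc, rfl, rfl, h⟩ := h
  refine ⟨a.flatten, b.flatten, c.flatten, d.flatten, ?_, ?_, by simp, by simp, ?_⟩
  · obtain ⟨x, b, rfl⟩ := List.exists_cons_of_ne_nil hb
    have : x ≠ [] := by rintro rfl; simp at hπ
    simp [this]
  · obtain ⟨x, c, rfl⟩ := List.exists_cons_of_ne_nil hc
    have : x ≠ [] := by rintro rfl; simp at hπ
    simp [this]
  · intro x hx y hy
    obtain ⟨p, hp, hx⟩ := List.mem_flatten.1 hx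
    obtain ⟨q, hq, hy⟩ := List.mem_flatten.1 hy
    exact List.pair_sublist_flatten.2 (Or.inr ⟨q, p, h p hp q hq, hy, hx⟩)

theorem isChain_map_flatten {G π : List (List L)} {O : List (List (List L))}
    (h : (π :: O).IsChain (IsMonotoneBlockMove G)) (hπ : [] ∉ π) :
    ((π :: O).map List.flatten).IsChain (IsMonotoneBlockMove G.flatten) := by
  induction O generalizing π with
  | nil => simp
  | cons ρ O ih =>
    rw [List.isChain_cons_cons] at h
    simp only [List.map_cons] at ih ⊢
    rw [List.isChain_cons_cons]
    exact ⟨h.1.flatten hπ, ih h.2 fun h' => hπ (h.1.isBlockMove.perm.mem_iff.1 h')⟩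

end
end MetroNetwork

/-! ### Flattened lists, and pairs of disjoint edges in a bipartite graph -/

namespace List

variable {α : Type}

theorem pair_sublist_getElem {l : List α} {i j : ℕ} (hj : j < l.length) (hij : i < j) :
    [l[i], l[j]].Sublist l := by
  have h : l.Pairwise fun a b => [a, b].Sublist l :=
    pairwise_iff_forall_sublist.2 fun {a b} hab => hab
  exact pairwise_iff_getElem.1 h i j (hij.trans hj) hj hij

theorem nodup_of_nodup_flatten {l : List (List α)} (h : l.flatten.Nodup) (hl : [] ∉ l) :
    l.Nodup := by
  rw [nodup_flatten] at h
  refine h.2.imp_of_mem fun {a b} ha _ hab => ?_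
  rintro rfl
  obtain ⟨x, a, rfl⟩ := exists_cons_of_ne_nil (l := a) (by rintro rfl; exact hl ha)
  exact hab (a := x) (by simp) (by simp)

theorem eq_of_mem_of_nodup_flatten {l : List (List α)} (h : l.flatten.Nodup) {a b : List α}
    (ha : a ∈ l) (hb : b ∈ l) {x : α} (hxa : x ∈ a) (hxb : x ∈ b) : a = b := by
  by_contra hab
  rw [nodup_flatten] at h
  rcases pair_sublist_total ha hb hab with h' | h'
  · exact pairwise_iff_forall_sublist.1 h.2 h' hxa hxb
  · exact pairwise_iff_forall_sublist.1 h.2 h' hxb hxa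

end List

/-- Edges of a bipartite graph, given by their ends `i` and `j`, of which at most `n` meet in any
vertex and exactly `n` in some vertex: many pairs of edges are disjoint. -/
theorem sq_card_sub_le_card_disjoint {β : Type} [DecidableEq β] (K : Finset β) (i j : β → ℕ)
    (inj : ∀ a ∈ K, ∀ b ∈ K, i a = i b → j a = j b → a = b) (n : ℕ)
    (hi : ∀ c, (K.filter fun b => i b = c).card ≤ n)
    (hj : ∀ c, (K.filter fun b => j b = c).card ≤ n)
    (c : ℕ) (hc : (K.filter fun b => i b = c).card = n) :
    (K.card - n) ^ 2 ≤
      2 * ((K ×ˢ K).filter fun p => i p.1 ≠ i p.2 ∧ j p.1 ≠ j p.2).card := by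
  set P : β → Finset β := fun x => K.filter fun y => i x ≠ i y ∧ j x ≠ j y with hP
  have hD : ((K ×ˢ K).filter fun p => i p.1 ≠ i p.2 ∧ j p.1 ≠ j p.2).card =
      ∑ x ∈ K, (P x).card := by
    simp only [hP, Finset.card_filter, Finset.sum_product]
  set S := K.filter fun b => i b = c with hS
  have hSK : S ⊆ K := Finset.filter_subset _ _
  -- Each `x` outside the full star `S` is disjoint from at least `n - 1` edges of `S`, as at most
  -- one of them shares its other end. It is also disjoint from all but at most `2 * n - 1` edges of
  -- `K`. Adding the two bounds gives the claim.
  have key : ∀ x ∈ K \ S, K.card - n ≤ 2 * (P x).card := by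
    intro x hx
    obtain ⟨hxK, hxS⟩ := Finset.mem_sdiff.1 hx
    have hxc : i x ≠ c := fun h => hxS (by simp [hS, hxK, h])
    have h1 : n ≤ (P x).card + 1 := by
      have hone : (S.filter fun y => j y = j x).card ≤ 1 := by
        rw [Finset.card_le_one]
        intro a ha b hb
        simp only [hS, Finset.mem_filter] at ha hb
        exact inj a ha.1.1 b hb.1.1 (ha.1.2.trans hb.1.2.symm) (ha.2.trans hb.2.symm)
      have hsub : (S.filter fun y => ¬ j y = j x) ⊆ P x := by
        intro y hy
        simp only [hS, hP, Finset.mem_filter] at hy ⊢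
        exact ⟨hy.1.1, fun h => hxc (h.trans hy.1.2), fun h => hy.2 h.symm⟩
      have := Finset.card_filter_add_card_filter_not (s := S) (fun y => j y = j x)
      have := Finset.card_le_card hsub
      omega
    have h2 : K.card + 1 ≤ (P x).card + 2 * n := by
      have hcov : K ⊆ P x ∪ ((K.filter fun y => i y = i x) ∪
          (K.filter fun y => j y = j x).erase x) := by
        intro y hy
        simp only [hP, Finset.mem_union, Finset.mem_filter, Finset.mem_erase, hy, true_and]
        by_cases hxy : y = x
        · subst hxy; simp
        · by_cases h1 : i y = i x
          · simp [h1]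
          · by_cases h2 : j y = j x
            · simp [h2, hxy]
            · exact Or.inl ⟨fun h => h1 h.symm, fun h => h2 h.symm⟩
      have a1 := Finset.card_le_card hcov
      have a2 := Finset.card_union_le (P x) ((K.filter fun y => i y = i x) ∪
          (K.filter fun y => j y = j x).erase x)
      have a3 := Finset.card_union_le (K.filter fun y => i y = i x)
          ((K.filter fun y => j y = j x).erase x)
      have a4 : ((K.filter fun y => j y = j x).erase x).card + 1 =
          (K.filter fun y => j y = j x).card :=
        Finset.card_erase_add_one (by simp [hxK])
      have := hi (i x)
      have := hj (j x)
      omega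
    omega
  calc (K.card - n) ^ 2 = ∑ x ∈ K \ S, (K.card - n) := by
        rw [Finset.sum_const, Finset.card_sdiff_of_subset hSK, hc, smul_eq_mul, sq]
    _ ≤ ∑ x ∈ K \ S, 2 * (P x).card := Finset.sum_le_sum key
    _ ≤ ∑ x ∈ K, 2 * (P x).card :=
        Finset.sum_le_sum_of_subset Finset.sdiff_subset
    _ = _ := by rw [hD, Finset.mul_sum]

/-! ### Merged blocks as intersections of a left group with a right group -/

namespace LineOrdering

open MetroNetwork

variable {V L : Type} [DecidableEq V] [DecidableEq L]

/-- The index of the group of a line. -/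
abbrev label (gs : List (List L)) : L → ℕ := (labelLists 0 gs fun _ => 0).val

theorem label_of_mem {gs : List (List L)} (hg : gs.flatten.Nodup) {x : L} {i : ℕ}
    (hi : i < gs.length) (hx : x ∈ gs[i]) : label gs x = i := by
  simpa using labelLists_of_mem 0 gs (fun _ => 0) x hg i hi hx

theorem exists_mem_getElem_of_mem_flatten {gs : List (List L)} {x : L} (hx : x ∈ gs.flatten) :
    ∃ (i : ℕ) (hi : i < gs.length), x ∈ gs[i] := by
  obtain ⟨g, hg, hx⟩ := List.mem_flatten.1 hx
  obtain ⟨i, hi, rfl⟩ := List.mem_iff_getElem.1 hg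
  exact ⟨i, hi, hx⟩

theorem label_eq_iff {gs : List (List L)} (hg : gs.flatten.Nodup) {x y : L}
    (hx : x ∈ gs.flatten) (hy : y ∈ gs.flatten) :
    label gs x = label gs y ↔ ∃ g ∈ gs, x ∈ g ∧ y ∈ g := by
  obtain ⟨i, hi, hx'⟩ := exists_mem_getElem_of_mem_flatten hx
  constructor
  · intro h
    obtain ⟨j, hj, hy'⟩ := exists_mem_getElem_of_mem_flatten hy
    rw [label_of_mem hg hi hx', label_of_mem hg hj hy'] at h
    subst h
    exact ⟨_, List.getElem_mem hi, hx', hy'⟩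
  · rintro ⟨g, hgg, h1, h2⟩
    obtain ⟨j, hj, rfl⟩ := List.mem_iff_getElem.1 hgg
    rw [label_of_mem hg hj h1, label_of_mem hg hj h2]

theorem pair_sublist_of_label_lt {gs : List (List L)} (hg : gs.flatten.Nodup) {x y : L}
    (hx : x ∈ gs.flatten) (hy : y ∈ gs.flatten) (h : label gs x < label gs y) :
    [x, y].Sublist gs.flatten := by
  obtain ⟨i, hi, hx'⟩ := exists_mem_getElem_of_mem_flatten hx
  obtain ⟨j, hj, hy'⟩ := exists_mem_getElem_of_mem_flatten hy
  rw [label_of_mem hg hi hx', label_of_mem hg hj hy'] at h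
  exact List.pair_sublist_flatten.2 (Or.inr ⟨_, _, List.pair_sublist_getElem hj h, hx', hy'⟩)

theorem merge_flatten (lab : L → ℕ) (g : List L) :
    (merge lab g).val.flatten = g ∧ [] ∉ (merge lab g).val := by
  induction g with
  | nil => simp [merge]
  | cons a g ih =>
    simp only [merge, val_bind]
    generalize (merge lab g).val = B at *
    match B, ih with
    | [], ih => simpa using ih
    | [] :: rest, ih => simp at ih
    | (b :: bs) :: rest, ih =>
      simp only [val_bind, val_load, val_same]
      by_cases h : lab a = lab b
      · simpa [h] using ih
      · simpa [h] using ih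

/-- When the labels do not decrease along the group, equal labels are consecutive, so a maximal run
is a whole label class. -/
theorem merge_eq (lab : L → ℕ) (g : List L) (hg : g.Pairwise fun a b => lab a ≤ lab b) :
    (merge lab g).val = (g.map lab).dedup.map fun j => g.filter fun y => decide (lab y = j) := by
  induction g with
  | nil => simp [merge]
  | cons a g ih =>
    have ih' := ih hg.of_cons
    have hm := merge_flatten lab g
    have ha := (List.pairwise_cons.1 hg).1
    simp only [merge, val_bind]
    cases g with
    | nil => simp [merge]
    | cons b g =>
      have hnd := List.nodup_dedup ((b :: g).map lab)
      have hmd : ∀ j, j ∈ ((b :: g).map lab).dedup ↔ j ∈ (b :: g).map lab :=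
        fun j => List.mem_dedup
      generalize hDD : ((b :: g).map lab).dedup = D at *
      cases D with
      | nil =>
        rw [ih'] at hm
        simp at hm
      | cons j D =>
        have e1 : (List.filter (fun y => decide (lab y = j)) (b :: g)) ≠ [] := by
          intro h
          exact hm.2 (by rw [ih', List.map_cons, h]; simp)
        obtain ⟨b', bs, hb'⟩ := List.exists_cons_of_ne_nil e1
        -- The first class begins with the head of the remaining list, so comparing `a` with this
        -- entry decides whether `a` joins the class or opens a new one.
        have hbb : b' = b := by
          have := hm.1
          rw [ih', List.map_cons, hb', List.flatten_cons, List.cons_append] at this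
          exact (List.cons.inj this).1
        subst hbb
        have hj : lab b' = j := by
          have : b' ∈ (List.filter (fun y => decide (lab y = j)) (b' :: g)) := by rw [hb']; simp
          simpa using (List.mem_filter.1 this).2
        subst hj
        rw [ih', List.map_cons, hb']
        simp only [val_bind, val_load, val_same]
        by_cases h : lab a = lab b'
        · simp only [h, decide_true, if_true, val_pure]
          rw [List.map_cons, List.dedup_cons_of_mem (by simp [h]), hDD, List.map_cons,
            List.filter_cons_of_pos (by simp [h]), hb']
          congr 1
          refine List.map_congr_left fun k hk => ?_
          have : lab a ≠ k := by
            rintro rfl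
            rw [h] at hk
            exact (List.nodup_cons.1 hnd).1 hk
          simp [List.filter_cons, this]
        · have hlt : ∀ y ∈ b' :: g, lab a < lab y := by
            intro y hy
            have h1 := lt_of_le_of_ne (ha b' (by simp)) h
            rcases List.mem_cons.1 hy with rfl | hy
            · exact h1
            · exact h1.trans_le ((List.pairwise_cons.1 hg.of_cons).1 y hy)
          have hnot : lab a ∉ (b' :: g).map lab := by
            intro h'
            obtain ⟨y, hy, hy'⟩ := List.mem_map.1 h'
            exact absurd hy' (hlt y hy).ne'
          simp only [h, decide_false, Bool.false_eq_true, if_false, val_pure]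
          rw [List.map_cons, List.dedup_cons_of_notMem hnot, hDD, List.map_cons, List.map_cons,
            List.filter_cons_of_pos (by simp)]
          congr 1
          · have : (b' :: g).filter (fun y => decide (lab y = lab a)) = [] := by
              rw [List.filter_eq_nil_iff]
              intro y hy
              simpa using (hlt y hy).ne'
            rw [this]
          · rw [← hb']
            have hk : ∀ k ∈ lab b' :: D, lab a ≠ k := by
              rintro k hk rfl
              exact hnot ((hmd _).1 hk)
            congr 1
            · conv_rhs => rw [List.filter_cons_of_neg (by simpa using h)]
            · refine List.map_congr_left fun k hk' => ?_
              conv_rhs => rw [List.filter_cons_of_neg (by simpa using hk k (by simp [hk']))]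

/-- The groups on the two sides of an edge are in accordance: lines of a common group on one side
are in the same relative order on the other side. -/
structure Compatible (gl gr : List (List L)) : Prop where
  nodup_left : gl.flatten.Nodup
  nodup_right : gr.flatten.Nodup
  mem : ∀ x, x ∈ gl.flatten ↔ x ∈ gr.flatten
  nonempty_left : [] ∉ gl
  nonempty_right : [] ∉ gr
  left : ∀ g ∈ gl, ∀ x y, [x, y].Sublist g → [x, y].Sublist gr.flatten
  right : ∀ g ∈ gr, ∀ x y, [x, y].Sublist g → [x, y].Sublist gl.flatten

namespace Compatible

variable {gl gr : List (List L)}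

theorem symm (h : Compatible gl gr) : Compatible gr gl :=
  ⟨h.nodup_right, h.nodup_left, fun x => (h.mem x).symm, h.nonempty_right, h.nonempty_left,
    h.right, h.left⟩

/-- A decrease of the label would put two lines of the group in the opposite order on the other
side. This supplies the hypothesis of `merge_eq`. -/
theorem pairwise_label (h : Compatible gl gr) {g : List L} (hg : g ∈ gl) :
    g.Pairwise fun a b => label gr a ≤ label gr b := by
  refine List.pairwise_iff_forall_sublist.2 fun {a b} hab => ?_
  by_contra hlt
  obtain ⟨ha, hb⟩ := List.pair_sublist_mem hab
  have ha' := (h.mem a).1 (List.mem_flatten.2 ⟨g, hg, ha⟩)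
  have hb' := (h.mem b).1 (List.mem_flatten.2 ⟨g, hg, hb⟩)
  exact List.pair_sublist_asymm h.nodup_right (h.left g hg a b hab)
    (pair_sublist_of_label_lt h.nodup_right hb' ha' (not_le.1 hlt))

/-- The groups on the left side, cut into blocks. -/
abbrev blocks (gl gr : List (List L)) : List (List (List L)) :=
  gl.map fun g => (merge (label gr) g).val

theorem blocks_flatten_flatten (gl gr : List (List L)) :
    (blocks gl gr).flatten.flatten = gl.flatten := by
  induction gl with
  | nil => simp
  | cons g gl ih => simp [ih, merge_flatten]

theorem nil_notMem_blocks (gl gr : List (List L)) : [] ∉ (blocks gl gr).flatten := by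
  simp only [List.mem_flatten, List.mem_map, not_exists, not_and]
  rintro _ ⟨g, -, rfl⟩
  exact (merge_flatten _ g).2

theorem nodup_blocks (h : Compatible gl gr) : (blocks gl gr).flatten.Nodup :=
  List.nodup_of_nodup_flatten (by rw [blocks_flatten_flatten]; exact h.nodup_left)
    (nil_notMem_blocks gl gr)

/-- The lines of one cell share a left group, hence have the same relative order on both sides. So a
block is the same list whichever side it is cut from. -/
theorem filter_flatten_eq (h : Compatible gl gr) (p q : ℕ) :
    gl.flatten.filter (fun y => decide (label gl y = p ∧ label gr y = q)) =
      gr.flatten.filter (fun y => decide (label gl y = p ∧ label gr y = q)) := by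
  refine List.eq_of_pair_sublist (h.nodup_left.filter _) (h.nodup_right.filter _) ?_ ?_
  · intro x
    simp only [List.mem_filter, h.mem]
  · intro x y hxy
    rw [List.pair_sublist_filter] at hxy ⊢
    refine ⟨hxy.1, hxy.2.1, ?_⟩
    have hx := of_decide_eq_true hxy.1
    have hy := of_decide_eq_true hxy.2.1
    obtain ⟨hxl, hyl⟩ := List.pair_sublist_mem hxy.2.2
    obtain ⟨g, hg, h1, h2⟩ := (label_eq_iff h.nodup_left hxl hyl).1 (hx.1.trans hy.1.symm)
    rcases List.pair_sublist_total h1 h2 (List.pair_sublist_ne h.nodup_left hxy.2.2) with h' | h'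
    · exact h.left g hg x y h'
    · exact absurd (h'.trans (List.sublist_flatten_of_mem hg))
        (List.pair_sublist_asymm h.nodup_left hxy.2.2)

/-- Blocks are the nonempty cells of the common refinement of the two groupings. By
`filter_flatten_eq` this description is symmetric in the two sides. -/
theorem mem_blocks_iff (h : Compatible gl gr) (b : List L) :
    b ∈ (blocks gl gr).flatten ↔ ∃ x ∈ gl.flatten, b = gl.flatten.filter
      (fun y => decide (label gl y = label gl x ∧ label gr y = label gr x)) := by
  have key : ∀ g ∈ gl, ∀ x ∈ g, g.filter (fun y => decide (label gr y = label gr x)) =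
      gl.flatten.filter
        (fun y => decide (label gl y = label gl x ∧ label gr y = label gr x)) := by
    intro g hg x hx
    have hgs := List.sublist_flatten_of_mem hg
    refine List.eq_of_pair_sublist ((hgs.nodup h.nodup_left).filter _) (h.nodup_left.filter _)
      (fun y => ?_) fun y z hyz => ?_
    · simp only [List.mem_filter, decide_eq_true_eq]
      constructor
      · rintro ⟨hy, h2⟩
        exact ⟨hgs.subset hy, (label_eq_iff h.nodup_left (hgs.subset hy) (hgs.subset hx)).2
          ⟨g, hg, hy, hx⟩, h2⟩
      · rintro ⟨hy, h1, h2⟩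
        obtain ⟨g', hg', h3, h4⟩ := (label_eq_iff h.nodup_left hy (hgs.subset hx)).1 h1
        rw [List.eq_of_mem_of_nodup_flatten h.nodup_left hg hg' hx h4]
        exact ⟨h3, h2⟩
    · rw [List.pair_sublist_filter] at hyz ⊢
      obtain ⟨hy, hz⟩ := List.pair_sublist_mem hyz.2.2
      have a1 := (label_eq_iff h.nodup_left (hgs.subset hy) (hgs.subset hx)).2 ⟨g, hg, hy, hx⟩
      have a2 := (label_eq_iff h.nodup_left (hgs.subset hz) (hgs.subset hx)).2 ⟨g, hg, hz, hx⟩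
      refine ⟨?_, ?_, hyz.2.2.trans hgs⟩
      · simpa [a1] using hyz.1
      · simpa [a2] using hyz.2.1
  simp only [List.mem_flatten, List.mem_map]
  constructor
  · rintro ⟨_, ⟨g, hg, rfl⟩, hb⟩
    rw [merge_eq _ _ (h.pairwise_label hg)] at hb
    obtain ⟨j, hj, rfl⟩ := List.mem_map.1 hb
    obtain ⟨x, hx, rfl⟩ := List.mem_map.1 (List.mem_dedup.1 hj)
    exact ⟨x, ⟨g, hg, hx⟩, key g hg x hx⟩
  · rintro ⟨x, ⟨g, hg, hx⟩, rfl⟩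
    refine ⟨_, ⟨g, hg, rfl⟩, ?_⟩
    rw [merge_eq _ _ (h.pairwise_label hg), ← key g hg x hx]
    exact List.mem_map.2 ⟨_, List.mem_dedup.2 (List.mem_map_of_mem hx), rfl⟩

theorem blocks_perm (h : Compatible gl gr) :
    (blocks gl gr).flatten.Perm (blocks gr gl).flatten := by
  refine (List.perm_ext_iff_of_nodup h.nodup_blocks h.symm.nodup_blocks).2 fun b => ?_
  rw [h.mem_blocks_iff, h.symm.mem_blocks_iff]
  simp only [h.mem, h.filter_flatten_eq, and_comm]

/-- The order of two blocks can be read off from one line in each. This is why the chosen group is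
already sorted when the insertions begin. -/
theorem blocks_sorted (h : Compatible gl gr) : ∀ g ∈ blocks gl gr, ∀ b c, [b, c].Sublist g →
    [b, c].Sublist (blocks gr gl).flatten := by
  intro g' hg' b c hbc
  have hbc' := hbc.trans (List.sublist_flatten_of_mem hg')
  obtain ⟨hb, hc⟩ := List.pair_sublist_mem hbc'
  have hne := List.pair_sublist_ne h.nodup_blocks hbc'
  obtain ⟨g, hg, rfl⟩ := List.mem_map.1 hg'
  have hb0 : b ≠ [] := by rintro rfl; exact nil_notMem_blocks gl gr hb
  have hc0 : c ≠ [] := by rintro rfl; exact nil_notMem_blocks gl gr hc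
  obtain ⟨x, hx⟩ := List.exists_mem_of_ne_nil b hb0
  obtain ⟨y, hy⟩ := List.exists_mem_of_ne_nil c hc0
  have hxy : [x, y].Sublist g := by
    rw [← (merge_flatten (label gr) g).1]
    exact List.pair_sublist_flatten.2 (Or.inr ⟨b, c, hbc, hx, hy⟩)
  have hxy' := h.left g hg x y hxy
  rw [← blocks_flatten_flatten gr gl] at hxy'
  have hnd : (blocks gr gl).flatten.flatten.Nodup := by
    rw [blocks_flatten_flatten]; exact h.nodup_right
  have hb' := h.blocks_perm.mem_iff.1 hb
  have hc' := h.blocks_perm.mem_iff.1 hc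
  rcases List.pair_sublist_flatten.1 hxy' with ⟨d, hd, h1⟩ | ⟨d, e, hde, h1, h2⟩
  · obtain ⟨h2, h3⟩ := List.pair_sublist_mem h1
    exact absurd ((List.eq_of_mem_of_nodup_flatten hnd hb' hd hx h2).trans
      (List.eq_of_mem_of_nodup_flatten hnd hc' hd hy h3).symm) hne
  · obtain ⟨hd, he⟩ := List.pair_sublist_mem hde
    rw [List.eq_of_mem_of_nodup_flatten hnd hb' hd hx h1,
      List.eq_of_mem_of_nodup_flatten hnd hc' he hy h2]
    exact hde

end Compatible

end LineOrdering

/-! ### Sorting one edge, and the pairs of lines that pay for its moves -/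

namespace LineOrdering

open MetroNetwork

variable {V L : Type} [DecidableEq V] [DecidableEq L]

theorem rank_val (pos : L → ℕ) (b : List L) {k : ℕ} (hb : b ≠ []) (h : ∀ x ∈ b, pos x = k) :
    (rank pos b).val = k := by
  obtain ⟨x, b, rfl⟩ := List.exists_cons_of_ne_nil hb
  simpa [rank] using h x (by simp)

/-- The chosen group of `n` blocks needs no move and every other block at most one; the additional
entry in the length is the initial order. -/
theorem sortInto_spec (n : ℕ) (gs target : List (List (List L)))
    (hperm : gs.flatten.Perm target.flatten) (hnd : target.flatten.flatten.Nodup)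
    (hne : [] ∉ target.flatten) (hn : ∃ g ∈ gs, g.length = n)
    (hsort : ∀ g ∈ gs, ∀ b c, [b, c].Sublist g → [b, c].Sublist target.flatten) :
    (sortInto n gs target).val.head? = some gs.flatten ∧
    (sortInto n gs target).val.getLast? = some target.flatten ∧
    (sortInto n gs target).val.IsChain (IsMonotoneBlockMove target.flatten) ∧
    (sortInto n gs target).val.length ≤ gs.flatten.length - n + 1 := by
  have hT : target.flatten.Nodup := List.nodup_of_nodup_flatten hnd hne
  have hG : gs.flatten.Nodup := hperm.nodup_iff.2 hT
  set pos := label target.flatten with hpos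
  -- The blocks of the target are labelled by their indices, so rank and position in the target
  -- coincide.
  have hr : ∀ i (hi : i < target.flatten.length),
      (rank pos target.flatten[i]).val = i := fun i hi =>
    rank_val pos _ (fun h => hne (h ▸ List.getElem_mem hi)) fun x hx => label_of_mem hnd hi hx
  have hsorted : target.flatten.Pairwise fun a b => (rank pos a).val < (rank pos b).val := by
    rw [List.pairwise_iff_getElem]
    intro i j hi hj hij
    rwa [hr i hi, hr j hj]
  have hlt : ∀ {b c}, [b, c].Sublist target.flatten → (rank pos b).val < (rank pos c).val :=
    fun h => List.pairwise_iff_forall_sublist.1 hsorted h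
  have hlt' : ∀ {b c}, b ∈ target.flatten → c ∈ target.flatten →
      (rank pos b).val < (rank pos c).val → [b, c].Sublist target.flatten := by
    intro b c hb hc h
    rcases List.pair_sublist_total hb hc (by rintro rfl; exact lt_irrefl _ h) with h' | h'
    · exact h'
    · exact absurd (hlt h') h.le.not_gt
  have hinj : ∀ b ∈ target.flatten, ∀ c ∈ target.flatten, b ≠ c →
      (rank pos b).val ≠ (rank pos c).val := by
    intro b hb c hc hbc
    rcases List.pair_sublist_total hb hc hbc with h | h
    · exact (hlt h).ne
    · exact (hlt h).ne'
  obtain ⟨hl1, hl2⟩ := locate_spec n [] gs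
  obtain ⟨hl2, hl3⟩ := hl2 hn
  simp only [sortInto, val_bind, val_flatten, val_append, val_pure]
  generalize (locate n [] gs).val = R at *
  obtain ⟨xs, s, ys⟩ := R
  simp only [List.reverse_nil, List.nil_append] at hl1 hl2 hl3 ⊢
  have hmem : ∀ b, b ∈ xs.reverse ++ s ++ ys → b ∈ target.flatten := fun b hb =>
    hperm.mem_iff.1 (hl1 ▸ hb)
  have hnd' : (xs.reverse ++ s ++ ys).Nodup := hl1 ▸ hG
  rw [List.nodup_append, List.nodup_append] at hnd'
  obtain ⟨⟨nx, ns, nxs⟩, ny, nxy⟩ := hnd'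
  have pw : ∀ l : List (List L), l.Nodup → (∀ b ∈ l, b ∈ target.flatten) →
      l.Pairwise fun a b => (rank pos a).val ≠ (rank pos b).val := by
    intro l hl hlm
    exact hl.imp_of_mem fun {a b} ha hb hab => hinj a (hlm a ha) b (hlm b hb) hab
  obtain ⟨p1, p2, p3, p4, p5⟩ := insertLeft_spec pos ys xs s
    (List.pairwise_iff_forall_sublist.2 fun {a b} hab => hlt (hsort s hl2 a b hab))
    (fun x hx y hy => hinj x (hmem x (by simp [hx])) y (hmem y (by simp [hy]))
      (nxs x (by simpa using hx) y hy))
    (pw xs (by simpa using nx) fun b hb => hmem b (by simp [hb]))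
  change (insertLeft (labelLists 0 target.flatten fun _ => 0).val ys xs s).val.1.Perm _ at p1
  generalize hI : (insertLeft (labelLists 0 target.flatten fun _ => 0).val ys xs s).val = I at *
  obtain ⟨s', moves⟩ := I
  simp only at p1 p2 p3 p4 p5 ⊢
  have hms : ∀ b, b ∈ s' ↔ b ∈ xs ∨ b ∈ s := fun b => by rw [p1.mem_iff, List.mem_append]
  obtain ⟨t, q1, q2, q3, q4, q5⟩ := insertRight_spec pos ys s' p2 (by
      intro x hx y hy
      refine hinj x (hmem x (by simp [hx])) y (hmem y ?_) (Ne.symm (nxy y ?_ x hx))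
      · rcases (hms y).1 hy with h | h <;> simp [h]
      · rcases (hms y).1 hy with h | h <;> simp [h])
    (pw ys ny fun b hb => hmem b (by simp [hb]))
  have hst : t.Perm target.flatten := by
    refine (q1.trans ((p1.append_right ys).trans ?_)).trans hperm
    rw [← hl1]
    exact ((List.reverse_perm xs).symm.append_right s).append_right ys
  -- A permutation sorted by strictly increasing rank is unique.
  have ht : t = target.flatten := by
    refine hst.eq_of_pairwise (le := fun a b => (rank pos a).val < (rank pos b).val) ?_ q2 hsorted
    intro a b _ _ h1 h2
    exact absurd h1 h2.le.not_gt
  subst ht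
  rw [hl1] at p3 p4
  change List.IsChain _
    ((s' ++ ys) :: (insertRight (labelLists 0 target.flatten fun _ => 0).val ys s').val) at q3
  change List.getLast?
    ((s' ++ ys) :: (insertRight (labelLists 0 target.flatten fun _ => 0).val ys s').val) = _ at q4
  change (insertRight (labelLists 0 target.flatten fun _ => 0).val ys s').val.length ≤ _ at q5
  generalize (insertRight (labelLists 0 target.flatten fun _ => 0).val ys s').val = moves' at *
  have hlen : gs.flatten.length = xs.length + s.length + ys.length := by
    rw [← hl1]; simp [add_assoc]
  have hchain : (gs.flatten :: (moves ++ moves')).IsChain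
      (IsRankMove fun b => (rank pos b).val) := by
    rw [← List.cons_append, List.isChain_append]
    refine ⟨p3, q3.tail, ?_⟩
    rw [p4]
    rintro x hx y hy
    obtain rfl : s' ++ ys = x := by simpa using hx
    cases moves' with
    | nil => simp at hy
    | cons m moves' =>
      obtain rfl : m = y := by simpa using hy
      exact (List.isChain_cons_cons.1 q3).1
  have hlast : (gs.flatten :: (moves ++ moves')).getLast? = some target.flatten := by
    rw [← List.cons_append, List.getLast?_append, p4]
    cases moves' with
    | nil => simpa using q4
    | cons m moves' =>
      rw [List.getLast?_cons_cons] at q4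
      simp [q4]
  refine ⟨rfl, hlast, ?_, ?_⟩
  · have hb : ∀ (O : List (List (List L))) π, (∀ b ∈ π, b ∈ target.flatten) →
        (π :: O).IsChain (IsRankMove fun b => (rank pos b).val) →
        (π :: O).IsChain (IsMonotoneBlockMove target.flatten) := by
      intro O
      induction O with
      | nil => simp
      | cons ρ O ih =>
        intro π hπ hc
        rw [List.isChain_cons_cons] at hc ⊢
        obtain ⟨⟨a, b, c, d, h1, h2, rfl, rfl, h3⟩, hc⟩ := hc
        refine ⟨⟨a, b, c, d, h1, h2, rfl, rfl, fun x hx y hy => ?_⟩, ih _ ?_ hc⟩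
        · exact hlt' (hπ y (by simp [hy])) (hπ x (by simp [hx])) (h3 x hx y hy)
        · intro x hx
          refine hπ x ?_
          simp only [List.mem_append] at hx ⊢
          tauto
    exact hb _ _ (fun b hb => hperm.mem_iff.1 hb) hchain
  · simp only [List.length_cons, List.length_append]
    omega

namespace Compatible

variable {gl gr : List (List L)}

theorem isSorting_sortInto (h : Compatible gl gr) {n : ℕ}
    (hn : ∃ g ∈ blocks gl gr, g.length = n) :
    IsSorting gl.flatten gr.flatten
      ((sortInto n (blocks gl gr) (blocks gr gl)).val.map List.flatten) ∧
    (sortInto n (blocks gl gr) (blocks gr gl)).val.length ≤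
      (blocks gl gr).flatten.length - n + 1 := by
  obtain ⟨h1, h2, h3, h4⟩ := sortInto_spec n _ _ h.blocks_perm
    (by rw [blocks_flatten_flatten]; exact h.nodup_right) (nil_notMem_blocks gr gl) hn
    h.blocks_sorted
  refine ⟨IsSorting.of_monotone h.nodup_right ?_ ?_ ?_, h4⟩
  · rw [List.head?_map, h1, Option.map_some, blocks_flatten_flatten]
  · rw [List.getLast?_map, h2, Option.map_some, blocks_flatten_flatten]
  · cases hO : (sortInto n (blocks gl gr) (blocks gr gl)).val with
    | nil => simp
    | cons π O =>
      rw [hO] at h1 h3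
      obtain rfl : π = (blocks gl gr).flatten := by simpa using h1
      have := isChain_map_flatten h3 (nil_notMem_blocks gl gr)
      rwa [blocks_flatten_flatten] at this

/-- A block is represented by its first line. The default `x` never matters, because blocks are
nonempty. -/
theorem headD_mem (gl gr : List (List L)) (x : L) {b : List L}
    (hb : b ∈ (blocks gl gr).flatten) : b.headD x ∈ b := by
  obtain ⟨y, b, rfl⟩ := List.exists_cons_of_ne_nil
    (show b ≠ [] by rintro rfl; exact nil_notMem_blocks gl gr hb)
  simp

theorem headD_mem_flatten (gl gr : List (List L)) (x : L) {b : List L}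
    (hb : b ∈ (blocks gl gr).flatten) : b.headD x ∈ gl.flatten := by
  rw [← blocks_flatten_flatten gl gr]
  exact List.mem_flatten.2 ⟨b, hb, headD_mem gl gr x hb⟩

theorem mem_merge_iff (h : Compatible gl gr) (x : L) {g b : List L} (hg : g ∈ gl)
    (hb : b ∈ (blocks gl gr).flatten) : b ∈ (merge (label gr) g).val ↔ b.headD x ∈ g := by
  have hx := headD_mem gl gr x hb
  have key : ∀ g, b ∈ (merge (label gr) g).val → b.headD x ∈ g := by
    intro g h'
    rw [← (merge_flatten (label gr) g).1]
    exact List.mem_flatten.2 ⟨b, h', hx⟩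
  refine ⟨key g, fun h' => ?_⟩
  obtain ⟨_, hm, hb'⟩ := List.mem_flatten.1 hb
  obtain ⟨g', hg', rfl⟩ := List.mem_map.1 hm
  rwa [List.eq_of_mem_of_nodup_flatten h.nodup_left hg hg' h' (key g' hb')]

/-- In the bipartite graph, the edges at the left vertex `g` are the blocks into which `g` is cut;
this turns degrees into group sizes. -/
theorem filter_label_eq (h : Compatible gl gr) (x : L) {g : List L} (hg : g ∈ gl) {y : L}
    (hy : y ∈ g) : ((blocks gl gr).flatten.toFinset.filter
      fun b => label gl (b.headD x) = label gl y) = (merge (label gr) g).val.toFinset := by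
  have hyf : y ∈ gl.flatten := List.mem_flatten.2 ⟨g, hg, hy⟩
  ext b
  rw [Finset.mem_filter, List.mem_toFinset, List.mem_toFinset]
  constructor
  · rintro ⟨hb, hl⟩
    rw [h.mem_merge_iff x hg hb]
    obtain ⟨g', hg', h1, h2⟩ :=
      (label_eq_iff h.nodup_left (headD_mem_flatten gl gr x hb) hyf).1 hl
    rwa [List.eq_of_mem_of_nodup_flatten h.nodup_left hg hg' hy h2]
  · intro hb
    have hb' : b ∈ (blocks gl gr).flatten :=
      List.mem_flatten.2 ⟨_, List.mem_map.2 ⟨g, hg, rfl⟩, hb⟩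
    exact ⟨hb', (label_eq_iff h.nodup_left (headD_mem_flatten gl gr x hb') hyf).2
      ⟨g, hg, (h.mem_merge_iff x hg hb').1 hb, hy⟩⟩

theorem card_filter_label_le (h : Compatible gl gr) (x : L) {n : ℕ}
    (hl : ∀ g ∈ blocks gl gr, g.length ≤ n) (c : ℕ) :
    ((blocks gl gr).flatten.toFinset.filter fun b => label gl (b.headD x) = c).card ≤ n := by
  rcases Finset.eq_empty_or_nonempty
    ((blocks gl gr).flatten.toFinset.filter fun b => label gl (b.headD x) = c) with h0 | ⟨b, hb⟩
  · rw [h0]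
    simp
  · rw [Finset.mem_filter, List.mem_toFinset] at hb
    obtain ⟨g, hg, hbg⟩ := List.mem_flatten.1 (headD_mem_flatten gl gr x hb.1)
    rw [← hb.2, h.filter_label_eq x hg hbg]
    exact (List.toFinset_card_le _).trans (hl _ (List.mem_map.2 ⟨g, hg, rfl⟩))

/-- If the largest group, after merging, is on the left side, then the number of blocks outside
this group is bounded by the number of pairs of lines that are not in a common group. -/
theorem exists_separated (h : Compatible gl gr) (n : ℕ)
    (hl : ∀ g ∈ blocks gl gr, g.length ≤ n) (hr : ∀ g ∈ blocks gr gl, g.length ≤ n)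
    (hn : ∃ g ∈ blocks gl gr, g.length = n) :
    ∃ D : Finset (L × L), (∀ p ∈ D, p.1 ∈ gl.flatten ∧ p.2 ∈ gl.flatten ∧
      (¬ ∃ g ∈ gl, p.1 ∈ g ∧ p.2 ∈ g) ∧ ¬ ∃ g ∈ gr, p.1 ∈ g ∧ p.2 ∈ g) ∧
      ((blocks gl gr).flatten.length - n) ^ 2 ≤ 2 * D.card := by
  obtain ⟨_, hm, hgn⟩ := hn
  obtain ⟨g, hg, rfl⟩ := List.mem_map.1 hm
  obtain ⟨x, hx⟩ := List.exists_mem_of_ne_nil g (by rintro rfl; exact h.nonempty_left hg)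
  have hnd : (blocks gl gr).flatten.flatten.Nodup := by
    rw [blocks_flatten_flatten]; exact h.nodup_left
  set K := (blocks gl gr).flatten.toFinset with hK
  have hKm : ∀ b, b ∈ K ↔ b ∈ (blocks gl gr).flatten := fun b => by simp [hK]
  have hK' : K = (blocks gr gl).flatten.toFinset := List.toFinset_eq_of_perm _ _ h.blocks_perm
  have main := sq_card_sub_le_card_disjoint K (fun b => label gl (b.headD x))
    (fun b => label gr (b.headD x)) ?_ n (h.card_filter_label_le x hl) ?_ (label gl x) ?_
  · rw [hK, List.toFinset_card_of_nodup h.nodup_blocks, ← hK] at main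
    refine ⟨((K ×ˢ K).filter fun p => label gl (p.1.headD x) ≠ label gl (p.2.headD x) ∧
      label gr (p.1.headD x) ≠ label gr (p.2.headD x)).image
        fun p => (p.1.headD x, p.2.headD x), ?_, ?_⟩
    · intro p hp
      obtain ⟨⟨b, c⟩, hbc, rfl⟩ := Finset.mem_image.1 hp
      simp only [Finset.mem_filter, Finset.mem_product, hKm] at hbc
      obtain ⟨⟨hb, hc⟩, h1, h2⟩ := hbc
      have hb' := headD_mem_flatten gl gr x hb
      have hc' := headD_mem_flatten gl gr x hc
      rw [ne_eq, label_eq_iff h.nodup_left hb' hc'] at h1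
      rw [ne_eq, label_eq_iff h.nodup_right ((h.mem _).1 hb') ((h.mem _).1 hc')] at h2
      exact ⟨hb', hc', h1, h2⟩
    · rw [Finset.card_image_of_injOn]
      · exact main
      · have inj : ∀ b ∈ K, ∀ c ∈ K, b.headD x = c.headD x → b = c := by
          intro b hb c hc hbc
          rw [hKm] at hb hc
          exact List.eq_of_mem_of_nodup_flatten hnd hb hc (headD_mem gl gr x hb)
            (hbc ▸ headD_mem gl gr x hc)
        rintro ⟨b, c⟩ hbc ⟨b', c'⟩ hbc' heq
        simp only [Finset.coe_filter, Finset.mem_product, Set.mem_ofPred_eq, Prod.mk.injEq] at *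
        exact ⟨inj b hbc.1.1 b' hbc'.1.1 heq.1, inj c hbc.1.2 c' hbc'.1.2 heq.2⟩
  · intro a ha b hb h1 h2
    rw [hKm] at ha hb
    -- The two groups of its representative determine a block, so the bipartite graph has no
    -- multiple edges.
    have key : ∀ b ∈ (blocks gl gr).flatten, b = gl.flatten.filter (fun y => decide
        (label gl y = label gl (b.headD x) ∧ label gr y = label gr (b.headD x))) := by
      intro b hb
      have hb' := headD_mem gl gr x hb
      obtain ⟨y, hy, e⟩ := (h.mem_blocks_iff b).1 hb
      generalize b.headD x = z at *
      have h3 : z ∈ gl.flatten.filter _ := e ▸ hb'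
      have h3 := of_decide_eq_true (List.mem_filter.1 h3).2
      rw [h3.1, h3.2]
      exact e
    rw [key a ha, key b hb]
    simp only [h1, h2]
  · intro c
    rw [hK']
    exact h.symm.card_filter_label_le x hr c
  · rw [h.filter_label_eq x hg hx, List.toFinset_card_of_nodup, hgn]
    exact (List.sublist_flatten_of_mem (List.mem_map.2 ⟨g, hg, rfl⟩)).nodup h.nodup_blocks

/-- If the largest group is on the right, the sorting is built from right to left and then reversed.
This is legitimate since `IsSorting` is symmetric in its two ends, as is the set of separated pairs.
-/
theorem sortEdge_spec (h : Compatible gl gr) (hne : gl ≠ []) :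
    IsSorting gl.flatten gr.flatten (sortEdge gl gr).val ∧
    ∃ D : Finset (L × L), (∀ p ∈ D, p.1 ∈ gl.flatten ∧ p.2 ∈ gl.flatten ∧
      (¬ ∃ g ∈ gl, p.1 ∈ g ∧ p.2 ∈ g) ∧ ¬ ∃ g ∈ gr, p.1 ∈ g ∧ p.2 ∈ g) ∧
      ((sortEdge gl gr).val.length - 1) ^ 2 ≤ 2 * D.card := by
  have hne' : gr ≠ [] := by
    rintro rfl
    obtain ⟨g, gs, rfl⟩ := List.exists_cons_of_ne_nil hne
    obtain ⟨x, hx⟩ := List.exists_mem_of_ne_nil g (by rintro rfl; simpa using h.nonempty_left)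
    have := (h.mem x).1 (by simp [hx])
    simp at this
  obtain ⟨l1, l2⟩ := maxSize_spec (blocks gl gr)
  obtain ⟨r1, r2⟩ := maxSize_spec (blocks gr gl)
  simp only [sortEdge, val_bind, val_map, val_less]
  by_cases hlt : (maxSize (blocks gl gr)).val < (maxSize (blocks gr gl)).val
  · have hn := r2 (by simpa using hne')
    obtain ⟨h1, h2⟩ := h.symm.isSorting_sortInto hn
    obtain ⟨D, h3, h4⟩ := h.symm.exists_separated _ (r1) (fun g hg => (l1 g hg).trans hlt.le) hn
    simp only [hlt, decide_true, if_true, val_bind, val_map, val_reverse, val_flatten]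
    refine ⟨by simpa using h1.reverse, D, fun p hp => ?_, le_trans ?_ h4⟩
    · obtain ⟨a1, a2, a3, a4⟩ := h3 p hp
      exact ⟨(h.mem _).2 a1, (h.mem _).2 a2, a4, a3⟩
    · refine Nat.pow_le_pow_left ?_ 2
      simp only [List.length_map, List.length_reverse]
      exact Nat.sub_le_of_le_add h2
  · have hn := l2 (by simpa using hne)
    obtain ⟨h1, h2⟩ := h.isSorting_sortInto hn
    obtain ⟨D, h3, h4⟩ := h.exists_separated _ l1 (fun g hg => (r1 g hg).trans (not_lt.1 hlt)) hn
    simp only [hlt, decide_false, Bool.false_eq_true, if_false, val_bind, val_map, val_flatten]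
    refine ⟨h1, D, h3, le_trans ?_ h4⟩
    refine Nat.pow_le_pow_left ?_ 2
    simp only [List.length_map]
    exact Nat.sub_le_of_le_add h2

end Compatible

end LineOrdering

/-! ### Travelling along a line -/

namespace List

variable {α : Type}

theorem Nodup.append_cons_inj {a : α} {s t s' t' : List α} (h : (s ++ a :: t).Nodup)
    (e : s ++ a :: t = s' ++ a :: t') : s = s' ∧ t = t' := by
  induction s generalizing s' with
  | nil =>
    cases s' with
    | nil => simpa using e
    | cons b s' =>
      simp only [nil_append, cons_append, cons.injEq] at e
      obtain ⟨rfl, rfl⟩ := e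
      simp at h
  | cons b s ih =>
    cases s' with
    | nil =>
      simp only [nil_append, cons_append, cons.injEq] at e
      obtain ⟨rfl, rfl⟩ := e
      simp at h
    | cons c s' =>
      simp only [cons_append, cons.injEq] at e
      obtain ⟨rfl, e⟩ := e
      obtain ⟨h1, h2⟩ := ih (nodup_cons.1 h).2 e
      exact ⟨by rw [h1], h2⟩

end List

namespace MetroNetwork

variable {V L : Type} (N : MetroNetwork V L)

/-- Travelling along the line `l` from `u` to the next vertex `v`, one meets the vertices `p`
afterwards. -/
def Runs (l : L) (u v : V) (p : List V) : Prop :=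
  (u :: v :: p) <:+ N.vertices l ∨ (u :: v :: p) <:+ (N.vertices l).reverse

variable {N} {l k : L} {u v w : V} {p q : List V}

theorem nodup_vertices (l : L) : (N.vertices l).Nodup := (N.line l).2.support_nodup

theorem mem_edges_iff : s(u, v) ∈ N.edges l ↔
    [u, v] <:+: N.vertices l ∨ [v, u] <:+: N.vertices l :=
  (SimpleGraph.Walk.infix_support_iff_mem_edges).symm

/-- The vertices of a line, read in the direction of a run. -/
theorem Runs.exists_orientation (h : N.Runs l u v p) : ∃ X A, X.Nodup ∧ X = A ++ u :: v :: p ∧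
    (X = N.vertices l ∨ X = (N.vertices l).reverse) := by
  rcases h with ⟨A, h⟩ | ⟨A, h⟩
  · exact ⟨_, A, nodup_vertices l, h.symm, Or.inl rfl⟩
  · exact ⟨_, A, List.nodup_reverse.2 (nodup_vertices l), h.symm, Or.inr rfl⟩

theorem Runs.tail (h : N.Runs l u v (w :: p)) : N.Runs l v w p :=
  h.imp (List.suffix_cons u _).trans (List.suffix_cons u _).trans

theorem Runs.nodup (h : N.Runs l u v p) : (u :: v :: p).Nodup := by
  obtain ⟨X, A, hX, rfl, -⟩ := h.exists_orientation
  exact (List.suffix_append A _).sublist.nodup hX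

/-- The second clause starts the backward run one vertex further away. It is used for looking back
through an edge that has just been passed. -/
theorem Runs.back (h : N.Runs l u v p) : ∃ q, N.Runs l v u q ∧
    ∀ w p', p = w :: p' → N.Runs l w v (u :: q) := by
  obtain ⟨X, A, -, rfl, hX⟩ := h.exists_orientation
  refine ⟨A.reverse, ?_, ?_⟩
  · rcases hX with hX | hX
    · right; rw [← hX]; exact ⟨p.reverse, by simp⟩
    · left; rw [List.reverse_eq_iff.1 hX.symm]; exact ⟨p.reverse, by simp⟩
  · rintro w p rfl
    rcases hX with hX | hX
    · right; rw [← hX]; exact ⟨p.reverse, by simp⟩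
    · left; rw [List.reverse_eq_iff.1 hX.symm]; exact ⟨p.reverse, by simp⟩

theorem Runs.mem_edges (h : N.Runs l u v p) : s(u, v) ∈ N.edges l := by
  rw [mem_edges_iff]
  rcases h with ⟨A, h⟩ | ⟨A, h⟩
  · exact Or.inl ⟨A, p, by simp [← h]⟩
  · exact Or.inr ⟨p.reverse, A.reverse, by simpa using congrArg List.reverse h⟩

theorem exists_runs (h : s(u, v) ∈ N.edges l) : ∃ p, N.Runs l u v p := by
  rcases mem_edges_iff.1 h with ⟨A, B, h⟩ | ⟨A, B, h⟩
  · exact ⟨B, Or.inl ⟨A, by simpa using h⟩⟩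
  · exact ⟨A.reverse, Or.inr ⟨B.reverse, by simp [← h]⟩⟩

/-- A path visits no vertex twice. So it has only one direction in which `u` comes before `v`, and
only one place where they occur. -/
theorem Runs.unique (h : N.Runs l u v p) (h' : N.Runs l u v q) : p = q := by
  obtain ⟨X, A, hX, e, o⟩ := h.exists_orientation
  obtain ⟨Y, B, hY, e', o'⟩ := h'.exists_orientation
  have hXY : X = Y ∨ X = Y.reverse := by
    rcases o with rfl | rfl <;> rcases o' with rfl | rfl <;> simp
  rcases hXY with rfl | rfl
  · rw [e] at e' hX
    simpa using (hX.append_cons_inj e').2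
  · have h1 : [u, v].Sublist Y.reverse := by
      rw [e]; exact (List.prefix_append [u, v] p).sublist.trans (List.suffix_append A _).sublist
    have h2 : [u, v].Sublist Y := by
      rw [e']; exact (List.prefix_append [u, v] q).sublist.trans (List.suffix_append B _).sublist
    exact absurd (List.pair_sublist_reverse.1 h1) (List.pair_sublist_asymm hY h2)

theorem Runs.adj (h : N.Runs l u v p) : N.graph.Adj u v := by
  have := (N.line l).1.edges_subset_edgeSet h.mem_edges
  simpa using this

/-- A line that runs from `u` to `v` and uses another edge at `v` continues there. -/
theorem Runs.next (h : N.Runs l u v p) (hw : s(v, w) ∈ N.edges l) (hwu : w ≠ u) :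
    ∃ p', p = w :: p' := by
  obtain ⟨X, A, hX, e, o⟩ := h.exists_orientation
  have key : [v, w] <:+: X ∨ [w, v] <:+: X := by
    rcases o with rfl | rfl
    · exact mem_edges_iff.1 hw
    · rcases mem_edges_iff.1 hw with h' | h'
      · right; simpa using List.reverse_infix.2 h'
      · left; simpa using List.reverse_infix.2 h'
  have e1 : X = (A ++ [u]) ++ v :: p := by simp [e]
  rcases key with ⟨B, C, h'⟩ | ⟨B, C, h'⟩
  · have e2 : X = B ++ v :: (w :: C) := by simp [← h']
    rw [e1] at e2 hX
    exact ⟨C, (hX.append_cons_inj e2).2⟩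
  · have e2 : X = (B ++ [w]) ++ v :: C := by simp [← h']
    rw [e1] at e2 hX
    have := (hX.append_cons_inj e2).1
    exact absurd (by simpa using (List.append_inj' this rfl).2.symm) hwu

theorem Runs.nil_terminal (h : N.Runs l u v []) : v = N.src l ∨ v = N.dst l := by
  rcases h with ⟨A, h⟩ | ⟨A, h⟩
  · right
    have := congrArg List.getLast? h
    rw [vertices, List.getLast?_eq_some_getLast (SimpleGraph.Walk.support_ne_nil _),
      SimpleGraph.Walk.getLast_support] at this
    simpa using this
  · left
    have := congrArg List.getLast? h
    rw [vertices, List.getLast?_reverse, List.head?_eq_some_head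
      (SimpleGraph.Walk.support_ne_nil _), SimpleGraph.Walk.head_support] at this
    simpa using this

theorem Runs.cons_not_terminal (h : N.Runs l u v (w :: p)) : v ≠ N.src l ∧ v ≠ N.dst l := by
  have hh : (N.vertices l).head? = some (N.src l) := by
    rw [vertices, List.head?_eq_some_head (SimpleGraph.Walk.support_ne_nil _),
      SimpleGraph.Walk.head_support]
  have hl : (N.vertices l).getLast? = some (N.dst l) := by
    rw [vertices, List.getLast?_eq_some_getLast (SimpleGraph.Walk.support_ne_nil _),
      SimpleGraph.Walk.getLast_support]
  obtain ⟨X, A, hX, e, o⟩ := h.exists_orientation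
  have h1 : X.head? ≠ some v := by
    rintro h1
    rw [e] at h1 hX
    cases A with
    | nil =>
      obtain rfl : u = v := by simpa using h1
      simp at hX
    | cons a A =>
      obtain rfl : a = v := by simpa using h1
      simp at hX
  have h2 : X.getLast? ≠ some v := by
    rintro h2
    rw [e] at h2 hX
    rw [List.getLast?_append_of_ne_nil _ (by simp)] at h2
    rw [List.getLast?_cons_cons, List.getLast?_cons_cons] at h2
    have h3 := List.mem_of_getLast? h2
    have h4 := h.nodup
    simp only [List.nodup_cons] at h4
    exact h4.2.1 h3
  rcases o with rfl | rfl
  · exact ⟨fun h => h1 (by rw [hh, h]), fun h => h2 (by rw [hl, h])⟩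
  · rw [List.head?_reverse] at h1
    rw [List.getLast?_reverse] at h2
    exact ⟨fun h => h2 (by rw [hh, h]), fun h => h1 (by rw [hl, h])⟩

section

variable [DecidableEq V]

theorem turn_eq_of_rot {s t : List V} (h : N.rot v = s ++ u :: t) : N.turn u v = t ++ s := by
  have hu : u ∉ s := by
    have := N.rot_nodup v
    rw [h, List.nodup_append] at this
    intro hu
    exact this.2.2 u hu u (by simp) rfl
  rw [turn, h, List.idxOf_append_of_notMem hu, List.idxOf_cons_self, add_zero]
  simp [List.drop_append]

theorem turn_spec (h : N.graph.Adj v u) :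
    (N.turn u v).Nodup ∧ ∀ w, w ∈ N.turn u v ↔ N.graph.Adj v w ∧ w ≠ u := by
  obtain ⟨s, t, e⟩ := List.append_of_mem ((N.mem_rot v u).2 h)
  have hn := N.rot_nodup v
  rw [turn_eq_of_rot e]
  rw [e, List.nodup_append] at hn
  have hn' := List.nodup_cons.1 hn.2.1
  constructor
  · rw [List.nodup_append]
    exact ⟨hn'.2, hn.1, fun a ha b hb hab => hn.2.2 b hb a (by simp [ha]) hab.symm⟩
  · intro w
    rw [← N.mem_rot, e]
    simp only [List.mem_append, List.mem_cons]
    constructor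
    · rintro (h | h)
      · exact ⟨by simp [h], fun e => hn'.1 (e ▸ h)⟩
      · exact ⟨by simp [h], fun e => hn.2.2 w h u (by simp) e⟩
    · rintro ⟨h | rfl | h, h'⟩
      · exact Or.inr h
      · exact absurd rfl h'
      · exact Or.inl h

theorem Runs.mem_turn (h : N.Runs l u v (w :: p)) : w ∈ N.turn u v := by
  rw [(turn_spec h.adj.symm).2]
  refine ⟨h.tail.adj, ?_⟩
  rintro rfl
  simpa using h.nodup

end

end MetroNetwork

/-! ### What the procedures for following lines return -/

namespace LineOrdering

open MetroNetwork

variable {V L : Type} [DecidableEq V] [DecidableEq L]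

theorem turnFrom_val (N : MetroNetwork V L) (u v : V) :
    (turnFrom u [] (N.rot v)).val = N.turn u v := by
  have key : ∀ seen ws : List V, u ∉ seen → (turnFrom u seen ws).val =
      (seen.reverse ++ ws).drop ((seen.reverse ++ ws).idxOf u + 1) ++
        (seen.reverse ++ ws).take ((seen.reverse ++ ws).idxOf u) := by
    intro seen ws hu
    induction ws generalizing seen with
    | nil =>
      simp only [turnFrom, val_bind, val_reverse, List.append_nil]
      -- If `u` is absent, `idxOf` returns the length, so `drop` gives nothing and `take`
      -- everything, as the procedure does.
      rw [List.idxOf_of_notMem (by simpa using hu), List.drop_of_length_le (by simp),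
        List.take_length, List.nil_append]
    | cons w ws ih =>
      simp only [turnFrom, val_bind, val_same]
      by_cases h : w = u
      · subst h
        simp only [decide_true, if_true, val_bind, val_reverse, val_append]
        rw [List.idxOf_append_of_notMem (by simpa using hu), List.idxOf_cons_self]
        simp [List.drop_append]
      · simp only [h, decide_false, Bool.false_eq_true, if_false]
        rw [ih _ (by simpa using ⟨Ne.symm h, hu⟩)]
        simp
  simpa [MetroNetwork.turn] using key [] (N.rot v) (by simp)

theorem mem_toward {w : V} {is : List (L × List V)} {l : L} {p : List V} :
    (l, p) ∈ (toward w is).val ↔ (l, w :: p) ∈ is := by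
  induction is with
  | nil => simp [toward]
  | cons i is ih =>
    obtain ⟨k, q⟩ := i
    cases q with
    | nil => simp [toward, ih]
    | cons x q =>
      simp only [toward, val_bind, val_same]
      by_cases h : x = w
      · subst h; simp [ih]
      · simp [ih, h, Ne.symm h]

theorem toward_sublist (w : V) (is : List (L × List V)) :
    ((toward w is).val.map Prod.fst).Sublist (is.map Prod.fst) := by
  induction is with
  | nil => simp [toward]
  | cons i is ih =>
    obtain ⟨k, q⟩ := i
    cases q with
    | nil => simpa [toward] using ih.cons k
    | cons x q =>
      simp only [toward, val_bind, val_same]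
      by_cases h : x = w
      · simpa [h] using ih
      · simpa [h] using ih.cons k

theorem ending_val (is : List (L × List V)) :
    (ending is).val = ((is.filter fun i => i.2.isEmpty).map fun i => [i.1]) := by
  induction is with
  | nil => simp [ending]
  | cons i is ih =>
    obtain ⟨k, q⟩ := i
    cases q <;> simp [ending, ih]

theorem occurs_val (l : L) (is : List (L × List V)) :
    (occurs l is).val = decide (l ∈ is.map Prod.fst) := by
  induction is with
  | nil => simp [occurs]
  | cons i is ih =>
    obtain ⟨k, q⟩ := i
    simp only [occurs, val_bind, val_same]
    by_cases h : k = l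
    · simp [h]
    · simp [h, ih, Ne.symm h]

theorem restrict_val (is : List (L × List V)) (ls : List L) :
    (restrict is ls).val = ls.filter fun l => decide (l ∈ is.map Prod.fst) := by
  induction ls with
  | nil => simp [restrict]
  | cons l ls ih =>
    simp only [restrict, val_bind, occurs_val, ih, List.filter_cons]
    split_ifs <;> rfl

end LineOrdering

/-! ### Groups, and the order in which lines separate -/

namespace MetroNetwork

variable {V L : Type} (N : MetroNetwork V L)

/-- Two lines that have been followed to `v` and then visit the vertices `p` and `q`, respectively,
reach a treated edge before they separate. -/
def SameGroup (T : LineOrdering.Table V L) : V → List V → List V → Prop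
  | v, x :: p, y :: q => x = y ∧ (T (v, x) ≠ [] ∨ SameGroup T x p q)
  | _, [], _ => False
  | _, _ :: _, [] => False

/-- The lines `l` and `k`, which have been followed from `u` to `v` and visit the vertices `p`
and `q` afterwards, appear in this order when they separate or reach a treated edge. -/
def Precedes [DecidableEq V] (T : LineOrdering.Table V L) (l k : L) :
    V → V → List V → List V → Prop
  | u, v, x :: p, y :: q =>
    if x = y then
      if T (v, x) = [] then Precedes T l k v x p q else [l, k].Sublist (startOrder T v x)
    else [x, y].Sublist (N.turn u v)
  | _, _, [], _ :: _ => True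
  | _, _, _, [] => False

/-- All orders in the table are orders of the correct sets of lines. -/
def TableValid (T : LineOrdering.Table V L) : Prop :=
  ∀ u v, N.graph.Adj u v → ∀ π ∈ T (u, v), π.Nodup ∧ ∀ l, l ∈ π ↔ s(u, v) ∈ N.edges l

/-- A list of lines following the edge `uv`, each with the vertices after `v`. -/
structure IsBundle (u v : V) (is : List (L × List V)) : Prop where
  nodup : (is.map Prod.fst).Nodup
  runs : ∀ i ∈ is, N.Runs i.1 u v i.2

end MetroNetwork

namespace LineOrdering

open MetroNetwork

variable {V L : Type} [DecidableEq V] [DecidableEq L] {N : MetroNetwork V L} {T : Table V L}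

/-- The groups of the lines continuing from `v` to `w`. -/
def branch (rot : V → List V) (T : Table V L) (n : ℕ) (v w : V) (is : List (L × List V)) :
    List (List L) :=
  if (toward w is).val = [] then []
  else if T (v, w) = [] then (groups rot T n v w (toward w is).val).val
  else [((T (v, w)).headD []).filter fun l => decide (l ∈ (toward w is).val.map Prod.fst)]

theorem groups_succ_val (n : ℕ) (u v : V) (is : List (L × List V)) :
    (groups N.rot T (n + 1) u v is).val =
      (ending is).val ++ (N.turn u v).flatMap fun w => branch N.rot T n v w is := by
  simp only [groups, val_bind, val_load, turnFrom_val, val_append, val_flatMap]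
  congr 2
  funext w
  rw [branch]
  cases h : (toward w is).val with
  | nil => simp
  | cons i is' =>
    simp only [val_bind, val_load]
    cases h' : T (v, w) with
    | nil => simp
    | cons near rest => simp [restrict_val]

theorem IsBundle.unique {u v : V} {is : List (L × List V)} (h : N.IsBundle u v is) {l : L}
    {p q : List V} (hp : (l, p) ∈ is) (hq : (l, q) ∈ is) : p = q :=
  (h.runs _ hp).unique (h.runs _ hq)

theorem IsBundle.toward {u v : V} {is : List (L × List V)} (h : N.IsBundle u v is) (w : V) :
    N.IsBundle v w (toward w is).val :=
  ⟨(toward_sublist w is).nodup h.nodup, fun ⟨_, _⟩ hi => (h.runs _ (mem_toward.1 hi)).tail⟩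

/-- What is known about a list of groups of lines, by their continuations. -/
structure GroupsSpec (N : MetroNetwork V L) (T : Table V L) (u v : V) (is : List (L × List V))
    (G : List (List L)) : Prop where
  mem : ∀ l, l ∈ G.flatten ↔ ∃ p, (l, p) ∈ is
  nodup : G.flatten.Nodup
  nonempty : [] ∉ G
  precedes : ∀ l k p q, (l, p) ∈ is → (k, q) ∈ is → [l, k].Sublist G.flatten →
    N.Precedes T l k u v p q
  same : ∀ l k p q, (l, p) ∈ is → (k, q) ∈ is → l ≠ k →
    ((∃ g ∈ G, l ∈ g ∧ k ∈ g) ↔ SameGroup T v p q)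

/-- One neighbour contributes nothing, or the groups found behind an untreated edge, or a single
group inheriting its order from a treated edge. The three cases mirror the recursions of `Precedes`
and `SameGroup`. -/
theorem branch_spec (hT : N.TableValid T) {n : ℕ} {u v : V} {is : List (L × List V)}
    (his : N.IsBundle u v is) (w : V)
    (ih : (toward w is).val ≠ [] → GroupsSpec N T v w (toward w is).val
      (groups N.rot T n v w (toward w is).val).val) :
    (∀ l, l ∈ (branch N.rot T n v w is).flatten ↔ ∃ p, (l, w :: p) ∈ is) ∧
    (branch N.rot T n v w is).flatten.Nodup ∧ [] ∉ branch N.rot T n v w is ∧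
    (∀ l k p q, (l, w :: p) ∈ is → (k, w :: q) ∈ is →
      [l, k].Sublist (branch N.rot T n v w is).flatten →
      N.Precedes T l k u v (w :: p) (w :: q)) ∧
    (∀ l k p q, (l, w :: p) ∈ is → (k, w :: q) ∈ is → l ≠ k →
      ((∃ g ∈ branch N.rot T n v w is, l ∈ g ∧ k ∈ g) ↔ SameGroup T v (w :: p) (w :: q))) := by
  have hm : ∀ l p, (l, w :: p) ∈ is ↔ (l, p) ∈ (toward w is).val := fun l p => mem_toward.symm
  have hs := IsBundle.toward his w
  simp only [hm, branch]
  generalize (toward w is).val = sub at *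
  by_cases h0 : sub = []
  · simp [h0]
  · simp only [h0, if_false]
    by_cases hT0 : T (v, w) = []
    · obtain ⟨a1, a2, a3, a4, a5⟩ := ih h0
      simp only [hT0, if_true]
      refine ⟨a1, a2, a3, ?_, ?_⟩
      · intro l k p q hp hq h
        simpa [Precedes, hT0] using a4 l k p q hp hq h
      · intro l k p q hp hq h
        simpa [SameGroup, hT0] using a5 l k p q hp hq h
    · simp only [hT0, if_false]
      obtain ⟨near, rest, hnear⟩ := List.exists_cons_of_ne_nil hT0
      obtain ⟨⟨l0, p0⟩, hi0⟩ := List.exists_mem_of_ne_nil _ h0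
      have hadj := (hs.runs _ hi0).adj
      obtain ⟨v1, v2⟩ := hT v w hadj near (by simp [hnear])
      have hin : ∀ l p, (l, p) ∈ sub → l ∈ near := fun l p h => (v2 l).2 (hs.runs _ h).mem_edges
      have hin' : ∀ l p, (l, p) ∈ sub → l ∈ sub.map Prod.fst := fun l p h =>
        List.mem_map.2 ⟨_, h, rfl⟩
      simp only [hnear, List.headD_cons, List.flatten_cons, List.flatten_nil, List.append_nil]
      refine ⟨?_, v1.filter _, ?_, ?_, ?_⟩
      · intro l
        simp only [List.mem_filter, decide_eq_true_eq]
        constructor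
        · rintro ⟨-, h⟩
          obtain ⟨⟨l', p⟩, hi, rfl⟩ := List.mem_map.1 h
          exact ⟨p, hi⟩
        · rintro ⟨p, h⟩
          exact ⟨hin l p h, hin' l p h⟩
      · rw [List.mem_singleton, eq_comm, List.filter_eq_nil_iff]
        intro h
        exact h l0 (hin _ _ hi0) (by simpa using ⟨p0, hi0⟩)
      · intro l k p q hp hq h
        rw [List.pair_sublist_filter] at h
        simpa [Precedes, startOrder, hnear] using h.2.2
      · intro l k p q hp hq hne
        simp only [List.mem_singleton, exists_eq_left, SameGroup, true_and]
        constructor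
        · exact fun _ => Or.inl hT0
        · exact fun _ => ⟨List.mem_filter.2 ⟨hin l p hp, by simpa using ⟨p, hp⟩⟩,
            List.mem_filter.2 ⟨hin k q hq, by simpa using ⟨q, hq⟩⟩⟩

/-- The depth `n` exceeds every remaining length, so the search is never truncated. Different
neighbours are visited in the order of `turn`, and lines that end at `v` are listed first, in
keeping with the convention in `Precedes`. -/
theorem groups_spec (hN : N.PathTerminalProperty) (hT : N.TableValid T) (n : ℕ) (u v : V)
    (is : List (L × List V)) (his : N.IsBundle u v is) (hne : is ≠ [])
    (hn : ∀ i ∈ is, i.2.length < n) :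
    GroupsSpec N T u v is (groups N.rot T n u v is).val := by
  induction n generalizing u v is with
  | zero =>
    obtain ⟨i, hi⟩ := List.exists_mem_of_ne_nil _ hne
    exact absurd (hn i hi) (by simp)
  | succ n ih =>
    have B := fun w => branch_spec hT his w (n := n) (fun h => ih v w _ (IsBundle.toward his w) h (by
      rintro ⟨l, p⟩ hi
      have := hn _ (mem_toward.1 hi)
      simpa using this))
    obtain ⟨i0, hi0⟩ := List.exists_mem_of_ne_nil _ hne
    have hadj := (his.runs _ hi0).adj
    obtain ⟨t1, t2⟩ := turn_spec (N := N) hadj.symm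
    have hturn : ∀ l w p, (l, w :: p) ∈ is → w ∈ N.turn u v := fun l w p h =>
      (his.runs _ h).mem_turn
    have hend : ∀ l, l ∈ (ending is).val.flatten ↔ (l, []) ∈ is := by
      intro l
      simp [ending_val]
    have hfl : ((ending is).val ++ (N.turn u v).flatMap fun w => branch N.rot T n v w is).flatten
        = (ending is).val.flatten ++
          (N.turn u v).flatMap fun w => (branch N.rot T n v w is).flatten := by
      rw [List.flatten_append]
      congr 1
      induction N.turn u v with
      | nil => simp
      | cons w ws ih => simp [ih]
    -- Two lines ending at `v` would have a common terminal, so the order among ending lines need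
    -- not be discussed.
    have hendeq : ∀ l k, (l, []) ∈ is → (k, []) ∈ is → l = k := by
      intro l k hl hk
      by_contra hlk
      have := hN.2 l k hlk
      rw [Set.disjoint_left] at this
      exact this (by simpa using (his.runs _ hl).nil_terminal)
        (by simpa using (his.runs _ hk).nil_terminal)
    have hendnd : (ending is).val.flatten.Nodup := by
      have : (ending is).val.flatten = (is.filter fun i => i.2.isEmpty).map Prod.fst := by
        rw [ending_val]
        induction (is.filter fun i => i.2.isEmpty) with
        | nil => rfl
        | cons i is ih => simp [ih]
      rw [this]
      exact (List.filter_sublist.map Prod.fst).nodup his.nodup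
    rw [groups_succ_val]
    refine ⟨?_, ?_, ?_, ?_, ?_⟩
    · intro l
      rw [hfl, List.mem_append, hend, List.mem_flatMap]
      constructor
      · rintro (h | ⟨w, -, h⟩)
        · exact ⟨_, h⟩
        · obtain ⟨p, hp⟩ := ((B w).1 l).1 h
          exact ⟨_, hp⟩
      · rintro ⟨p, hp⟩
        cases p with
        | nil => exact Or.inl hp
        | cons w p => exact Or.inr ⟨w, hturn _ _ _ hp, ((B w).1 l).2 ⟨p, hp⟩⟩
    · rw [hfl, List.nodup_append]
      refine ⟨hendnd, ?_, ?_⟩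
      · rw [List.nodup_flatMap]
        refine ⟨fun w _ => (B w).2.1, t1.imp fun {a b} hab => ?_⟩
        intro l hla hlb
        obtain ⟨p, hp⟩ := ((B a).1 l).1 hla
        obtain ⟨q, hq⟩ := ((B b).1 l).1 hlb
        exact hab (List.cons.inj (IsBundle.unique his hp hq)).1
      · rintro l hl k hk rfl
        obtain ⟨w, -, hk⟩ := List.mem_flatMap.1 hk
        obtain ⟨p, hp⟩ := ((B w).1 l).1 hk
        exact absurd (IsBundle.unique his ((hend l).1 hl) hp) (by simp)
    · rw [List.mem_append, List.mem_flatMap]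
      rintro (h | ⟨w, -, h⟩)
      · simp [ending_val] at h
      · exact (B w).2.2.1 h
    · intro l k p q hp hq h
      rw [hfl, List.pair_sublist_append] at h
      rcases h with h | ⟨hl, hk⟩ | h
      · obtain ⟨hl, hk⟩ := List.pair_sublist_mem h
        exact absurd (hendeq l k ((hend l).1 hl) ((hend k).1 hk))
          (List.pair_sublist_ne hendnd h)
      · obtain ⟨w, -, hk⟩ := List.mem_flatMap.1 hk
        obtain ⟨q', hq'⟩ := ((B w).1 k).1 hk
        rw [IsBundle.unique his hp ((hend l).1 hl), IsBundle.unique his hq hq']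
        trivial
      · rw [List.flatMap_def, List.pair_sublist_flatten] at h
        rcases h with ⟨b, hb, h⟩ | ⟨b, c, hbc, hl, hk⟩
        · obtain ⟨w, -, rfl⟩ := List.mem_map.1 hb
          obtain ⟨hl, hk⟩ := List.pair_sublist_mem h
          obtain ⟨p', hp'⟩ := ((B w).1 l).1 hl
          obtain ⟨q', hq'⟩ := ((B w).1 k).1 hk
          obtain rfl := IsBundle.unique his hp hp'
          obtain rfl := IsBundle.unique his hq hq'
          exact (B w).2.2.2.1 l k p' q' hp hq h
        · have hpw : ((N.turn u v).map fun w => (branch N.rot T n v w is).flatten).Pairwise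
              fun b c => ∃ x y, [x, y].Sublist (N.turn u v) ∧
                b = (branch N.rot T n v x is).flatten ∧
                c = (branch N.rot T n v y is).flatten := by
            rw [List.pairwise_map]
            exact List.pairwise_iff_forall_sublist.2 fun {x y} hxy => ⟨x, y, hxy, rfl, rfl⟩
          obtain ⟨x, y, hxy, rfl, rfl⟩ := List.pairwise_iff_forall_sublist.1 hpw hbc
          obtain ⟨p', hp'⟩ := ((B x).1 l).1 hl
          obtain ⟨q', hq'⟩ := ((B y).1 k).1 hk
          obtain rfl := IsBundle.unique his hp hp'
          obtain rfl := IsBundle.unique his hq hq'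
          have hne := List.pair_sublist_ne t1 hxy
          simpa [Precedes, hne] using hxy
    · intro l k p q hp hq hlk
      constructor
      · rintro ⟨g, hg, hl, hk⟩
        rw [List.mem_append, List.mem_flatMap] at hg
        rcases hg with hg | ⟨w, -, hg⟩
        · rw [ending_val] at hg
          obtain ⟨i, -, rfl⟩ := List.mem_map.1 hg
          simp only [List.mem_singleton] at hl hk
          exact absurd (hl.trans hk.symm) hlk
        · obtain ⟨p', hp'⟩ := ((B w).1 l).1 (List.mem_flatten.2 ⟨g, hg, hl⟩)
          obtain ⟨q', hq'⟩ := ((B w).1 k).1 (List.mem_flatten.2 ⟨g, hg, hk⟩)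
          obtain rfl := IsBundle.unique his hp hp'
          obtain rfl := IsBundle.unique his hq hq'
          exact ((B w).2.2.2.2 l k p' q' hp hq hlk).1 ⟨g, hg, hl, hk⟩
      · intro h
        match p, q, h with
        | x :: p, y :: q, h =>
          obtain rfl : x = y := h.1
          obtain ⟨g, hg, hl, hk⟩ := ((B x).2.2.2.2 l k p q hp hq hlk).2 h
          exact ⟨g, List.mem_append.2 (Or.inr (List.mem_flatMap.2 ⟨x, hturn _ _ _ hp, hg⟩)),
            hl, hk⟩

end LineOrdering

/-! ### The invariant: orders at treated edges are forced by what lies beyond -/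

namespace MetroNetwork

open LineOrdering

variable {V L : Type} {N : MetroNetwork V L} {T T' : Table V L}

/-- Both lines follow `B`, so they are still together at the treated edge `cd`, if not stopped by a
treated edge earlier. -/
theorem SameGroup.of_prefix {c d v : V} {B p q : List V} (hp : B <+: p) (hq : B <+: q)
    (h : [c, d] <:+: v :: B) (hT : T (c, d) ≠ []) : SameGroup T v p q := by
  induction B generalizing v p q with
  | nil => simpa using h.length_le
  | cons x B ih =>
    obtain ⟨p, rfl⟩ := hp
    obtain ⟨q, rfl⟩ := hq
    refine ⟨rfl, ?_⟩
    rw [List.infix_cons_iff] at h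
    rcases h with ⟨r, h⟩ | h
    · simp only [List.cons_append, List.nil_append, List.cons.injEq] at h
      obtain ⟨rfl, rfl, -⟩ := h
      exact Or.inl hT
    · exact Or.inr (ih (List.prefix_append _ _) (List.prefix_append _ _) h)

/-- At every vertex of `B` the line has to leave by the next edge of `B`, because it uses that edge
and has not come from it. -/
theorem Runs.prefix {l : L} {u v : V} {p B : List V} (h : N.Runs l u v p)
    (hn : (u :: v :: B).Nodup) (he : ∀ a b, [a, b] <:+: v :: B → s(a, b) ∈ N.edges l) :
    B <+: p := by
  induction B generalizing u v p with
  | nil => exact List.nil_prefix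
  | cons w B ih =>
    obtain ⟨p', rfl⟩ := h.next (he v w ⟨[], B, by simp⟩) (by
      rintro rfl
      simp at hn)
    rw [List.prefix_cons_inj]
    exact ih h.tail hn.of_cons fun a b hab => he a b (List.infix_cons hab)

/-- If two lines share an edge and another treated edge, then they reach a treated edge together
on one of the two sides of the former edge. -/
theorem sameGroup_of_treated (hN : N.PathIntersectionProperty) {l k : L} (hlk : l ≠ k)
    {u v c d : V} {p q p' q' : List V} (hl : N.Runs l u v p) (hk : N.Runs k u v q)
    (hl' : N.Runs l v u p') (hk' : N.Runs k v u q') (hcl : s(c, d) ∈ N.edges l)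
    (hck : s(c, d) ∈ N.edges k) (hne : s(c, d) ≠ s(u, v)) (hT : T (c, d) ≠ [])
    (hT' : T (d, c) ≠ []) : SameGroup T v p q ∨ SameGroup T u p' q' := by
  obtain h0 | ⟨a, b, P, -, hP⟩ := hN l k hlk
  · exfalso
    have mem : ∀ {l p}, N.Runs l u v p → u ∈ N.vertices l := by
      rintro l p (h | h)
      · exact h.subset (by simp)
      · exact List.mem_reverse.1 (h.subset (by simp))
    exact h0 u ⟨mem hl, mem hk⟩
  -- The common part `P` is one path containing both edges. `X` is its vertex list, read so that `u`
  -- precedes `v`.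
  · have key : ∀ X : List V, X.Nodup → (∀ a b, [a, b] <:+: X → s(a, b) ∈ P.1.edges) →
        [u, v] <:+: X → ([c, d] <:+: X ∨ [d, c] <:+: X) →
        SameGroup T v p q ∨ SameGroup T u p' q' := by
      intro X hX hE ⟨A, B, hAB⟩ hcd
      have hX1 : X = A ++ u :: v :: B := by simp [← hAB]
      subst hX1
      have main : ∀ c d, s(c, d) ≠ s(u, v) → T (c, d) ≠ [] → T (d, c) ≠ [] →
          [c, d] <:+: A ++ u :: v :: B → SameGroup T v p q ∨ SameGroup T u p' q' := by
        rintro c d hne hT hT' ⟨C, D, hCD⟩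
        -- Being different from `uv`, the treated edge lies entirely beyond `v` or entirely beyond
        -- `u`; this determines the side on which the lines share a group.
        have hsplit : [c, d] <:+: v :: B ∨ [c, d] <:+: A ++ [u] := by
          rw [List.append_assoc, List.append_eq_append_iff] at hCD
          rcases hCD with ⟨F, h1, h2⟩ | ⟨F, h1, h2⟩
          · match F, h2 with
            | [], h2 =>
              simp only [List.cons_append, List.nil_append, List.cons.injEq] at h2
              exact absurd (by rw [h2.1, h2.2.1]) hne
            | [x], h2 =>
              simp only [List.cons_append, List.nil_append, List.cons.injEq] at h2
              exact Or.inr ⟨C, [], by simp [h1, h2.1, h2.2.1]⟩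
            | x :: y :: F, h2 =>
              simp only [List.cons_append, List.nil_append, List.cons.injEq] at h2
              exact Or.inr ⟨C, F ++ [u], by simp [h1, h2.1, h2.2.1]⟩
          · match F, h2 with
            | [], h2 =>
              simp only [List.cons_append, List.nil_append, List.cons.injEq] at h2
              exact absurd (by rw [h2.1, h2.2.1]) hne
            | x :: F, h2 =>
              simp only [List.cons_append, List.nil_append, List.cons.injEq] at h2
              exact Or.inl ⟨F, D, by simp [h2.2]⟩
        rcases hsplit with h | h
        · left
          have hB : (u :: v :: B).Nodup := (List.suffix_append A _).sublist.nodup hX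
          have hE' : ∀ a b, [a, b] <:+: v :: B → s(a, b) ∈ P.1.edges := fun a b hab =>
            hE a b (hab.trans ((List.suffix_cons u _).isInfix.trans
              (List.suffix_append A _).isInfix))
          exact SameGroup.of_prefix (hl.prefix hB fun a b hab => ((hP _).1 (hE' a b hab)).1)
            (hk.prefix hB fun a b hab => ((hP _).1 (hE' a b hab)).2) h hT
        · right
          have e : (A ++ u :: v :: B).reverse = B.reverse ++ v :: u :: A.reverse := by simp
          have hA : (v :: u :: A.reverse).Nodup := by
            rw [← List.nodup_reverse, e] at hX
            exact (List.suffix_append _ _).sublist.nodup hX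
          have hE' : ∀ a b, [a, b] <:+: u :: A.reverse → s(a, b) ∈ P.1.edges := by
            intro a b hab
            rw [Sym2.eq_swap]
            refine hE b a (List.IsInfix.trans ?_ (show A ++ [u] <:+: A ++ u :: v :: B from
              ⟨[], v :: B, by simp⟩))
            simpa using List.reverse_infix.2 hab
          exact SameGroup.of_prefix (hl'.prefix hA fun a b hab => ((hP _).1 (hE' a b hab)).1)
            (hk'.prefix hA fun a b hab => ((hP _).1 (hE' a b hab)).2)
            (by simpa using List.reverse_infix.2 h) hT'
      rcases hcd with h | h
      · exact main c d hne hT hT' h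
      · exact main d c (by rwa [Sym2.eq_swap]) hT' hT h
    have huv := (hP s(u, v)).2 ⟨hl.mem_edges, hk.mem_edges⟩
    have hcd := (hP s(c, d)).2 ⟨hcl, hck⟩
    rw [← SimpleGraph.Walk.infix_support_iff_mem_edges] at huv hcd
    have hS := P.2.support_nodup
    have hSE : ∀ a b, [a, b] <:+: P.1.support → s(a, b) ∈ P.1.edges := fun a b h =>
      SimpleGraph.Walk.infix_support_iff_mem_edges.1 (Or.inl h)
    rcases huv with h | h
    · exact key _ hS hSE h hcd
    · refine key P.1.support.reverse (List.nodup_reverse.2 hS) ?_ ?_ ?_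
      · intro a b hab
        rw [Sym2.eq_swap]
        exact hSE b a (by simpa using List.reverse_infix.2 hab)
      · simpa using List.reverse_infix.2 h
      · rcases hcd with h | h
        · exact Or.inr (by simpa using List.reverse_infix.2 h)
        · exact Or.inl (by simpa using List.reverse_infix.2 h)

/-- The same orders are stored for both directions of travel. -/
def TableFlips (T : Table V L) : Prop :=
  ∀ u v, T (v, u) = ((T (u, v)).map List.reverse).reverse

theorem TableFlips.endOrder_eq (h : TableFlips T) (u v : V) :
    endOrder T u v = (startOrder T v u).reverse := by
  rw [endOrder, startOrder, h u v]
  cases hl : (T (u, v)).getLast? with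
  | none => simp at hl; simp [hl]
  | some x => simp [hl, List.getLastD_eq_getLast?, List.headD_eq_head?_getD]

theorem TableFlips.eq_nil_iff (h : TableFlips T) (u v : V) : T (v, u) = [] ↔ T (u, v) = [] := by
  rw [h u v]; simp

variable [DecidableEq V]

/-- The invariant of the algorithm: the table is correctly formatted, and the orders at the ends
of the treated edges are those in which the lines separate or reach the next treated edge. -/
structure IsGood (N : MetroNetwork V L) (T : Table V L) : Prop where
  valid : N.TableValid T
  flips : TableFlips T
  ends : ∀ u v, T (u, v) ≠ [] → ∀ l k p q, l ≠ k → N.Runs l u v p → N.Runs k u v q →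
    ([l, k].Sublist (endOrder T u v) ↔ N.Precedes T l k u v p q)

theorem IsGood.pair_sublist_startOrder (h : IsGood N T) {u v : V} {l k : L} :
    [l, k].Sublist (startOrder T u v) ↔ [k, l].Sublist (endOrder T v u) := by
  rw [h.flips.endOrder_eq, List.pair_sublist_reverse]

theorem precedes_cons_self {l k : L} {u v x : V} {p q : List V} :
    N.Precedes T l k u v (x :: p) (x :: q) ↔
      if T (v, x) = [] then N.Precedes T l k v x p q else [l, k].Sublist (startOrder T v x) := by
  simp [Precedes]

/-- Whatever decides the pair, the turn at a vertex or a stored order, is a duplicate-free list and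
cannot contain both orders. -/
theorem Precedes.asymm (hT : N.TableValid T) {l k : L} {u v : V} {p q : List V}
    (hp : N.Runs l u v p) (hq : N.Runs k u v q) (h : N.Precedes T l k u v p q) :
    ¬ N.Precedes T k l u v q p := by
  induction p generalizing u v q with
  | nil => cases q <;> simp [Precedes] at h ⊢
  | cons x p ih =>
    cases q with
    | nil => simp [Precedes] at h
    | cons y q =>
      by_cases hxy : x = y
      · subst hxy
        rw [precedes_cons_self] at h ⊢
        split_ifs at h ⊢ with hx
        · exact ih hp.tail hq.tail h
        · refine List.pair_sublist_asymm ?_ h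
          obtain ⟨near, rest, hnear⟩ := List.exists_cons_of_ne_nil hx
          rw [startOrder, hnear]
          exact (hT v x hp.tail.adj near (by simp [hnear])).1
      · simp only [Precedes, hxy, Ne.symm hxy, if_false] at h ⊢
        exact List.pair_sublist_asymm (turn_spec hp.adj.symm).1 h

/-- Lines that reach a treated edge together on one side of an untreated edge are in the same
relative order on both sides. -/
theorem IsGood.precedes_of_sameGroup (hT : IsGood N T) {l k : L} (hlk : l ≠ k) {u v : V}
    {p q p' q' : List V} (huv : T (u, v) = []) (hl : N.Runs l u v p) (hk : N.Runs k u v q)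
    (hl' : N.Runs l v u p') (hk' : N.Runs k v u q') (h : SameGroup T u p' q') :
    N.Precedes T k l v u q' p' ↔ N.Precedes T l k u v p q := by
  induction p' generalizing u v p q q' with
  | nil => simp [SameGroup] at h
  | cons x p' ih =>
    cases q' with
    | nil => simp [SameGroup] at h
    | cons y q' =>
      obtain ⟨rfl, h⟩ := h
      have b1 : N.Runs l x u (v :: p) := by
        obtain ⟨r, hr, hr'⟩ := hl'.back
        rw [hl.unique hr]
        exact hr' x p' rfl
      have b2 : N.Runs k x u (v :: q) := by
        obtain ⟨r, hr, hr'⟩ := hk'.back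
        rw [hk.unique hr]
        exact hr' x q' rfl
      -- Looking from `x` through `u`, the untreated edge `uv` is transparent. If `ux` is treated,
      -- the invariant at its end `u` therefore refers to what lies beyond `v`; otherwise the
      -- argument is repeated one edge further back.
      have e : N.Precedes T l k x u (v :: p) (v :: q) ↔ N.Precedes T l k u v p q := by
        rw [precedes_cons_self, if_pos huv]
      rw [precedes_cons_self, ← e]
      split_ifs with hx
      · rw [ne_eq, hx] at h
        exact ih ((hT.flips.eq_nil_iff u x).2 hx) b1 b2 hl'.tail hk'.tail (by simpa using h)
      · rw [hT.pair_sublist_startOrder]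
        exact hT.ends x u (fun h' => hx ((hT.flips.eq_nil_iff x u).2 h')) l k _ _ hlk b1 b2

/-- All changed entries belong to edges at `c`, and a walk that avoids `c` never consults them. -/
theorem precedes_congr_of_notMem {c : V} (hc : ∀ x y, x ≠ c → y ≠ c → T' (x, y) = T (x, y))
    {l k : L} {u v : V} {p q : List V} (h : c ∉ v :: p) :
    N.Precedes T' l k u v p q ↔ N.Precedes T l k u v p q := by
  induction p generalizing u v q with
  | nil => cases q <;> simp [Precedes]
  | cons x p ih =>
    cases q with
    | nil => simp [Precedes]
    | cons y q =>
      by_cases hxy : x = y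
      · subst hxy
        simp only [List.mem_cons, not_or] at h
        rw [precedes_cons_self, precedes_cons_self, startOrder, startOrder,
          hc v x (Ne.symm h.1) (Ne.symm h.2.1)]
        split_ifs
        · exact ih (by simpa using h.2)
        · exact Iff.rfl
      · simp [Precedes, hxy]

/-- Treating one more edge in such a way that its ends have the correct orders keeps the
invariant. -/
theorem IsGood.update (hT : IsGood N T) {a b : V} (valid : N.TableValid T')
    (flips : TableFlips T') (old : ∀ u v, s(u, v) ≠ s(a, b) → T' (u, v) = T (u, v))
    (new : ∀ u v, s(u, v) = s(a, b) → T (u, v) = [] ∧ T' (u, v) ≠ [])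
    (ends : ∀ u v, s(u, v) = s(a, b) → ∀ l k p q, l ≠ k → N.Runs l u v p → N.Runs k u v q →
      ([l, k].Sublist (endOrder T' u v) ↔ N.Precedes T l k u v p q)) : IsGood N T' := by
  refine ⟨valid, flips, ?_⟩
  intro u v huv l k p q hlk hl hk
  by_cases hs : s(u, v) = s(a, b)
  -- On the new edge itself the continuation does not return to `u`, so old and new table give the
  -- same answer.
  · rw [ends u v hs l k p q hlk hl hk]
    refine (precedes_congr_of_notMem (c := u) (fun x y hx hy => old x y fun h => ?_)
      (List.nodup_cons.1 hl.nodup).1).symm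
    rw [← hs, Sym2.eq_iff] at h
    rcases h with h | h
    · exact hx h.1
    · exact hy h.2
  · have hTuv := old u v hs
    rw [hTuv] at huv
    have e : endOrder T' u v = endOrder T u v := by rw [endOrder, endOrder, hTuv]
    -- Walks forward from an old treated edge whose stored order is `ord`. The inner hypothesis says
    -- that looking back from the current position also yields `ord`. If the walk meets the new
    -- edge, `ends` equates the order stored there with this backward view.
    have key : ∀ (ord : Prop) (p q : List V) (u v : V), N.Runs l u v p → N.Runs k u v q →
        (∀ w p' q', N.Runs l v u p' → N.Runs k v u q' →
          (N.Precedes T k l w v (u :: q') (u :: p') ↔ ord)) →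
        (N.Precedes T l k u v p q ↔ ord) → (N.Precedes T' l k u v p q ↔ ord) := by
      intro ord p
      induction p with
      | nil =>
        intro q u v _ _ _ h
        cases q <;> simpa [Precedes] using h
      | cons x p ih =>
        intro q u v hl hk H h
        cases q with
        | nil => simpa [Precedes] using h
        | cons y q =>
          by_cases hxy : x = y
          · subst hxy
            obtain ⟨p', hp', hp''⟩ := hl.back
            obtain ⟨q', hq', hq''⟩ := hk.back
            have hp'' := hp'' x p rfl
            have hq'' := hq'' x q rfl
            rw [precedes_cons_self] at h ⊢
            by_cases hvx : s(v, x) = s(a, b)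
            · rw [if_neg (new v x hvx).2, startOrder, ← List.pair_sublist_reverse]
              have := flips.endOrder_eq x v
              rw [startOrder] at this
              rw [← this, ends x v (by rw [Sym2.eq_swap, hvx]) k l _ _ hlk.symm hq'' hp'']
              exact H x p' q' hp' hq'
            · rw [startOrder, old v x hvx]
              by_cases h0 : T (v, x) = []
              · rw [if_pos h0] at h ⊢
                -- The edge just passed is untreated in `T`, so the backward view reaches through it
                -- and the hypothesis moves along.
                refine ih q v x hl.tail hk.tail (fun w r s hr hs => ?_) h
                rw [precedes_cons_self, if_pos ((hT.flips.eq_nil_iff v x).2 h0),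
                  hr.unique hp'', hs.unique hq'']
                exact H x p' q' hp' hq'
              · rw [if_neg h0] at h ⊢
                exact h
          · simpa [Precedes, hxy] using h
    rw [e, hT.ends u v huv l k p q hlk hl hk]
    refine (key _ p q u v hl hk (fun w p' q' hp' hq' => ?_) Iff.rfl).symm
    rw [precedes_cons_self, if_neg fun h => huv ((hT.flips.eq_nil_iff u v).1 h),
      hT.pair_sublist_startOrder, hT.ends u v huv l k p q hlk hl hk]

end MetroNetwork

/-! ### What is computed for one edge -/

namespace LineOrdering

open MetroNetwork

variable {V L : Type} [DecidableEq V] [DecidableEq L] {N : MetroNetwork V L} {T : Table V L}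

theorem cutLine_cons_val (u v a b : V) (back rest : List V) :
    (cutLine u v back (a :: b :: rest)).val =
      if a = u ∧ b = v then some (back, rest)
      else if a = v ∧ b = u then some (rest, back)
      else (cutLine u v (a :: back) (b :: rest)).val := by
  rw [cutLine]
  simp only [val_bind, val_same]
  by_cases h1 : a = u ∧ b = v
  · simp [h1]
  · by_cases h2 : a = v ∧ b = u
    · have : ¬ (v = u ∧ u = v) := by rintro ⟨rfl, -⟩; exact h1 h2
      simp [h2, this]
    · simp [h1, h2]

/-- `back.reverse ++ rem` is always the whole line. The two alternatives are the two directions in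
which it may traverse the edge. -/
theorem cutLine_some {u v : V} {back rem x y : List V}
    (h : (cutLine u v back rem).val = some (x, y)) :
    ((u :: v :: y) <:+ back.reverse ++ rem ∧ (v :: u :: x) <:+ (back.reverse ++ rem).reverse) ∨
    ((v :: u :: x) <:+ back.reverse ++ rem ∧ (u :: v :: y) <:+ (back.reverse ++ rem).reverse) := by
  match rem with
  | [] => simp [cutLine] at h
  | [a] => simp [cutLine] at h
  | a :: b :: rest =>
    rw [cutLine_cons_val] at h
    split_ifs at h with h1 h2
    · obtain ⟨rfl, rfl⟩ := h1
      obtain ⟨rfl, rfl⟩ := Prod.mk.inj (Option.some.inj h)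
      exact Or.inl ⟨List.suffix_append _ _, ⟨rest.reverse, by simp⟩⟩
    · obtain ⟨rfl, rfl⟩ := h2
      obtain ⟨rfl, rfl⟩ := Prod.mk.inj (Option.some.inj h)
      exact Or.inr ⟨List.suffix_append _ _, ⟨rest.reverse, by simp⟩⟩
    · simpa using cutLine_some h

theorem cutLine_none {u v : V} {back rem : List V} (h : (cutLine u v back rem).val = none) :
    ¬ [u, v] <:+: rem ∧ ¬ [v, u] <:+: rem := by
  match rem with
  | [] => simp
  | [a] =>
    have : ∀ x y, ¬ [x, y] <:+: [a] := fun x y h => by simpa using h.length_le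
    simp [this]
  | a :: b :: rest =>
    rw [cutLine_cons_val] at h
    split_ifs at h with h1 h2
    obtain ⟨h3, h4⟩ := cutLine_none h
    simp only [List.infix_cons_iff (l₂ := b :: rest), not_or, h3, h4, not_false_eq_true, and_true]
    constructor
    · rintro ⟨r, hr⟩
      simp only [List.cons_append, List.cons.injEq] at hr
      exact h1 ⟨hr.1.symm, hr.2.1.symm⟩
    · rintro ⟨r, hr⟩
      simp only [List.cons_append, List.cons.injEq] at hr
      exact h2 ⟨hr.1.symm, hr.2.1.symm⟩

theorem linesThrough_spec (N : MetroNetwork V L) (u v : V) (ls : List L) :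
    ((linesThrough N.vertices u v ls).val.map Prod.fst).Sublist ls ∧
    (∀ l ∈ ls, s(u, v) ∈ N.edges l →
      l ∈ (linesThrough N.vertices u v ls).val.map Prod.fst) ∧
    ∀ i ∈ (linesThrough N.vertices u v ls).val,
      N.Runs i.1 v u i.2.1 ∧ N.Runs i.1 u v i.2.2 := by
  induction ls with
  | nil => simp [linesThrough]
  | cons l ls ih =>
    simp only [linesThrough, val_bind, val_load]
    generalize hR : (linesThrough N.vertices u v ls).val = R at *
    obtain ⟨h1, h2, h3⟩ := ih
    cases hc : (cutLine u v [] (N.vertices l)).val with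
    | none =>
      refine ⟨h1.cons l, ?_, h3⟩
      intro k hk hkl
      rcases List.mem_cons.1 hk with rfl | hk
      · have := cutLine_none hc
        rw [mem_edges_iff] at hkl
        tauto
      · exact h2 k hk hkl
    | some xy =>
      obtain ⟨x, y⟩ := xy
      refine ⟨by simpa using h1, ?_, ?_⟩
      · intro k hk hkl
        rcases List.mem_cons.1 hk with rfl | hk
        · simp
        · have := h2 k hk hkl
          simp only [val_pure, List.map_cons, List.mem_cons]
          exact Or.inr this
      · rintro i hi
        rcases List.mem_cons.1 hi with rfl | hi
        · have := cutLine_some hc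
          simp only [List.reverse_nil, List.nil_append] at this
          exact ⟨this.elim (fun h => Or.inr h.2) fun h => Or.inl h.1,
            this.elim (fun h => Or.inl h.1) fun h => Or.inr h.2⟩
        · exact h3 i hi

theorem record_val (T : Table V L) (u v : V) (O : List (List L)) :
    (record T u v O).val = Function.update (Function.update T (u, v) O) (v, u)
      (O.map List.reverse).reverse := by
  simp [record]

/-- What is achieved on a newly treated edge. -/
structure EdgeSpec (N : MetroNetwork V L) (T : Table V L) (u v : V) (σ τ : List L)
    (O : List (List L)) : Prop where
  sorting : IsSorting σ τ O
  nodup : σ.Nodup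
  mem : ∀ l, l ∈ σ ↔ s(u, v) ∈ N.edges l
  last : ∀ l k p q, l ≠ k → N.Runs l u v p → N.Runs k u v q →
    ([l, k].Sublist τ ↔ N.Precedes T l k u v p q)
  first : ∀ l k p q, l ≠ k → N.Runs l v u p → N.Runs k v u q →
    ([k, l].Sublist σ ↔ N.Precedes T l k v u p q)
  count : ∃ D : Finset (L × L), (∀ x ∈ D, x.1 ≠ x.2 ∧ s(u, v) ∈ N.edges x.1 ∧
    s(u, v) ∈ N.edges x.2 ∧ ∀ p q p' q', N.Runs x.1 u v p → N.Runs x.2 u v q →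
      N.Runs x.1 v u p' → N.Runs x.2 v u q' → ¬ SameGroup T v p q ∧ ¬ SameGroup T u p' q') ∧
    (O.length - 1) ^ 2 ≤ 2 * D.card

/-- There are no pairs of different lines, so all conditions on orders are vacuous and no pair has
to be charged. -/
theorem edgeSpec_of_subsingleton {u v : V} {σ : List L} (hσ : σ.length ≤ 1)
    (mem : ∀ l, l ∈ σ ↔ s(u, v) ∈ N.edges l) : EdgeSpec N T u v σ σ [σ] := by
  have key : ∀ l k, l ≠ k → s(u, v) ∈ N.edges l → s(u, v) ∈ N.edges k → False := by
    intro l k hlk hl hk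
    rw [← mem] at hl hk
    match σ, hσ with
    | [], _ => simp at hl
    | [a], _ => exact hlk ((List.mem_singleton.1 hl).trans (List.mem_singleton.1 hk).symm)
  refine ⟨⟨rfl, rfl, by simp⟩, ?_, mem, ?_, ?_, ∅, by simp, by simp⟩
  · match σ, hσ with
    | [], _ => simp
    | [a], _ => simp
  · intro l k p q hlk hl hk
    exact (key l k hlk hl.mem_edges hk.mem_edges).elim
  · intro l k p q hlk hl hk
    exact (key l k hlk (Sym2.eq_swap ▸ hl.mem_edges) (Sym2.eq_swap ▸ hk.mem_edges)).elim

/-- Any two lines are comparable in the list and `Precedes` is asymmetric, so the one implication in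
`GroupsSpec` is already an equivalence. -/
theorem GroupsSpec.pair_sublist_iff (hT : N.TableValid T) {u v : V} {is : List (L × List V)}
    {G : List (List L)} (hG : GroupsSpec N T u v is G) (his : N.IsBundle u v is) {l k : L}
    {p q : List V} (hl : (l, p) ∈ is) (hk : (k, q) ∈ is) (hlk : l ≠ k) :
    [l, k].Sublist G.flatten ↔ N.Precedes T l k u v p q := by
  refine ⟨hG.precedes l k p q hl hk, fun h => ?_⟩
  have h1 := (hG.mem l).2 ⟨p, hl⟩
  have h2 := (hG.mem k).2 ⟨q, hk⟩
  refine (List.pair_sublist_total h1 h2 hlk).resolve_right fun h' => ?_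
  exact h.asymm hT (his.runs _ hl) (his.runs _ hk) (hG.precedes k l q p hk hl h')

/-- The groups on the two sides of an edge are in accordance with each other. -/
theorem GroupsSpec.compatible (hT : IsGood N T) {u v : V} (huv : T (u, v) = [])
    {iu iv : List (L × List V)} (hiu : N.IsBundle v u iu) (hiv : N.IsBundle u v iv)
    (memu : ∀ l, (∃ p, (l, p) ∈ iu) ↔ s(u, v) ∈ N.edges l)
    (memv : ∀ l, (∃ p, (l, p) ∈ iv) ↔ s(u, v) ∈ N.edges l)
    {Gu Gv : List (List L)} (hu : GroupsSpec N T v u iu Gu) (hv : GroupsSpec N T u v iv Gv) :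
    Compatible (Gu.map List.reverse).reverse Gv := by
  have hvu : T (v, u) = [] := (hT.flips.eq_nil_iff u v).2 huv
  -- The groups beyond `u` were found looking from `v` to `u`, where left and right are exchanged;
  -- hence the reversal of the groups and of their sequence.
  have eu : (Gu.map List.reverse).reverse.flatten = Gu.flatten.reverse :=
    List.reverse_flatten.symm
  have mu : ∀ l, l ∈ Gu.flatten ↔ s(u, v) ∈ N.edges l := fun l => (hu.mem l).trans (memu l)
  have mv : ∀ l, l ∈ Gv.flatten ↔ s(u, v) ∈ N.edges l := fun l => (hv.mem l).trans (memv l)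
  refine ⟨?_, hv.nodup, fun x => ?_, ?_, hv.nonempty, ?_, ?_⟩
  · rw [eu]; exact List.nodup_reverse.2 hu.nodup
  · rw [eu, List.mem_reverse, mu, mv]
  · have := hu.nonempty
    simpa using this
  · intro g hg x y hxy
    obtain ⟨g', hg', rfl⟩ := List.mem_map.1 (List.mem_reverse.1 hg)
    rw [List.pair_sublist_reverse] at hxy
    have hyx := hxy.trans (List.sublist_flatten_of_mem hg')
    have hne := (List.pair_sublist_ne hu.nodup hyx).symm
    obtain ⟨hy, hx⟩ := List.pair_sublist_mem hxy
    obtain ⟨px', hpx'⟩ := (hu.mem x).1 (List.mem_flatten.2 ⟨g', hg', hx⟩)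
    obtain ⟨py', hpy'⟩ := (hu.mem y).1 (List.mem_flatten.2 ⟨g', hg', hy⟩)
    obtain ⟨px, hpx⟩ := (memv x).2 ((memu x).1 ⟨_, hpx'⟩)
    obtain ⟨py, hpy⟩ := (memv y).2 ((memu y).1 ⟨_, hpy'⟩)
    rw [hv.pair_sublist_iff hT.valid hiv hpx hpy hne]
    rw [hu.pair_sublist_iff hT.valid hiu hpy' hpx' hne.symm] at hyx
    -- A common group means that a treated edge is reached together; the order there was itself
    -- determined by the opposite side of `uv`.
    exact (hT.precedes_of_sameGroup hne huv (hiv.runs _ hpx) (hiv.runs _ hpy) (hiu.runs _ hpx')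
      (hiu.runs _ hpy') ((hu.same _ _ _ _ hpx' hpy' hne).1 ⟨g', hg', hx, hy⟩)).1 hyx
  · intro g hg x y hxy
    have hxy' := hxy.trans (List.sublist_flatten_of_mem hg)
    have hne := List.pair_sublist_ne hv.nodup hxy'
    obtain ⟨hx, hy⟩ := List.pair_sublist_mem hxy
    obtain ⟨px, hpx⟩ := (hv.mem x).1 (List.mem_flatten.2 ⟨g, hg, hx⟩)
    obtain ⟨py, hpy⟩ := (hv.mem y).1 (List.mem_flatten.2 ⟨g, hg, hy⟩)
    obtain ⟨px', hpx'⟩ := (memu x).2 ((memv x).1 ⟨_, hpx⟩)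
    obtain ⟨py', hpy'⟩ := (memu y).2 ((memv y).1 ⟨_, hpy⟩)
    rw [eu, List.pair_sublist_reverse, hu.pair_sublist_iff hT.valid hiu hpy' hpx' hne.symm]
    rw [hv.pair_sublist_iff hT.valid hiv hpx hpy hne] at hxy'
    exact (hT.precedes_of_sameGroup hne.symm hvu (hiu.runs _ hpy') (hiu.runs _ hpx')
      (hiv.runs _ hpy) (hiv.runs _ hpx)
      ((hv.same _ _ _ _ hpy hpx hne.symm).1 ⟨g, hg, hy, hx⟩)).1 hxy'

/-- The orders computed for an edge with at least two lines. -/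
theorem edgeSpec_sortEdge (hT : IsGood N T) {u v : V} (huv : T (u, v) = [])
    {iu iv : List (L × List V)} (hne : iv ≠ []) (hiu : N.IsBundle v u iu) (hiv : N.IsBundle u v iv)
    (memu : ∀ l, (∃ p, (l, p) ∈ iu) ↔ s(u, v) ∈ N.edges l)
    (memv : ∀ l, (∃ p, (l, p) ∈ iv) ↔ s(u, v) ∈ N.edges l)
    {Gu Gv : List (List L)} (hu : GroupsSpec N T v u iu Gu) (hv : GroupsSpec N T u v iv Gv) :
    EdgeSpec N T u v (Gu.map List.reverse).reverse.flatten Gv.flatten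
      (sortEdge (Gu.map List.reverse).reverse Gv).val := by
  have eu : (Gu.map List.reverse).reverse.flatten = Gu.flatten.reverse :=
    List.reverse_flatten.symm
  have mu : ∀ l, l ∈ Gu.flatten ↔ s(u, v) ∈ N.edges l := fun l => (hu.mem l).trans (memu l)
  have mv : ∀ l, l ∈ Gv.flatten ↔ s(u, v) ∈ N.edges l := fun l => (hv.mem l).trans (memv l)
  have mem_iu : ∀ l p, N.Runs l v u p → (l, p) ∈ iu := by
    intro l p h
    obtain ⟨p', hp'⟩ := (memu l).2 (Sym2.eq_swap ▸ h.mem_edges)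
    rwa [h.unique (hiu.runs _ hp')]
  have mem_iv : ∀ l p, N.Runs l u v p → (l, p) ∈ iv := by
    intro l p h
    obtain ⟨p', hp'⟩ := (memv l).2 h.mem_edges
    rwa [h.unique (hiv.runs _ hp')]
  have mem_left : ∀ l k, (∃ g ∈ (Gu.map List.reverse).reverse, l ∈ g ∧ k ∈ g) ↔
      ∃ g ∈ Gu, l ∈ g ∧ k ∈ g := by
    intro l k
    simp only [List.mem_reverse, List.mem_map]
    constructor
    · rintro ⟨_, ⟨g, hg, rfl⟩, h⟩
      exact ⟨g, hg, by simpa using h⟩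
    · rintro ⟨g, hg, h⟩
      exact ⟨_, ⟨g, hg, rfl⟩, by simpa using h⟩
  have comp := GroupsSpec.compatible hT huv hiu hiv memu memv hu hv
  have hgl : (Gu.map List.reverse).reverse ≠ [] := by
    obtain ⟨⟨l, p⟩, hi⟩ := List.exists_mem_of_ne_nil _ hne
    have := (mu l).2 ((memv l).1 ⟨p, hi⟩)
    intro h
    rw [← List.mem_reverse, ← eu, h] at this
    simp at this
  obtain ⟨h1, D, h2, h3⟩ := comp.sortEdge_spec hgl
  refine ⟨h1, comp.nodup_left, ?_, ?_, ?_, D, ?_, h3⟩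
  · intro l
    rw [eu, List.mem_reverse, mu]
  · intro l k p q hlk hl hk
    exact hv.pair_sublist_iff hT.valid hiv (mem_iv _ _ hl) (mem_iv _ _ hk) hlk
  · intro l k p q hlk hl hk
    rw [eu, List.pair_sublist_reverse]
    exact hu.pair_sublist_iff hT.valid hiu (mem_iu _ _ hl) (mem_iu _ _ hk) hlk
  · rintro ⟨l, k⟩ hlk
    obtain ⟨a1, a2, a3, a4⟩ := h2 _ hlk
    simp only at a1 a2 a3 a4 ⊢
    have hne : l ≠ k := by
      rintro rfl
      obtain ⟨g, hg, h⟩ := List.mem_flatten.1 a1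
      exact a3 ⟨g, hg, h, h⟩
    rw [eu, List.mem_reverse, mu] at a1 a2
    refine ⟨hne, a1, a2, fun p q p' q' hp hq hp' hq' => ?_⟩
    rw [← hv.same l k p q (mem_iv _ _ hp) (mem_iv _ _ hq) hne,
      ← hu.same l k p' q' (mem_iu _ _ hp') (mem_iu _ _ hq') hne, ← mem_left]
    exact ⟨a4, a3⟩

/-- The lines through an edge, with their continuations on both sides. -/
theorem linesThrough_bundles (N : MetroNetwork V L) (u v : V) {ls : List L} (hls : ls.Nodup)
    (hall : ∀ l, l ∈ ls) {is : List (L × List V × List V)}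
    (his : (linesThrough N.vertices u v ls).val = is) :
    (∀ l, l ∈ is.map Prod.fst ↔ s(u, v) ∈ N.edges l) ∧
    N.IsBundle v u (is.map fun i => (i.1, i.2.1)) ∧
    N.IsBundle u v (is.map fun i => (i.1, i.2.2)) ∧
    (∀ l, (∃ p, (l, p) ∈ is.map fun i => (i.1, i.2.1)) ↔ s(u, v) ∈ N.edges l) ∧
    (∀ l, (∃ p, (l, p) ∈ is.map fun i => (i.1, i.2.2)) ↔ s(u, v) ∈ N.edges l) := by
  obtain ⟨h1, h2, h3⟩ := linesThrough_spec N u v ls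
  have hnd := h1.nodup hls
  rw [his] at h1 h2 h3 hnd
  have hmem : ∀ l, l ∈ is.map Prod.fst ↔ s(u, v) ∈ N.edges l := by
    refine fun l => ⟨fun h => ?_, h2 l (hall l)⟩
    obtain ⟨i, hi, rfl⟩ := List.mem_map.1 h
    exact (h3 i hi).2.mem_edges
  have hex : ∀ (f : L × List V × List V → List V) l,
      (∃ p, (l, p) ∈ is.map fun i => (i.1, f i)) ↔ s(u, v) ∈ N.edges l := by
    intro f l
    rw [← hmem, List.mem_map]
    constructor
    · rintro ⟨p, hp⟩
      obtain ⟨i, hi, e⟩ := List.mem_map.1 hp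
      exact ⟨i, hi, (Prod.mk.inj e).1⟩
    · rintro ⟨i, hi, rfl⟩
      exact ⟨_, List.mem_map.2 ⟨i, hi, rfl⟩⟩
  refine ⟨hmem, ⟨by simpa only [List.map_map, Function.comp_def] using hnd, ?_⟩,
    ⟨by simpa only [List.map_map, Function.comp_def] using hnd, ?_⟩, hex _, hex _⟩
  · rintro _ hm
    obtain ⟨i, hi, rfl⟩ := List.mem_map.1 hm
    exact (h3 i hi).1
  · rintro _ hm
    obtain ⟨i, hi, rfl⟩ := List.mem_map.1 hm
    exact (h3 i hi).2

theorem treatEdge_spec (hN : N.PathTerminalProperty) (hT : IsGood N T) {u v : V}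
    (huv : T (u, v) = []) {ls : List L} (hls : ls.Nodup) (hall : ∀ l, l ∈ ls) {depth : ℕ}
    (hdepth : ∀ l a b p, N.Runs l a b p → p.length < depth) :
    ∃ σ τ O, EdgeSpec N T u v σ τ O ∧ (treatEdge N.rot N.vertices ls depth T u v).val =
      Function.update (Function.update T (u, v) O) (v, u) (O.map List.reverse).reverse := by
  obtain ⟨hmem, hiu, hiv, memu, memv⟩ := linesThrough_bundles N u v hls hall rfl
  simp only [treatEdge, val_bind]
  generalize (linesThrough N.vertices u v ls).val = is at *
  match is, hmem, hiu, hiv, memu, memv with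
  | [], hmem, _, _, _, _ =>
    exact ⟨[], [], _, edgeSpec_of_subsingleton (by simp) (by simpa using hmem), record_val _ _ _ _⟩
  | [(l, _)], hmem, _, _, _, _ =>
    exact ⟨[l], [l], _, edgeSpec_of_subsingleton (by simp) (by simpa using hmem),
      record_val _ _ _ _⟩
  | i :: j :: is, _, hiu, hiv, memu, memv =>
    simp only [val_bind, val_map, val_pure, val_reverse, record_val]
    exact ⟨_, _, _, edgeSpec_sortEdge hT huv (by simp) hiu hiv memu memv
      (groups_spec hN hT.valid depth v u _ hiu (by simp)
        fun i hi => hdepth _ _ _ _ (hiu.runs i hi))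
      (groups_spec hN hT.valid depth u v _ hiv (by simp)
        fun i hi => hdepth _ _ _ _ (hiv.runs i hi)), rfl⟩

end LineOrdering

/-! ### Induction over the treated edges -/

namespace MetroNetwork

open LineOrdering

variable {V L : Type} [DecidableEq V] [DecidableEq L] {N : MetroNetwork V L} {T T' : Table V L}

theorem SameGroup.symm {v : V} {p q : List V} (h : SameGroup T v p q) : SameGroup T v q p := by
  induction p generalizing v q with
  | nil => simp [SameGroup] at h
  | cons x p ih =>
    cases q with
    | nil => simp [SameGroup] at h
    | cons y q =>
      obtain ⟨rfl, h⟩ := h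
      exact ⟨rfl, h.imp id ih⟩

/-- Lines that have met on a treated edge do not cross on another edge. -/
theorem pair_sublist_iff_of_treated (hN : N.PathIntersectionProperty) (hT : IsGood N T)
    {u v : V} (huv : T (u, v) = []) {σ τ : List L} {O : List (List L)}
    (h : EdgeSpec N T u v σ τ O) {l k : L} (hlk : l ≠ k) {c d : V} (hcd : T (c, d) ≠ [])
    (hl : s(c, d) ∈ N.edges l) (hk : s(c, d) ∈ N.edges k) :
    [l, k].Sublist σ ↔ [l, k].Sublist τ := by
  have hmem : ∀ l, l ∈ τ ↔ s(u, v) ∈ N.edges l := fun l => by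
    rw [← h.mem]
    exact ((h.sorting.perm τ (List.mem_of_getLast? h.sorting.last)).mem_iff)
  have hvu : T (v, u) = [] := (hT.flips.eq_nil_iff u v).2 huv
  by_cases hlu : s(u, v) ∈ N.edges l ∧ s(u, v) ∈ N.edges k
  · obtain ⟨p, hp⟩ := exists_runs hlu.1
    obtain ⟨q, hq⟩ := exists_runs hlu.2
    obtain ⟨p', hp', -⟩ := hp.back
    obtain ⟨q', hq', -⟩ := hq.back
    rw [h.last l k p q hlk hp hq, h.first k l q' p' hlk.symm hq' hp']
    have hne : s(c, d) ≠ s(u, v) := by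
      rw [ne_eq, Sym2.eq_iff]
      rintro (⟨rfl, rfl⟩ | ⟨rfl, rfl⟩)
      · exact hcd huv
      · exact hcd hvu
    rcases sameGroup_of_treated hN hlk hp hq hp' hq' hl hk hne hcd
      (fun h => hcd ((hT.flips.eq_nil_iff c d).1 h)) with hs | hs
    · exact (hT.precedes_of_sameGroup hlk.symm hvu hq' hp' hq hp hs.symm).symm
    · exact hT.precedes_of_sameGroup hlk huv hp hq hp' hq' hs
  · constructor
    · intro h'
      obtain ⟨h1, h2⟩ := List.pair_sublist_mem h'
      exact absurd ⟨(h.mem l).1 h1, (h.mem k).1 h2⟩ hlu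
    · intro h'
      obtain ⟨h1, h2⟩ := List.pair_sublist_mem h'
      exact absurd ⟨(hmem l).1 h1, (hmem k).1 h2⟩ hlu

/-- What has been achieved when the edges in `ds` have been treated. -/
structure Progress (N : MetroNetwork V L) (ds : List (V × V)) (T : Table V L) : Prop where
  good : IsGood N T
  treated : ∀ u v, T (u, v) ≠ [] ↔ s(u, v) ∈ ds.map fun e => s(e.1, e.2)
  sorting : ∀ u v, T (u, v) ≠ [] → IsSorting (startOrder T u v) (endOrder T u v) (T (u, v))
  crossings : ∀ l k, l ≠ k → pairCrossings T ds l k ≤ 1 ∧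
    ((∀ u v, T (u, v) ≠ [] → s(u, v) ∈ N.edges l → s(u, v) ∉ N.edges k) →
      pairCrossings T ds l k = 0)
  count : ∃ D : Finset (L × L), (∀ x ∈ D, ∃ u v, T (u, v) ≠ [] ∧ s(u, v) ∈ N.edges x.1 ∧
    s(u, v) ∈ N.edges x.2) ∧ (ds.map fun e => ((T e).length - 1) ^ 2).sum ≤ 2 * D.card

theorem progress_nil : Progress N [] (fun _ => [] : Table V L) where
  good := ⟨by intro; simp, by intro; simp, by simp⟩
  treated := by simp
  sorting := by simp
  crossings := by simp [pairCrossings]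
  count := ⟨∅, by simp⟩

theorem _root_.LineOrdering.EdgeSpec.valid {u v : V} {σ τ : List L} {O : List (List L)}
    (h : EdgeSpec N T u v σ τ O) :
    ∀ π ∈ O, π.Nodup ∧ ∀ l, l ∈ π ↔ s(u, v) ∈ N.edges l := by
  intro π hπ
  have hp := h.sorting.perm π hπ
  exact ⟨hp.nodup_iff.2 h.nodup, fun l => by rw [hp.mem_iff, h.mem]⟩

/-- Both bookkeeping clauses use the same dichotomy. Lines that share a treated edge neither cross
on the new edge nor are charged to it; lines that share none have neither crossed nor been charged
before. -/
theorem Progress.step (hN : N.PathIntersectionProperty) {ds : List (V × V)}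
    (hT : Progress N ds T) {u v : V} (hadj : N.graph.Adj u v)
    (huv : s(u, v) ∉ ds.map fun e => s(e.1, e.2)) {σ τ : List L} {O : List (List L)}
    (h : EdgeSpec N T u v σ τ O) :
    Progress N (ds ++ [(u, v)]) (Function.update (Function.update T (u, v) O) (v, u)
      (O.map List.reverse).reverse) := by
  have hTuv : T (u, v) = [] := by
    by_contra h'
    exact huv ((hT.treated u v).1 h')
  have hTvu : T (v, u) = [] := (hT.good.flips.eq_nil_iff u v).2 hTuv
  have hne : u ≠ v := hadj.ne
  have hO := h.sorting.ne_nil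
  set T' := Function.update (Function.update T (u, v) O) (v, u) (O.map List.reverse).reverse
    with hT'
  have e1 : T' (u, v) = O := by
    rw [hT', Function.update_of_ne (by simp [hne]), Function.update_self]
  have e2 : T' (v, u) = (O.map List.reverse).reverse := by rw [hT', Function.update_self]
  have e3 : ∀ a b, s(a, b) ≠ s(u, v) → T' (a, b) = T (a, b) := by
    intro a b hab
    rw [ne_eq, Sym2.eq_iff, not_or] at hab
    rw [hT', Function.update_of_ne (by simpa using hab.2),
      Function.update_of_ne (by simpa using hab.1)]
  have s1 : startOrder T' u v = σ := by
    rw [startOrder, e1, List.headD_eq_head?_getD, h.sorting.head]; rfl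
  have s2 : endOrder T' u v = τ := by
    rw [endOrder, e1, List.getLastD_eq_getLast?, h.sorting.last]; rfl
  have s3 : startOrder T' v u = τ.reverse := by
    rw [startOrder, e2, List.headD_eq_head?_getD, List.head?_reverse, List.getLast?_map,
      h.sorting.last]; rfl
  have s4 : endOrder T' v u = σ.reverse := by
    rw [endOrder, e2, List.getLastD_eq_getLast?, List.getLast?_reverse, List.head?_map,
      h.sorting.head]; rfl
  -- Every claim about the new edge is checked for both of its directions of travel.
  have cases_eq : ∀ {P : V → V → Prop} a b, s(a, b) = s(u, v) → P u v → P v u → P a b := by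
    intro P a b hab h1 h2
    rw [Sym2.eq_iff] at hab
    rcases hab with ⟨rfl, rfl⟩ | ⟨rfl, rfl⟩
    · exact h1
    · exact h2
  have valid : N.TableValid T' := by
    intro a b hab
    by_cases hs : s(a, b) = s(u, v)
    · refine cases_eq (P := fun a b => ∀ π ∈ T' (a, b), π.Nodup ∧
        ∀ l, l ∈ π ↔ s(a, b) ∈ N.edges l) a b hs ?_ ?_
      · rw [e1]; exact h.valid
      · rw [e2]
        intro π hπ
        obtain ⟨ρ, hρ, rfl⟩ := List.mem_map.1 (List.mem_reverse.1 hπ)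
        obtain ⟨h1, h2⟩ := h.valid ρ hρ
        exact ⟨List.nodup_reverse.2 h1, fun l => by rw [List.mem_reverse, h2, Sym2.eq_swap]⟩
    · rw [e3 a b hs]; exact hT.good.valid a b hab
  have flips : TableFlips T' := by
    intro a b
    by_cases hs : s(a, b) = s(u, v)
    · refine cases_eq (P := fun a b => T' (b, a) = ((T' (a, b)).map List.reverse).reverse)
        a b hs ?_ ?_
      · rw [e1, e2]
      · rw [e1, e2]; simp
    · rw [e3 a b hs, e3 b a (by rwa [Sym2.eq_swap])]; exact hT.good.flips a b
  have new : ∀ a b, s(a, b) = s(u, v) → T (a, b) = [] ∧ T' (a, b) ≠ [] := by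
    intro a b hs
    refine cases_eq (P := fun a b => T (a, b) = [] ∧ T' (a, b) ≠ []) a b hs ?_ ?_
    · rw [e1]; exact ⟨hTuv, hO⟩
    · rw [e2]; exact ⟨hTvu, by simpa using hO⟩
  have treated : ∀ a b, T' (a, b) ≠ [] ↔ T (a, b) ≠ [] ∨ s(a, b) = s(u, v) := by
    intro a b
    by_cases hs : s(a, b) = s(u, v)
    · simp [hs, (new a b hs).2]
    · simp [hs, e3 a b hs]
  have old : ∀ e ∈ ds, T' e = T e := by
    rintro ⟨a, b⟩ he
    refine e3 a b fun hs => huv ?_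
    rw [← hs]
    exact List.mem_map.2 ⟨_, he, rfl⟩
  refine ⟨?_, ?_, ?_, ?_, ?_⟩
  · refine hT.good.update valid flips e3 new ?_
    intro a b hs
    refine cases_eq (P := fun a b => ∀ l k p q, l ≠ k → N.Runs l a b p → N.Runs k a b q →
      ([l, k].Sublist (endOrder T' a b) ↔ N.Precedes T l k a b p q)) a b hs ?_ ?_
    · rw [s2]; exact h.last
    · intro l k p q hlk hl hk
      rw [s4, List.pair_sublist_reverse]
      exact h.first l k p q hlk hl hk
  · intro a b
    rw [treated, hT.treated]
    simp
  · intro a b hab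
    by_cases hs : s(a, b) = s(u, v)
    · refine cases_eq (P := fun a b => IsSorting (startOrder T' a b) (endOrder T' a b) (T' (a, b)))
        a b hs ?_ ?_
      · rw [s1, s2, e1]; exact h.sorting
      · rw [s3, s4, e2]; exact h.sorting.map_reverse.reverse
    · rw [startOrder, endOrder, e3 a b hs]
      refine hT.sorting a b ?_
      rwa [e3 a b hs] at hab
  · intro l k hlk
    have hsum : pairCrossings T' (ds ++ [(u, v)]) l k = pairCrossings T ds l k +
        (O.zip O.tail).countP (fun p => decide (Swapped l k p.1 p.2)) := by
      rw [pairCrossings, pairCrossings, List.map_append, List.sum_append]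
      congr 1
      · congr 1
        refine List.map_congr_left fun e he => ?_
        rw [old e he]
      · simp [e1]
    obtain ⟨c1, c2⟩ := hT.crossings l k hlk
    obtain ⟨c3, c4⟩ := IsSorting.countP_swapped h.nodup h.sorting l k
    rw [hsum]
    constructor
    -- Either the pair has met on a treated edge and does not cross now, or it has not met and has
    -- no crossing so far.
    · by_cases hex : ∃ c d, T (c, d) ≠ [] ∧ s(c, d) ∈ N.edges l ∧ s(c, d) ∈ N.edges k
      · obtain ⟨c, d, hcd, hl, hk⟩ := hex
        rw [c4 (pair_sublist_iff_of_treated hN hT.good hTuv h hlk hcd hl hk)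
          (pair_sublist_iff_of_treated hN hT.good hTuv h hlk.symm hcd hk hl)]
        exact c1
      · rw [c2 fun c d h1 h2 h3 => hex ⟨c, d, h1, h2, h3⟩]
        omega
    · intro hno
      rw [c2 fun c d h1 => hno c d ((treated c d).2 (Or.inl h1))]
      have huv' := hno u v (by rw [e1]; exact hO)
      have hm : ∀ x y, [x, y].Sublist τ → [x, y].Sublist σ ∨
          (s(u, v) ∈ N.edges x ∧ s(u, v) ∈ N.edges y) := by
        intro x y hxy
        obtain ⟨hx, hy⟩ := List.pair_sublist_mem hxy
        have := (h.valid τ (List.mem_of_getLast? h.sorting.last)).2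
        exact Or.inr ⟨(this x).1 hx, (this y).1 hy⟩
      have hm' : ∀ x y, [x, y].Sublist σ → s(u, v) ∈ N.edges x ∧ s(u, v) ∈ N.edges y := by
        intro x y hxy
        obtain ⟨hx, hy⟩ := List.pair_sublist_mem hxy
        exact ⟨(h.mem x).1 hx, (h.mem y).1 hy⟩
      rw [c4]
      · constructor
        · intro h'
          exact absurd (hm' l k h').2 (huv' (hm' l k h').1)
        · intro h'
          exact (hm l k h').resolve_right fun h'' => huv' h''.1 h''.2
      · constructor
        · intro h'
          exact absurd (hm' k l h').1 (huv' (hm' k l h').2)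
        · intro h'
          exact (hm k l h').resolve_right fun h'' => huv' h''.2 h''.1
  · obtain ⟨D, d1, d2⟩ := hT.count
    obtain ⟨E, f1, f2⟩ := h.count
    refine ⟨D ∪ E, ?_, ?_⟩
    · intro x hx
      rcases Finset.mem_union.1 hx with hx | hx
      · obtain ⟨a, b, h1, h2⟩ := d1 x hx
        exact ⟨a, b, (treated a b).2 (Or.inl h1), h2⟩
      · obtain ⟨-, h2, h3, -⟩ := f1 x hx
        exact ⟨u, v, by rw [e1]; exact hO, h2, h3⟩
    · have hdisj : Disjoint D E := by
        rw [Finset.disjoint_left]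
        intro x hxD hxE
        obtain ⟨c, d, hcd, hl, hk⟩ := d1 x hxD
        obtain ⟨hlk, hlu, hku, hsep⟩ := f1 x hxE
        obtain ⟨p, hp⟩ := exists_runs hlu
        obtain ⟨q, hq⟩ := exists_runs hku
        obtain ⟨p', hp', -⟩ := hp.back
        obtain ⟨q', hq', -⟩ := hq.back
        have hne : s(c, d) ≠ s(u, v) := fun hs => hcd (new c d hs).1
        obtain ⟨n1, n2⟩ := hsep p q p' q' hp hq hp' hq'
        rcases sameGroup_of_treated hN hlk hp hq hp' hq' hl hk hne hcd
          (fun h => hcd ((hT.good.flips.eq_nil_iff c d).1 h)) with hs | hs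
        · exact n1 hs
        · exact n2 hs
      rw [Finset.card_union_of_disjoint hdisj, List.map_append, List.sum_append]
      have : ds.map (fun e => ((T' e).length - 1) ^ 2) = ds.map
          fun e => ((T e).length - 1) ^ 2 :=
        List.map_congr_left fun e he => by rw [old e he]
      rw [this]
      simp only [List.map_cons, List.map_nil, List.sum_cons, List.sum_nil, add_zero, e1]
      omega

theorem progress_treatEdges (hN : N.PathTerminalProperty) (hN' : N.PathIntersectionProperty)
    {ls : List L} (hls : ls.Nodup) (hall : ∀ l, l ∈ ls) {depth : ℕ}
    (hdepth : ∀ l a b p, N.Runs l a b p → p.length < depth) (ds es : List (V × V)) (T : Table V L)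
    (hT : Progress N ds T) (hnd : ((ds ++ es).map fun e => s(e.1, e.2)).Nodup)
    (hadj : ∀ e ∈ es, N.graph.Adj e.1 e.2) :
    Progress N (ds ++ es) (treatEdges N.rot N.vertices ls depth es T).val := by
  induction es generalizing ds T with
  | nil => simpa [treatEdges] using hT
  | cons e es ih =>
    obtain ⟨u, v⟩ := e
    have huv : s(u, v) ∉ ds.map fun e => s(e.1, e.2) := by
      rw [List.map_append, List.nodup_append] at hnd
      intro h
      exact hnd.2.2 _ h s(u, v) (by simp) rfl
    have hTuv : T (u, v) = [] := by
      by_contra h'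
      exact huv ((hT.treated u v).1 h')
    obtain ⟨σ, τ, O, h1, h2⟩ := treatEdge_spec hN hT.good hTuv hls hall hdepth
    have := ih (ds ++ [(u, v)]) _ (hT.step hN' (hadj (u, v) (by simp)) huv h1) (by simpa using hnd)
      fun e he => hadj e (List.mem_cons_of_mem _ he)
    simpa [treatEdges, h2] using this

end MetroNetwork

/-! ### Feasibility, monotonicity and the number of block crossings -/

namespace MetroNetwork

open LineOrdering

variable {V L : Type} [DecidableEq V] [DecidableEq L] {N : MetroNetwork V L} {T : Table V L}

theorem Runs.exists_next {l : L} {u v : V} {p : List V} (h : N.Runs l u v p)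
    (hv : v ≠ N.src l ∧ v ≠ N.dst l) : ∃ w q, p = w :: q := by
  cases p with
  | nil => exact (h.nil_terminal.elim hv.1 hv.2).elim
  | cons w q => exact ⟨w, q, rfl⟩

/-- If all edges around `v` have been treated, the orders are consistent. -/
theorem IsGood.consistentAt (hT : IsGood N T) {u v : V} (huv : N.graph.Adj u v)
    (hall : ∀ u v, N.graph.Adj u v → T (u, v) ≠ []) : N.ConsistentAt T u v := by
  obtain ⟨t1, t2⟩ := turn_spec (N := N) huv.symm
  have hs : ∀ {a b}, N.graph.Adj a b →
      (startOrder T a b).Nodup ∧ ∀ l, l ∈ startOrder T a b ↔ s(a, b) ∈ N.edges l := by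
    intro a b hab
    obtain ⟨π, O, hO⟩ := List.exists_cons_of_ne_nil (hall a b hab)
    have := hT.valid a b hab π (by simp [hO])
    simpa [startOrder, hO] using this
  have he : (endOrder T u v).Nodup ∧ ∀ l, l ∈ endOrder T u v ↔ s(u, v) ∈ N.edges l := by
    obtain ⟨h1, h2⟩ := hs huv.symm
    rw [hT.flips.endOrder_eq]
    exact ⟨List.nodup_reverse.2 h1, fun l => by rw [List.mem_reverse, h2, Sym2.eq_swap]⟩
  have hw : ∀ w ∈ N.turn u v, ∀ l, l ∈ (startOrder T v w).filter
      (fun l => decide (s(u, v) ∈ N.edges l)) ↔ ∃ p, N.Runs l u v (w :: p) := by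
    intro w hw l
    obtain ⟨hvw, hwu⟩ := (t2 w).1 hw
    rw [List.mem_filter, (hs hvw).2, decide_eq_true_eq]
    constructor
    · rintro ⟨h1, h2⟩
      obtain ⟨p, hp⟩ := exists_runs h2
      obtain ⟨p', rfl⟩ := hp.next h1 hwu
      exact ⟨p', hp⟩
    · rintro ⟨p, hp⟩
      exact ⟨hp.tail.mem_edges, hp.mem_edges⟩
  refine List.eq_of_pair_sublist (he.1.filter _) ?_ ?_ ?_
  · rw [List.nodup_flatMap]
    refine ⟨fun w hwt => (hs ((t2 w).1 hwt).1).1.filter _, ?_⟩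
    refine t1.imp_of_mem fun {a b} ha hb hab l hla hlb => ?_
    obtain ⟨p, hp⟩ := (hw a ha l).1 hla
    obtain ⟨q, hq⟩ := (hw b hb l).1 hlb
    exact hab (List.cons.inj (hp.unique hq)).1
  · intro l
    rw [List.mem_filter, he.2, List.mem_flatMap, decide_eq_true_eq]
    constructor
    · rintro ⟨h1, h2⟩
      obtain ⟨p, hp⟩ := exists_runs h1
      obtain ⟨w, p, rfl⟩ := hp.exists_next h2
      exact ⟨w, hp.mem_turn, (hw w hp.mem_turn l).2 ⟨p, hp⟩⟩
    · rintro ⟨w, hwt, h⟩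
      obtain ⟨p, hp⟩ := (hw w hwt l).1 h
      exact ⟨hp.mem_edges, hp.cons_not_terminal⟩
  · intro l k h
    rw [List.pair_sublist_filter, decide_eq_true_eq, decide_eq_true_eq] at h
    obtain ⟨hlv, hkv, h⟩ := h
    obtain ⟨hl, hk⟩ := List.pair_sublist_mem h
    obtain ⟨p, hp⟩ := exists_runs ((he.2 l).1 hl)
    obtain ⟨q, hq⟩ := exists_runs ((he.2 k).1 hk)
    -- Since every edge at `v` is treated, `Precedes` is decided at `v` itself: by the turn if the
    -- lines go to different neighbours, by the stored order if they go to the same one.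
    rw [hT.ends u v (hall u v huv) l k p q (List.pair_sublist_ne he.1 h) hp hq] at h
    obtain ⟨x, p, rfl⟩ := hp.exists_next hlv
    obtain ⟨y, q, rfl⟩ := hq.exists_next hkv
    rw [List.flatMap_def, List.pair_sublist_flatten]
    by_cases hxy : x = y
    · subst hxy
      rw [precedes_cons_self, if_neg (hall v x hp.tail.adj)] at h
      refine Or.inl ⟨_, List.mem_map.2 ⟨x, hp.mem_turn, rfl⟩, ?_⟩
      rw [List.pair_sublist_filter]
      simpa [hp.mem_edges, hq.mem_edges] using h
    · simp only [Precedes, hxy, if_false] at h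
      exact Or.inr ⟨_, _, h.map _, (hw x hp.mem_turn l).2 ⟨p, hp⟩, (hw y hq.mem_turn k).2 ⟨q, hq⟩⟩

theorem IsEdgeList.mem {es : List (V × V)} (h : N.IsEdgeList es) {u v : V} :
    s(u, v) ∈ es.map (fun e => s(e.1, e.2)) ↔ N.graph.Adj u v := by
  rw [h.2, SimpleGraph.mem_edgeSet]

theorem IsEdgeList.adj {es : List (V × V)} (h : N.IsEdgeList es) :
    ∀ e ∈ es, N.graph.Adj e.1 e.2 := fun e he =>
  h.mem.1 (List.mem_map.2 ⟨e, he, rfl⟩)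

theorem Progress.isFeasible {es : List (V × V)} (he : N.IsEdgeList es) (h : Progress N es T) :
    N.IsFeasible T where
  nonempty _ _ huv := (h.treated _ _).2 (he.mem.2 huv)
  order := h.good.valid
  moves _ _ huv := (h.sorting _ _ ((h.treated _ _).2 (he.mem.2 huv))).isBlockMove
  flip u v _ := h.good.flips u v
  consistent u v huv := h.good.consistentAt huv fun u v huv => (h.treated u v).2 (he.mem.2 huv)

theorem Progress.isMonotone {es : List (V × V)} (he : N.IsEdgeList es) (h : Progress N es T) :
    N.IsMonotone T es :=
  ⟨fun u v huv => (h.sorting u v ((h.treated u v).2 (he.mem.2 huv))).monotone,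
    fun l k hlk => (h.crossings l k hlk).1⟩

/-- A move exchanges two nonempty blocks, so at least two lines use the edge. This allows `|E'|`
instead of `|E|` in the bound. -/
theorem Progress.mem_sharedEdges {es : List (V × V)} (he : N.IsEdgeList es)
    (h : Progress N es T) {u v : V} (huv : N.graph.Adj u v) (hlen : (T (u, v)).length - 1 ≠ 0) :
    s(u, v) ∈ N.sharedEdges := by
  have hs := h.sorting u v ((h.treated u v).2 (he.mem.2 huv))
  have hv := h.good.valid u v huv
  match hO : T (u, v) with
  | [] => simp [hO] at hlen
  | [_] => simp [hO] at hlen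
  | π :: ρ :: O =>
    rw [hO] at hs hv
    obtain ⟨h1, h2⟩ := hv π (by simp)
    obtain ⟨a, b, c, d, hb, hc, rfl, -, -⟩ := (List.isChain_cons_cons.1 hs.chain).1
    obtain ⟨x, hx⟩ := List.exists_mem_of_ne_nil b hb
    obtain ⟨y, hy⟩ := List.exists_mem_of_ne_nil c hc
    refine ⟨huv, x, y, ?_, (h2 x).1 (by simp [hx]), (h2 y).1 (by simp [hy])⟩
    rintro rfl
    rw [List.nodup_append, List.nodup_append] at h1
    exact h1.1.2.2 x (by simp [hx]) x hy rfl

theorem IsEdgeList.finite {es : List (V × V)} (he : N.IsEdgeList es) : N.graph.edgeSet.Finite :=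
  (List.finite_toSet (es.map fun e : V × V => s(e.1, e.2))).subset fun e h => (he.2 e).2 h

theorem IsEdgeList.ncard {es : List (V × V)} (he : N.IsEdgeList es) :
    N.graph.edgeSet.ncard = es.length := by
  classical
  have : N.graph.edgeSet = ((es.map fun e => s(e.1, e.2)).toFinset : Set (Sym2 V)) := by
    ext e
    rw [← he.2]
    simp
  rw [this, Set.ncard_coe_finset, List.toFinset_card_of_nodup he.1, List.length_map]

theorem Progress.blockCrossings_le [Fintype L] {es : List (V × V)} (he : N.IsEdgeList es)
    (h : Progress N es T) : (blockCrossings T es : ℝ) ≤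
      2 * (Fintype.card L * Real.sqrt N.sharedEdges.ncard) := by
  classical
  have hnd : es.Nodup := List.Nodup.of_map _ he.1
  obtain ⟨D, -, hD⟩ := h.count
  have hDc : D.card ≤ Fintype.card L ^ 2 := by
    refine (Finset.card_le_univ D).trans ?_
    rw [Fintype.card_prod, sq]
  set S := es.toFinset.filter fun e => (T e).length - 1 ≠ 0 with hS
  have hsum : blockCrossings T es = ∑ e ∈ S, ((T e).length - 1) := by
    rw [blockCrossings, hS, Finset.sum_filter_ne_zero, List.sum_toFinset _ hnd]
  have hsq : (es.map fun e => ((T e).length - 1) ^ 2).sum =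
      ∑ e ∈ es.toFinset, ((T e).length - 1) ^ 2 := (List.sum_toFinset _ hnd).symm
  have hScard : S.card ≤ N.sharedEdges.ncard := by
    have hinj : Set.InjOn (fun e : V × V => s(e.1, e.2)) (S : Set (V × V)) := by
      intro a ha b hb hab
      have h1 : a ∈ es := by simpa using (Finset.mem_filter.1 ha).1
      have h2 : b ∈ es := by simpa using (Finset.mem_filter.1 hb).1
      exact List.inj_on_of_nodup_map he.1 h1 h2 hab
    rw [← Set.ncard_coe_finset, ← hinj.ncard_image]
    refine Set.ncard_le_ncard ?_ (he.finite.subset fun e h => h.1)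
    rintro _ ⟨e, hS', rfl⟩
    obtain ⟨h1, h2⟩ := Finset.mem_filter.1 hS'
    exact h.mem_sharedEdges he (he.adj e (by simpa using h1)) h2
  -- Cauchy–Schwarz over the edges with at least one move, combined with the bound on the sum of
  -- squares. The resulting constant `√2` is rounded up to `2`.
  have hcs : blockCrossings T es ^ 2 ≤ N.sharedEdges.ncard * (2 * Fintype.card L ^ 2) := by
    rw [hsum]
    refine sq_sum_le_card_mul_sum_sq.trans (Nat.mul_le_mul hScard ?_)
    refine (Finset.sum_le_sum_of_subset (Finset.filter_subset _ _)).trans ?_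
    rw [← hsq]
    omega
  have hcs' : (blockCrossings T es : ℝ) ^ 2 ≤
      N.sharedEdges.ncard * (2 * (Fintype.card L : ℝ) ^ 2) := by exact_mod_cast hcs
  refine (pow_le_pow_iff_left₀ (by positivity) (by positivity) two_ne_zero).1 ?_
  rw [mul_pow, mul_pow, Real.sq_sqrt (by positivity)]
  nlinarith [show (0 : ℝ) ≤ N.sharedEdges.ncard * (Fintype.card L : ℝ) ^ 2 by positivity]

theorem length_vertices_le {es : List (V × V)} (he : N.IsEdgeList es) (l : L) :
    (N.vertices l).length ≤ es.length + 1 := by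
  have h2 : (N.vertices l).length = (N.edges l).length + 1 := by
    rw [vertices, edges, SimpleGraph.Walk.length_support, SimpleGraph.Walk.length_edges]
  have h3 : (N.edges l).length ≤ (es.map fun e => s(e.1, e.2)).length :=
    (List.subperm_of_subset (N.line l).2.isTrail.edges_nodup fun e h =>
      (he.2 e).2 ((N.line l).1.edges_subset_edgeSet h)).length_le
  rw [List.length_map] at h3
  omega

theorem Runs.length_lt {es : List (V × V)} (he : N.IsEdgeList es) {l : L} {u v : V} {p : List V}
    (h : N.Runs l u v p) : p.length < es.length := by
  have h1 : (u :: v :: p).length ≤ (N.vertices l).length := by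
    rcases h with h | h
    · exact h.length_le
    · simpa using h.length_le
  have h2 := length_vertices_le he l
  simp only [List.length_cons] at h1
  omega

theorem progress_orderLines (hN : N.PathTerminalProperty) (hN' : N.PathIntersectionProperty)
    {ls : List L} {es : List (V × V)} (hls : ls.Nodup) (hall : ∀ l, l ∈ ls)
    (he : N.IsEdgeList es) : Progress N es (orderLines N.rot N.vertices ls es).val := by
  have := progress_treatEdges hN hN' hls hall (depth := es.length)
    (fun l a b p h => h.length_lt he) [] es _ progress_nil (by simpa using he.1) he.adj
  simpa [orderLines] using this

end MetroNetwork

/-! ### Step counts of the procedures -/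

namespace LineOrdering

open MetroNetwork

variable {V L : Type} [DecidableEq V] [DecidableEq L]

/-- One call passes one vertex and makes at most four comparisons; both sides of each `&&` are
evaluated. -/
theorem cutLine_steps (u v : V) (back rem : List V) :
    (cutLine u v back rem).steps ≤ 5 * rem.length + 1 := by
  match rem with
  | [] => simp [cutLine]
  | [a] => simp [cutLine]
  | a :: b :: rest =>
    have ih := cutLine_steps u v (a :: back) (b :: rest)
    simp only [List.length_cons] at ih ⊢
    rw [cutLine]
    simp only [steps_bind, steps_tick, steps_same, val_same]
    by_cases h1 : a = u ∧ b = v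
    · simp [h1]
      omega
    · by_cases h2 : a = v ∧ b = u
      · have : ¬ (v = u ∧ u = v) := by rintro ⟨rfl, -⟩; exact h1 h2
        simp [h2, this]
        omega
      · simp [h1, h2]
        omega

theorem linesThrough_steps (path : L → List V) (u v : V) (ls : List L) (M : ℕ)
    (h : ∀ l, (path l).length ≤ M) :
    (linesThrough path u v ls).steps ≤ ls.length * (5 * M + 3) + 1 := by
  induction ls with
  | nil => simp [linesThrough]
  | cons l ls ih =>
    have := cutLine_steps u v [] (path l)
    have := h l
    simp only [linesThrough, steps_bind, steps_tick, steps_load, val_load, List.length_cons]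
    cases (cutLine u v [] (path l)).val <;> simp only [steps_pure] <;> nlinarith

theorem turnFrom_steps (u : V) (seen ws : List V) :
    (turnFrom u seen ws).steps ≤ 4 * ws.length + seen.length + 3 := by
  induction ws generalizing seen with
  | nil => simp [turnFrom]; omega
  | cons w ws ih =>
    have := ih (w :: seen)
    by_cases h : w = u
    · simp [turnFrom, h]; omega
    · simp [turnFrom, h] at this ⊢; omega

theorem toward_steps (w : V) (is : List (L × List V)) :
    (toward w is).steps ≤ 2 * is.length + 1 := by
  induction is with
  | nil => simp [toward]
  | cons i is ih =>
    obtain ⟨l, _ | ⟨x, p⟩⟩ := i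
    · simp [toward]; omega
    · by_cases h : x = w <;> simp [toward, h] <;> omega

theorem ending_steps (is : List (L × List V)) : (ending is).steps = is.length + 1 := by
  induction is with
  | nil => simp [ending]
  | cons i is ih =>
    obtain ⟨l, _ | ⟨x, p⟩⟩ := i <;> simp [ending] <;> omega

theorem occurs_steps (l : L) (is : List (L × List V)) :
    (occurs l is).steps ≤ 2 * is.length + 1 := by
  induction is with
  | nil => simp [occurs]
  | cons i is ih =>
    obtain ⟨k, p⟩ := i
    by_cases h : k = l <;> simp [occurs, h] <;> omega

theorem restrict_steps (is : List (L × List V)) (ls : List L) :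
    (restrict is ls).steps ≤ ls.length * (2 * is.length + 2) + 1 := by
  induction ls with
  | nil => simp [restrict]
  | cons l ls ih =>
    have := occurs_steps l is
    have e : (restrict is (l :: ls)).steps = 1 + (restrict is ls).steps + (occurs l is).steps := by
      cases h : (occurs l is).val <;> simp [restrict, h] <;> omega
    rw [e, List.length_cons]
    nlinarith

theorem labelList_steps (k : ℕ) (ls : List L) (A : L → ℕ) :
    (labelList k ls A).steps = 2 * ls.length + 1 := by
  induction ls generalizing A with
  | nil => simp [labelList]
  | cons l ls ih => simp [labelList, ih]; omega

theorem labelLists_steps (k : ℕ) (gs : List (List L)) (A : L → ℕ) :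
    (labelLists k gs A).steps = 2 * gs.flatten.length + 2 * gs.length + 1 := by
  induction gs generalizing k A with
  | nil => simp [labelLists]
  | cons g gs ih =>
    simp only [labelLists, steps_bind, steps_tick, labelList_steps, ih, List.flatten_cons,
      List.length_append, List.length_cons]
    omega

theorem merge_steps (lab : L → ℕ) (g : List L) :
    (merge lab g).steps ≤ 4 * g.length + 1 ∧ (merge lab g).val.length ≤ g.length := by
  induction g with
  | nil => simp [merge]
  | cons a g ih =>
    simp only [merge, val_bind, steps_bind, steps_tick, List.length_cons]
    cases h : (merge lab g).val with
    | nil => simp; omega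
    | cons b rest =>
      rw [h] at ih
      cases b with
      | nil => simp at ih ⊢; omega
      | cons b bs => by_cases h' : lab a = lab b <;> simp [h'] at ih ⊢ <;> omega

theorem maxSize_steps {β : Type} (gs : List (List β)) :
    (maxSize gs).steps ≤ gs.flatten.length + 3 * gs.length + 1 := by
  induction gs with
  | nil => simp [maxSize]
  | cons g gs ih =>
    simp only [maxSize, steps_bind, steps_tick, steps_length, val_length, steps_less, val_less,
      List.flatten_cons, List.length_append, List.length_cons]
    by_cases h : (maxSize gs).val < g.length <;>
      simp only [h, decide_true, decide_false, if_true, Bool.false_eq_true, if_false, steps_pure] <;>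
      omega

theorem locate_steps {β : Type} (n : ℕ) (left : List β) (gs : List (List β)) :
    (locate n left gs).steps ≤ 2 * gs.flatten.length + 6 * gs.length + 3 := by
  induction gs generalizing left with
  | nil => simp [locate]
  | cons g gs ih =>
    have := ih (g.reverse ++ left)
    simp only [locate, steps_bind, steps_tick, steps_length, val_length, steps_same, val_same,
      List.flatten_cons, List.length_append, List.length_cons]
    by_cases h : g.length = n
    · simp only [h, decide_true, if_true, steps_bind, steps_flatten, steps_pure]
      omega
    · simp only [h, decide_false, Bool.false_eq_true, if_false, steps_bind, steps_reverseOnto,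
        val_reverseOnto]
      omega

theorem rank_steps (pos : L → ℕ) (b : List L) : (rank pos b).steps ≤ 2 := by
  cases b <;> simp [rank]

theorem splitBelow_steps (pos : L → ℕ) (r : ℕ) (s : List (List L)) :
    (splitBelow pos r s).steps ≤ 4 * s.length + 1 ∧
    (splitBelow pos r s).val.1.length + (splitBelow pos r s).val.2.length = s.length := by
  induction s with
  | nil => simp [splitBelow]
  | cons b s ih =>
    have := rank_steps pos b
    simp only [splitBelow, steps_bind, val_bind, steps_tick, steps_less, val_less,
      List.length_cons]
    by_cases h : (rank pos b).val < r
    · simp only [h, decide_true, if_true, steps_bind, val_bind, steps_pure, val_pure,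
        List.length_cons]
      omega
    · simp only [h, decide_false, Bool.false_eq_true, if_false, steps_pure, val_pure,
        List.length_cons, List.length_nil]
      omega

theorem snapshot_steps {β : Type} (xs s ys : List β) :
    (snapshot xs s ys).steps = xs.length + s.length + 3 := by
  simp [snapshot]; omega

/-- One insertion scans and copies sequences of at most `N` blocks a constant number of times. The
bound `N` persists because each block only passes from `xs` to `s`. -/
theorem insertLeft_steps (pos : L → ℕ) (ys xs s : List (List L)) (N : ℕ)
    (h : xs.length + s.length ≤ N) :
    (insertLeft pos ys xs s).steps ≤ xs.length * (7 * N + 9) + 1 ∧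
    (insertLeft pos ys xs s).val.1.length = xs.length + s.length ∧
    (insertLeft pos ys xs s).val.2.length ≤ xs.length := by
  induction xs generalizing s with
  | nil => simp [insertLeft]
  | cons x xs ih =>
    obtain ⟨h1, h2⟩ := splitBelow_steps pos (rank pos x).val s
    have h3 := rank_steps pos x
    simp only [insertLeft, steps_bind, val_bind, steps_tick, steps_append, val_append]
    generalize (splitBelow pos (rank pos x).val s) = R at *
    obtain ⟨⟨front, back⟩, st⟩ := R
    simp only [List.length_cons] at h1 h2 h ⊢
    have h4 : (front ++ x :: back).length = s.length + 1 := by simp; omega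
    obtain ⟨i1, i2, i3⟩ := ih (front ++ x :: back) (by omega)
    have e : (xs.length + 1) * (7 * N + 9) = xs.length * (7 * N + 9) + (7 * N + 9) := by ring
    cases front with
    | nil =>
      simp only [steps_pure, val_pure]
      refine ⟨?_, ?_, ?_⟩ <;> omega
    | cons f front =>
      simp only [steps_pure, val_pure, steps_bind, val_bind, snapshot_steps, List.length_cons]
        at h2 h4 i1 i2 i3 ⊢
      refine ⟨?_, ?_, ?_⟩ <;> omega

theorem insertRight_steps (pos : L → ℕ) (ys s : List (List L)) (N : ℕ)
    (h : ys.length + s.length ≤ N) :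
    (insertRight pos ys s).steps ≤ ys.length * (7 * N + 9) + 1 ∧
    (insertRight pos ys s).val.length ≤ ys.length := by
  induction ys generalizing s with
  | nil => simp [insertRight]
  | cons x ys ih =>
    obtain ⟨h1, h2⟩ := splitBelow_steps pos (rank pos x).val s
    have h3 := rank_steps pos x
    simp only [insertRight, steps_bind, val_bind, steps_tick, steps_append, val_append]
    generalize (splitBelow pos (rank pos x).val s) = R at *
    obtain ⟨⟨front, back⟩, st⟩ := R
    simp only [List.length_cons] at h1 h2 h ⊢
    have h4 : (front ++ x :: back).length = s.length + 1 := by simp; omega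
    obtain ⟨i1, i2⟩ := ih (front ++ x :: back) (by omega)
    have e : (ys.length + 1) * (7 * N + 9) = ys.length * (7 * N + 9) + (7 * N + 9) := by ring
    cases back with
    | nil =>
      simp only [steps_pure, val_pure]
      refine ⟨?_, ?_⟩ <;> omega
    | cons f back =>
      simp only [steps_pure, val_pure, steps_bind, val_bind, snapshot_steps, List.length_cons,
        List.length_nil] at h2 h4 i1 i2 ⊢
      refine ⟨?_, ?_⟩ <;> omega

theorem sortInto_steps (n : ℕ) (gs target : List (List (List L))) (N : ℕ)
    (h1 : gs.length ≤ N) (h2 : target.length ≤ N) (h3 : gs.flatten.length ≤ N)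
    (h4 : target.flatten.length ≤ N) (h5 : target.flatten.flatten.length ≤ N) :
    (sortInto n gs target).steps ≤ 15 * (N + 1) ^ 2 := by
  have hl := locate_steps n [] gs
  have hs := congrArg List.length (locate_spec n [] gs).1
  simp only [sortInto, steps_bind, steps_tick, steps_flatten, val_flatten, labelLists_steps,
    steps_append, steps_pure]
  generalize (locate n [] gs) = R at *
  obtain ⟨⟨xs, s, ys⟩, st⟩ := R
  simp only [List.length_append, List.length_reverse, List.length_nil, zero_add] at hs hl ⊢
  generalize (labelLists 0 target.flatten fun _ => 0).val = pos
  obtain ⟨a1, a2, a3⟩ := insertLeft_steps pos ys xs s N (by omega)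
  obtain ⟨b1, b2⟩ := insertRight_steps pos ys (insertLeft pos ys xs s).val.1 N (by omega)
  have e : xs.length * (7 * N + 9) + ys.length * (7 * N + 9) ≤ N * (7 * N + 9) := by
    rw [← add_mul]
    exact Nat.mul_le_mul_right _ (by omega)
  nlinarith

end LineOrdering

/-! ### The cost of following the lines -/

namespace List

theorem sum_map_const_nat {α : Type} (l : List α) (c : ℕ) :
    (l.map fun _ => c).sum = l.length * c := by
  simp

theorem sum_map_le_sum_map_nat {α : Type} (l : List α) {f g : α → ℕ} (h : ∀ x ∈ l, f x ≤ g x) :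
    (l.map f).sum ≤ (l.map g).sum := List.sum_le_sum h

theorem length_le_length_flatten {α : Type} {l : List (List α)} (h : [] ∉ l) :
    l.length ≤ l.flatten.length := by
  rw [length_flatten]
  refine le_trans (by simp) (sum_map_le_sum_map_nat l (f := fun _ => 1) fun x hx => ?_)
  exact length_pos_iff.2 (by rintro rfl; exact h hx)

end List

namespace LineOrdering

open MetroNetwork

variable {V L : Type} [DecidableEq V] [DecidableEq L] {N : MetroNetwork V L} {T : Table V L}

theorem toward_cons_val (w x : V) (l : L) (p : List V) (is : List (L × List V)) :
    (toward w ((l, x :: p) :: is)).val =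
      if x = w then (l, p) :: (toward w is).val else (toward w is).val := by
  by_cases h : x = w <;> simp [toward, h]

theorem sum_ite_le {ws : List V} (hws : ws.Nodup) (x : V) (c : V → ℕ) :
    (ws.map fun w => if x = w then c w else 0).sum ≤ c x := by
  induction ws with
  | nil => simp
  | cons w ws ih =>
    have ih := ih hws.of_cons
    rw [List.map_cons, List.sum_cons]
    by_cases hx : x = w
    · subst hx
      have : (ws.map fun w => if x = w then c w else 0).sum = 0 := by
        rw [List.sum_eq_zero_iff]
        intro n hn
        obtain ⟨w, hw, rfl⟩ := List.mem_map.1 hn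
        rw [if_neg]
        rintro rfl
        exact (List.nodup_cons.1 hws).1 hw
      simp [this]
    · simpa [hx] using ih

/-- Every line continues to at most one vertex. -/
theorem sum_toward_le (g : V → L × List V → ℕ) {ws : List V} (hws : ws.Nodup)
    (is : List (L × List V)) (f : L × List V → ℕ)
    (h : ∀ l w p, (l, w :: p) ∈ is → g w (l, p) ≤ f (l, w :: p)) :
    (ws.map fun w => ((toward w is).val.map (g w)).sum).sum ≤ (is.map f).sum := by
  induction is with
  | nil => simp [toward]
  | cons i is ih =>
    have ih := ih fun l w p hi => h l w p (by simp [hi])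
    obtain ⟨l, _ | ⟨x, p⟩⟩ := i
    · simp only [toward, val_bind, List.map_cons, List.sum_cons]
      omega
    · have e : (ws.map fun w => ((toward w ((l, x :: p) :: is)).val.map (g w)).sum).sum =
          (ws.map fun w => if x = w then g w (l, p) else 0).sum +
          (ws.map fun w => ((toward w is).val.map (g w)).sum).sum := by
        rw [← List.sum_map_add]
        congr 1
        refine List.map_congr_left fun w _ => ?_
        rw [toward_cons_val]
        split_ifs <;> simp
      have e2 := sum_ite_le hws x fun w => g w (l, p)
      have := h l x p (by simp)
      rw [e, List.map_cons, List.sum_cons]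
      omega

theorem GroupsSpec.length_flatten {u v : V} {is : List (L × List V)} {G : List (List L)}
    (hG : GroupsSpec N T u v is G) (his : N.IsBundle u v is) : G.flatten.length = is.length := by
  have : G.flatten.Perm (is.map Prod.fst) := by
    refine (List.perm_ext_iff_of_nodup hG.nodup his.nodup).2 fun l => ?_
    rw [hG.mem]
    simp
  rw [this.length_eq, List.length_map]

theorem GroupsSpec.length_le {u v : V} {is : List (L × List V)} {G : List (List L)}
    (hG : GroupsSpec N T u v is G) (his : N.IsBundle u v is) : G.length ≤ is.length := by
  rw [← hG.length_flatten his]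
  exact List.length_le_length_flatten hG.nonempty

/-- The contribution of the vertices of a line to the cost of following it. -/
def degreeCost (rot : V → List V) (p : List V) : ℕ :=
  (p.map fun x => 10 * (rot x).length + 12).sum

theorem turn_nodup (N : MetroNetwork V L) (u v : V) : (N.turn u v).Nodup ∧
    (N.turn u v).length ≤ (N.rot v).length := by
  have hp : (N.turn u v).Perm ((N.rot v).take ((N.rot v).idxOf u) ++
      (N.rot v).drop ((N.rot v).idxOf u + 1)) := List.perm_append_comm
  have hs : ((N.rot v).take ((N.rot v).idxOf u) ++
      (N.rot v).drop ((N.rot v).idxOf u + 1)).Sublist (N.rot v) := by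
    conv_rhs => rw [← List.take_append_drop ((N.rot v).idxOf u) (N.rot v)]
    refine List.Sublist.append_left ?_ _
    exact List.drop_sublist_drop_left _ (Nat.le_succ _)
  exact ⟨hp.nodup_iff.2 (hs.nodup (N.rot_nodup v)), hp.length_eq ▸ hs.length_le⟩

/-- The search of the part of the tree behind the edge from `v` to `w`. -/
def searchBranch (rot : V → List V) (T : Table V L) (n : ℕ) (v : V) (is : List (L × List V))
    (w : V) : Timed (List (List L)) := do
  let sub ← toward w is
  match sub with
  | [] => return []
  | _ :: _ =>
    let orders ← load T (v, w)
    match orders with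
    | near :: _ =>
      let g ← restrict sub near
      return [g]
    | [] => groups rot T n v w sub

theorem groups_succ_steps (n : ℕ) (u v : V) (is : List (L × List V)) :
    (groups N.rot T (n + 1) u v is).steps =
      (ending is).steps + (turnFrom u [] (N.rot v)).steps + (ending is).val.length + 4 +
      ((N.turn u v).map fun w => (searchBranch N.rot T n v is w).steps +
        (searchBranch N.rot T n v is w).val.length + 2).sum := by
  have e : (groups N.rot T (n + 1) u v is).steps = 1 + ((ending is).steps + (1 +
      ((turnFrom u [] (N.rot v)).steps +
      ((flatMap (searchBranch N.rot T n v is) (turnFrom u [] (N.rot v)).val).steps +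
        (append (ending is).val (flatMap (searchBranch N.rot T n v is)
          (turnFrom u [] (N.rot v)).val).val).steps)))) := rfl
  rw [e, steps_flatMap, steps_append, turnFrom_val]
  omega

/-- Scanning for lines towards `w` costs `2 * is.length + 3` even if there are none; all further
work is charged to the lines that do continue to `w`. At a treated edge, restricting at most `M`
lines costs `M * (2 * s + 2) + 1` for `s` continuing lines, and `s ≥ 1` makes the product at most `4
* M * s`. -/
theorem searchBranch_steps (M : ℕ)
    (hM : ∀ v w, (startOrder T v w).length ≤ M) (n : ℕ) (v w : V) (is : List (L × List V))
    (ih : (toward w is).val ≠ [] → (groups N.rot T n v w (toward w is).val).steps ≤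
      ((toward w is).val.map fun i => 4 * M + 3 + degreeCost N.rot (w :: i.2)).sum)
    (hlen : (toward w is).val ≠ [] →
      (groups N.rot T n v w (toward w is).val).val.length ≤ (toward w is).val.length) :
    (searchBranch N.rot T n v is w).steps + (searchBranch N.rot T n v is w).val.length + 2 ≤
      (2 * is.length + 3) + ((toward w is).val.map fun i =>
        2 + (4 * M + 3 + degreeCost N.rot (w :: i.2))).sum := by
  have h1 := toward_steps w is
  simp only [searchBranch, steps_bind, val_bind]
  generalize toward w is = X at *
  obtain ⟨sub, st⟩ := X
  cases sub with
  | nil => simp at h1 ⊢; omega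
  | cons i sub =>
    simp only [steps_bind, val_bind, steps_load, val_load]
    have ih := ih (by simp)
    have hlen := hlen (by simp)
    simp only at ih hlen h1
    rw [List.sum_map_add, List.sum_map_const_nat]
    cases hO : T (v, w) with
    | nil =>
      simp only [List.length_cons] at hlen ⊢
      omega
    | cons near rest =>
      have h2 := restrict_steps (i :: sub) near
      have h3 : near.length ≤ M := by simpa [startOrder, hO] using hM v w
      have h4 : near.length * (2 * (i :: sub).length + 2) ≤ M * (2 * (i :: sub).length + 2) :=
        Nat.mul_le_mul_right _ h3
      have h5 : (i :: sub).length * (4 * M + 3) ≤ ((i :: sub).map fun i =>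
          4 * M + 3 + degreeCost N.rot (w :: i.2)).sum := by
        rw [← List.sum_map_const_nat]
        exact List.sum_map_le_sum_map_nat _ fun _ _ => Nat.le_add_right _ _
      simp only [steps_bind, val_bind, val_pure, steps_pure, List.length_cons,
        List.length_nil] at *
      nlinarith

/-- Every line reserves `4 * M + 3` for its leaf and pays a degree-dependent amount at each vertex
it visits. Since a line continues to at most one neighbour, the recursive costs add up line by line.
-/
theorem groups_steps (hN : N.PathTerminalProperty) (hT : N.TableValid T) (M : ℕ)
    (hM : ∀ v w, (startOrder T v w).length ≤ M) (n : ℕ) (u v : V)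
    (is : List (L × List V)) (his : N.IsBundle u v is) (hne : is ≠ [])
    (hn : ∀ i ∈ is, i.2.length < n) :
    (groups N.rot T n u v is).steps ≤
      (is.map fun i => 4 * M + 3 + degreeCost N.rot (v :: i.2)).sum := by
  induction n generalizing u v is with
  | zero =>
    obtain ⟨i, hi⟩ := List.exists_mem_of_ne_nil _ hne
    exact absurd (hn i hi) (by simp)
  | succ n ih =>
    have hpos : 1 ≤ is.length := List.length_pos_iff.2 hne
    obtain ⟨t1, t2⟩ := turn_nodup N u v
    have h1 := ending_steps is
    have h2 := turnFrom_steps u [] (N.rot v)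
    have h3 : (ending is).val.length ≤ is.length := by
      rw [ending_val, List.length_map]
      exact List.length_filter_le _ _
    have hsub : ∀ w, ∀ i ∈ (toward w is).val, i.2.length < n := by
      rintro w ⟨l, p⟩ hi
      have := hn _ (mem_toward.1 hi)
      simpa using this
    have hbr : ∀ w ∈ N.turn u v, (searchBranch N.rot T n v is w).steps +
        (searchBranch N.rot T n v is w).val.length + 2 ≤
        (2 * is.length + 3) + ((toward w is).val.map fun i =>
          2 + (4 * M + 3 + degreeCost N.rot (w :: i.2))).sum := fun w _ =>
      searchBranch_steps M hM n v w is
        (fun h => ih v w _ (IsBundle.toward his w) h (hsub w))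
        (fun h => (groups_spec hN hT n v w _ (IsBundle.toward his w) h (hsub w)).length_le
          (IsBundle.toward his w))
    have hsum := List.sum_map_le_sum_map_nat _ hbr
    have hr : ((N.turn u v).map fun w => (2 * is.length + 3) + ((toward w is).val.map fun i =>
          2 + (4 * M + 3 + degreeCost N.rot (w :: i.2))).sum).sum =
        (N.turn u v).length * (2 * is.length + 3) + ((N.turn u v).map fun w =>
          ((toward w is).val.map fun i =>
            2 + (4 * M + 3 + degreeCost N.rot (w :: i.2))).sum).sum := by
      rw [List.sum_map_add, List.sum_map_const_nat]
    rw [hr] at hsum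
    have htot := sum_toward_le (fun w i => 2 + (4 * M + 3 + degreeCost N.rot (w :: i.2))) t1 is
      (fun i => 2 + (4 * M + 3 + degreeCost N.rot i.2)) (fun _ _ _ _ => le_rfl)
    have hr' : (is.map fun i => 2 + (4 * M + 3 + degreeCost N.rot i.2)).sum = is.length * 2 +
        (is.map fun i => 4 * M + 3 + degreeCost N.rot i.2).sum := by
      rw [List.sum_map_add, List.sum_map_const_nat]
    rw [hr'] at htot
    -- Splits off the budget for `v`. It pays for the turn, about four steps per neighbour, and for
    -- the scans, at most five steps per neighbour and line because `is` is nonempty.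
    have hd : (is.map fun i => 4 * M + 3 + degreeCost N.rot (v :: i.2)).sum =
        is.length * (10 * (N.rot v).length + 12) +
          (is.map fun i => 4 * M + 3 + degreeCost N.rot i.2).sum := by
      rw [← List.sum_map_const_nat, ← List.sum_map_add]
      congr 1
      refine List.map_congr_left fun i _ => ?_
      simp only [degreeCost, List.map_cons, List.sum_cons]
      omega
    have hmul : (N.turn u v).length * (2 * is.length + 3) ≤
        (N.rot v).length * (2 * is.length + 3) := Nat.mul_le_mul_right _ t2
    rw [groups_succ_steps, hd]
    simp only [List.length_nil] at h2
    nlinarith [Nat.mul_le_mul_left (N.rot v).length hpos]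

/-- The vertices of a path have at most twice as many neighbours as there are edges. -/
theorem sum_rot_length_le {es : List (V × V)} (he : N.IsEdgeList es) {X : List V}
    (hX : X.Nodup) : (X.map fun x => (N.rot x).length).sum ≤ 2 * es.length := by
  have hnd : (X.flatMap fun x => (N.rot x).map fun y => (x, y)).Nodup := by
    rw [List.nodup_flatMap]
    refine ⟨fun x _ => (N.rot_nodup x).map fun a b h => (Prod.mk.inj h).2, ?_⟩
    refine hX.imp fun {a b} hab p ha hb => ?_
    obtain ⟨_, -, rfl⟩ := List.mem_map.1 ha
    obtain ⟨_, -, h⟩ := List.mem_map.1 hb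
    exact hab (Prod.mk.inj h).1.symm
  have hsub : (X.flatMap fun x => (N.rot x).map fun y => (x, y)) ⊆
      es ++ es.map Prod.swap := by
    intro p hp
    obtain ⟨x, -, hp⟩ := List.mem_flatMap.1 hp
    obtain ⟨y, hy, rfl⟩ := List.mem_map.1 hp
    obtain ⟨⟨a, b⟩, hab, h⟩ := List.mem_map.1 (he.mem.2 ((N.mem_rot x y).1 hy))
    rw [List.mem_append, List.mem_map]
    rw [Sym2.eq_iff] at h
    rcases h with ⟨rfl, rfl⟩ | ⟨rfl, rfl⟩
    · exact Or.inl hab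
    · exact Or.inr ⟨_, hab, rfl⟩
  have := (List.subperm_of_subset hnd hsub).length_le
  rw [List.length_flatMap] at this
  simp only [List.length_map, List.length_append] at this
  omega

/-- The degrees along a path sum to at most `2 * |E|`, contributing `20 * |E|`; the at most `|E|`
vertices contribute `12` each. -/
theorem degreeCost_le {es : List (V × V)} (he : N.IsEdgeList es) {l : L} {u v : V} {p : List V}
    (h : N.Runs l u v p) : degreeCost N.rot (v :: p) ≤ 32 * es.length + 12 := by
  have h1 := sum_rot_length_le he h.nodup.of_cons
  have h2 := h.length_lt he
  rw [degreeCost, List.sum_map_add, List.sum_map_const_nat, List.sum_map_mul_left,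
    List.length_cons]
  omega

end LineOrdering

/-! ### The cost of sorting and recording one edge -/

namespace LineOrdering

open MetroNetwork

variable {V L : Type} [DecidableEq V] [DecidableEq L] {N : MetroNetwork V L} {T : Table V L}

theorem map_merge_steps (lab : L → ℕ) (gs : List (List L)) :
    (map (merge lab) gs).steps ≤ 4 * gs.flatten.length + 2 * gs.length + 1 := by
  rw [steps_map]
  induction gs with
  | nil => simp
  | cons g gs ih =>
    have := (merge_steps lab g).1
    simp only [List.map_cons, List.sum_cons, List.flatten_cons, List.length_append,
      List.length_cons] at ih ⊢
    omega

theorem map_reverse_steps (gs : List (List L)) :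
    (map reverse gs).steps = gs.flatten.length + 3 * gs.length + 1 := by
  rw [steps_map]
  induction gs with
  | nil => simp
  | cons g gs ih =>
    simp only [steps_reverse, List.map_cons, List.sum_cons, List.flatten_cons,
      List.length_append, List.length_cons] at ih ⊢
    omega

namespace Compatible

variable {gl gr : List (List L)}

theorem length_blocks_flatten_le (gl gr : List (List L)) :
    (blocks gl gr).flatten.length ≤ gl.flatten.length := by
  conv_rhs => rw [← blocks_flatten_flatten gl gr]
  exact List.length_le_length_flatten (nil_notMem_blocks gl gr)

theorem sortInto_orders (h : Compatible gl gr) {k : ℕ} (hk : ∃ g ∈ blocks gl gr, g.length = k)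
    {n : ℕ} (hn : gl.flatten.length ≤ n) :
    (sortInto k (blocks gl gr) (blocks gr gl)).val.length ≤ n + 1 ∧
    ∀ π ∈ (sortInto k (blocks gl gr) (blocks gr gl)).val, (flatten π).steps ≤ 3 * n + 2 := by
  obtain ⟨h1, -, h3, h4⟩ := sortInto_spec k _ _ h.blocks_perm
    (by rw [blocks_flatten_flatten]; exact h.nodup_right) (nil_notMem_blocks gr gl) hk
    h.blocks_sorted
  have h5 := length_blocks_flatten_le gl gr
  refine ⟨by omega, ?_⟩
  cases hO : (sortInto k (blocks gl gr) (blocks gr gl)).val with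
  | nil => simp
  | cons σ O =>
    rw [hO] at h1 h3
    obtain rfl : σ = (blocks gl gr).flatten := by simpa using h1
    intro π hπ
    have hp := perm_of_isChain (h3.imp fun _ _ h => h.isBlockMove) π hπ
    have e := hp.flatten.length_eq
    rw [blocks_flatten_flatten] at e
    rw [steps_flatten, e, hp.length_eq]
    omega

theorem map_flatten_steps (h : Compatible gl gr) {k : ℕ} (hk : ∃ g ∈ blocks gl gr, g.length = k)
    {n : ℕ} (hn : gl.flatten.length ≤ n) {O : List (List (List L))}
    (hO : O.Perm (sortInto k (blocks gl gr) (blocks gr gl)).val) :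
    (map flatten O).steps ≤ (n + 1) * (3 * n + 3) + 1 := by
  obtain ⟨h1, h2⟩ := h.sortInto_orders hk hn
  rw [steps_map, Nat.add_le_add_iff_right]
  refine (List.sum_map_le_sum_map_nat O (g := fun _ => 3 * n + 3) fun π hπ => ?_).trans ?_
  · exact Nat.succ_le_succ (h2 π (hO.mem_iff.1 hπ))
  · rw [List.sum_map_const_nat, hO.length_eq]
    exact Nat.mul_le_mul_right _ h1

theorem sortEdge_steps (h : Compatible gl gr) (hne : gl ≠ []) {n : ℕ}
    (hn : gl.flatten.length ≤ n) :
    (sortEdge gl gr).steps ≤ 50 * (n + 1) ^ 2 ∧ (sortEdge gl gr).val.length ≤ n + 1 := by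
  have hn' : gr.flatten.length ≤ n := by
    rwa [← ((List.perm_ext_iff_of_nodup h.nodup_left h.nodup_right).2 h.mem).length_eq]
  have hne' : gr ≠ [] := by
    rintro rfl
    obtain ⟨g, gs, rfl⟩ := List.exists_cons_of_ne_nil hne
    obtain ⟨x, hx⟩ := List.exists_mem_of_ne_nil g (by rintro rfl; simpa using h.nonempty_left)
    have := (h.mem x).1 (by simp [hx])
    simp at this
  have c1 := List.length_le_length_flatten h.nonempty_left
  have c2 := List.length_le_length_flatten h.symm.nonempty_left
  have c3 := length_blocks_flatten_le gl gr
  have c4 := length_blocks_flatten_le gr gl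
  have c5 : (blocks gl gr).length = gl.length := List.length_map _
  have c6 : (blocks gr gl).length = gr.length := List.length_map _
  have c7 := congrArg List.length (blocks_flatten_flatten gl gr)
  have c8 := congrArg List.length (blocks_flatten_flatten gr gl)
  have m1 := map_merge_steps (label gr) gl
  have m2 := map_merge_steps (label gl) gr
  have x1 := maxSize_steps (blocks gl gr)
  have x2 := maxSize_steps (blocks gr gl)
  have l2 := (maxSize_spec (blocks gl gr)).2
  have r2 := (maxSize_spec (blocks gr gl)).2
  simp only [sortEdge, steps_bind, val_bind, steps_tick, labelLists_steps, val_map, val_less,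
    steps_less]
  -- Folds the intermediate results into `label` and `blocks`, so that the bounds collected above
  -- apply.
  change 1 + (_ + (_ + ((map (merge (label gr)) gl).steps + ((map (merge (label gl)) gr).steps +
    ((maxSize (blocks gl gr)).steps + ((maxSize (blocks gr gl)).steps + (1 + Timed.steps
    (if decide ((maxSize (blocks gl gr)).val < (maxSize (blocks gr gl)).val) = true then _
      else _)))))))) ≤ _ ∧ List.length (Timed.val
      (if decide ((maxSize (blocks gl gr)).val < (maxSize (blocks gr gl)).val) = true then _
      else _)) ≤ _
  by_cases hlt : (maxSize (blocks gl gr)).val < (maxSize (blocks gr gl)).val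
  · have hk := r2 (by rintro h'; rw [h', eq_comm] at c6; exact hne' (List.length_eq_zero_iff.1 c6))
    have s1 := sortInto_steps (maxSize (blocks gr gl)).val (blocks gr gl) (blocks gl gr) n
      (by omega) (by omega) (by omega) (by omega) (by omega)
    have s2 := h.symm.map_flatten_steps hk hn' (List.reverse_perm _)
    have s3 := (h.symm.sortInto_orders hk hn').1
    simp only [hlt, decide_true, if_true, steps_bind, val_bind, val_map, val_reverse,
      steps_reverse, List.length_map, List.length_reverse]
    change _ + (_ + (_ + (_ + (_ + (_ + (_ + (_ + (
      (sortInto (maxSize (blocks gr gl)).val (blocks gr gl) (blocks gl gr)).steps +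
      ((sortInto (maxSize (blocks gr gl)).val (blocks gr gl) (blocks gl gr)).val.length + 2 +
      (map flatten (sortInto (maxSize (blocks gr gl)).val (blocks gr gl)
        (blocks gl gr)).val.reverse).steps))))))))) ≤ _ ∧ _
    exact ⟨by nlinarith, s3⟩
  · have hk := l2 (by rintro h'; rw [h', eq_comm] at c5; exact hne (List.length_eq_zero_iff.1 c5))
    have s1 := sortInto_steps (maxSize (blocks gl gr)).val (blocks gl gr) (blocks gr gl) n
      (by omega) (by omega) (by omega) (by omega) (by omega)
    have s2 := h.map_flatten_steps hk hn (List.Perm.refl _)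
    have s3 := (h.sortInto_orders hk hn).1
    simp only [hlt, decide_false, Bool.false_eq_true, if_false, steps_bind, val_bind, val_map,
      List.length_map]
    change _ + (_ + (_ + (_ + (_ + (_ + (_ + (_ + (
      (sortInto (maxSize (blocks gl gr)).val (blocks gl gr) (blocks gr gl)).steps +
      (map flatten (sortInto (maxSize (blocks gl gr)).val (blocks gl gr)
        (blocks gr gl)).val).steps)))))))) ≤ _ ∧ _
    exact ⟨by nlinarith, s3⟩

end Compatible

theorem record_steps (T : Table V L) (u v : V) (O : List (List L)) {n : ℕ}
    (hO : ∀ π ∈ O, π.length ≤ n) :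
    (record T u v O).steps ≤ O.length * (n + 4) + 6 := by
  have : O.flatten.length ≤ O.length * n := by
    rw [List.length_flatten, ← List.sum_map_const_nat]
    exact List.sum_map_le_sum_map_nat _ hO
  simp only [record, steps_bind, steps_tick, steps_store, steps_reverse, map_reverse_steps,
    val_map, List.length_map]
  nlinarith

end LineOrdering

/-! ### The total running time -/

namespace LineOrdering

open MetroNetwork

variable {V L : Type} [DecidableEq V] [DecidableEq L] {N : MetroNetwork V L} {T : Table V L}

theorem groups_steps_le (hN : N.PathTerminalProperty) (hT : N.TableValid T) {es : List (V × V)}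
    (he : N.IsEdgeList es) {n : ℕ} (hM : ∀ v w, (startOrder T v w).length ≤ n) {u v : V}
    {is : List (L × List V)} (his : N.IsBundle u v is) (hne : is ≠ []) :
    (groups N.rot T es.length u v is).steps ≤
      is.length * (4 * n + 3 + (32 * es.length + 12)) := by
  refine (groups_steps hN hT n hM _ u v is his hne
    fun i hi => (his.runs i hi).length_lt he).trans ?_
  rw [← List.sum_map_const_nat]
  exact List.sum_map_le_sum_map_nat is fun i hi =>
    Nat.add_le_add_left (degreeCost_le he (his.runs i hi)) _

theorem map_copy_steps {α β : Type} (f : α → β) (is : List α) :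
    (map (fun i => do tick; return f i : α → Timed β) is).steps = 2 * is.length + 1 := by
  rw [steps_map]
  simp [mul_comm]

/-- Finding and following the lines costs `O(|L| * |E| + |L| ^ 2)`, sorting and recording `O(|L| ^
2)`. The hypothesis `hle` absorbs the quadratic terms into `|E| * |L|`. -/
theorem treatEdge_steps (hN : N.PathTerminalProperty) (hT : IsGood N T) {u v : V}
    (huv : T (u, v) = []) {ls : List L} (hls : ls.Nodup) (hall : ∀ l, l ∈ ls)
    {es : List (V × V)} (he : N.IsEdgeList es)
    (hM : ∀ v w, (startOrder T v w).length ≤ ls.length) (hpos : 1 ≤ ls.length)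
    (hle : ls.length ≤ 2 * es.length) :
    (treatEdge N.rot N.vertices ls es.length T u v).steps ≤ 1000 * (es.length * ls.length) := by
  have h1 := linesThrough_steps N.vertices u v ls _ (length_vertices_le he)
  obtain ⟨hmem, hiu, hiv, memu, memv⟩ := linesThrough_bundles N u v hls hall rfl
  have hsub := (linesThrough_spec N u v ls).1.length_le
  rw [List.length_map] at hsub
  simp only [treatEdge, steps_bind, steps_tick]
  have hm : 1 ≤ es.length := by omega
  have hmn : 1 ≤ es.length * ls.length := Nat.mul_pos hm hpos
  have hnm : ls.length ≤ es.length * ls.length := Nat.le_mul_of_pos_left _ hm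
  have hnn : ls.length * ls.length ≤ 2 * (es.length * ls.length) := by nlinarith
  generalize linesThrough N.vertices u v ls = R at *
  obtain ⟨is, st⟩ := R
  simp only at h1 hsub hmem hiu hiv memu memv ⊢
  match is, hsub, hmem, hiu, hiv, memu, memv with
  | [], _, _, _, _, _, _ =>
    have := record_steps T u v [[]] (n := 1) (by simp)
    simp only [List.length_cons, List.length_nil] at this ⊢
    nlinarith
  | [(l, _)], _, _, _, _, _, _ =>
    have := record_steps T u v [[l]] (n := 1) (by simp)
    simp only [List.length_cons, List.length_nil] at this ⊢
    nlinarith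
  | i :: j :: is, hsub, _, hiu, hiv, memu, memv =>
    simp only [steps_bind, val_map, map_copy_steps, val_pure, val_bind, steps_reverse,
      val_reverse, map_reverse_steps, List.length_map]
    generalize hI : i :: j :: is = I at *
    have hne : I ≠ [] := by rw [← hI]; simp
    have hneu : (I.map fun i => (i.1, i.2.1)) ≠ [] := by simpa using hne
    have hnev : (I.map fun i => (i.1, i.2.2)) ≠ [] := by simpa using hne
    have g1 := groups_steps_le hN hT.valid he hM hiu hneu
    have g2 := groups_steps_le hN hT.valid he hM hiv hnev
    have hu := groups_spec hN hT.valid es.length v u _ hiu hneu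
      fun i hi => (hiu.runs i hi).length_lt he
    have hv := groups_spec hN hT.valid es.length u v _ hiv hnev
      fun i hi => (hiv.runs i hi).length_lt he
    have k1 := hu.length_flatten hiu
    have k2 := hu.length_le hiu
    have comp := GroupsSpec.compatible hT huv hiu hiv memu memv hu hv
    have spec := edgeSpec_sortEdge hT huv hnev hiu hiv memu memv hu hv
    have e : ((groups N.rot T es.length v u (I.map fun i => (i.1, i.2.1))).val.map
        List.reverse).reverse.flatten.length = I.length := by
      rw [← List.reverse_flatten, List.length_reverse, k1, List.length_map]
    have hgl : ((groups N.rot T es.length v u (I.map fun i => (i.1, i.2.1))).val.map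
        List.reverse).reverse ≠ [] := by
      intro h
      rw [h, eq_comm] at e
      exact hne (List.length_eq_zero_iff.1 e)
    obtain ⟨s1, s2⟩ := comp.sortEdge_steps hgl (n := ls.length) (by omega)
    have hr := record_steps T u v (sortEdge ((groups N.rot T es.length v u
      (I.map fun i => (i.1, i.2.1))).val.map List.reverse).reverse
      (groups N.rot T es.length u v (I.map fun i => (i.1, i.2.2))).val).val (n := ls.length) (by
        intro π hπ
        rw [(spec.sorting.perm π hπ).length_eq, e]
        exact hsub)
    rw [List.length_map] at k1 k2 g1 g2
    have f1 : I.length * (4 * ls.length + 3 + (32 * es.length + 12)) ≤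
        ls.length * (4 * ls.length + 3 + (32 * es.length + 12)) := Nat.mul_le_mul_right _ hsub
    have f2 := Nat.mul_le_mul_right (ls.length + 4) s2
    nlinarith

theorem startOrder_length_le {ls : List L} (hall : ∀ l, l ∈ ls) {es ds : List (V × V)}
    (he : N.IsEdgeList es) (hds : ds ⊆ es) (hT : Progress N ds T) (v w : V) :
    (startOrder T v w).length ≤ ls.length := by
  cases hO : T (v, w) with
  | nil => simp [startOrder, hO]
  | cons π O =>
    have h := (hT.treated v w).1 (by simp [hO])
    have hadj := he.mem.1 (List.map_subset _ hds h)
    have := (hT.good.valid v w hadj π (by simp [hO])).1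
    simpa [startOrder, hO] using (List.subperm_of_subset this fun l _ => hall l).length_le

/-- The lines start at distinct vertices, all of which are incident to an edge. -/
theorem length_lines_le (hN : N.PathTerminalProperty) {ls : List L} (hls : ls.Nodup)
    {es : List (V × V)} (he : N.IsEdgeList es) : ls.length ≤ 2 * es.length := by
  have hinj : Function.Injective N.src := by
    intro l k hlk
    by_contra h
    exact Set.disjoint_left.1 (hN.2 l k h) (Or.inl rfl) (Or.inl hlk)
  have hsub : ls.map N.src ⊆ es.map Prod.fst ++ es.map Prod.snd := by
    intro x hx
    obtain ⟨l, -, rfl⟩ := List.mem_map.1 hx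
    obtain ⟨w, hw⟩ := Set.nonempty_of_ncard_ne_zero (s := N.graph.neighborSet (N.src l))
      (by rw [(hN.1 l).1]; exact one_ne_zero)
    obtain ⟨e, hes, h⟩ := List.mem_map.1 (he.mem.2 hw)
    rw [List.mem_append]
    rcases Sym2.eq_iff.1 h with ⟨h, -⟩ | ⟨-, h⟩
    · exact Or.inl (List.mem_map.2 ⟨e, hes, h⟩)
    · exact Or.inr (List.mem_map.2 ⟨e, hes, h⟩)
  have := (List.subperm_of_subset (hls.map hinj) hsub).length_le
  simp only [List.length_append, List.length_map] at this
  omega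

theorem treatEdges_steps (hN : N.PathTerminalProperty) (hN' : N.PathIntersectionProperty)
    {ls : List L} (hls : ls.Nodup) (hall : ∀ l, l ∈ ls) (hpos : 1 ≤ ls.length)
    {es : List (V × V)} (he : N.IsEdgeList es) (ds ts : List (V × V)) (hts : ds ++ ts = es)
    (T : Table V L) (hT : Progress N ds T) :
    (treatEdges N.rot N.vertices ls es.length ts T).steps ≤
      ts.length * (1000 * (es.length * ls.length) + 1) + 1 := by
  induction ts generalizing ds T with
  | nil => simp [treatEdges]
  | cons e ts ih =>
    obtain ⟨u, v⟩ := e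
    have hds : ds ++ [(u, v)] ++ ts = es := by simpa using hts
    have hnd := he.1
    rw [← hds, List.map_append] at hnd
    have hP := progress_treatEdges hN hN' hls hall (depth := es.length)
      (fun l a b p h => h.length_lt he) ds [(u, v)] T hT hnd.of_append_left
      (fun e h => he.adj e (by rw [← hds]; simp at h ⊢; tauto))
    have hTuv : T (u, v) = [] := by
      by_contra h'
      rw [List.map_append] at hnd
      exact (List.nodup_append.1 hnd.of_append_left).2.2 _ ((hT.treated u v).1 h') s(u, v)
        (by simp) rfl
    have h1 := treatEdge_steps hN hT.good hTuv hls hall he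
      (startOrder_length_le hall he (by rw [← hts]; exact List.subset_append_left _ _) hT) hpos
      (length_lines_le hN hls he)
    have h2 := ih (ds ++ [(u, v)]) hds _ hP
    simp only [treatEdges, steps_bind, val_bind, val_pure, steps_tick,
      List.length_cons] at h2 ⊢
    nlinarith

theorem orderLines_steps (hN : N.PathTerminalProperty) (hN' : N.PathIntersectionProperty)
    {ls : List L} (hls : ls.Nodup) (hall : ∀ l, l ∈ ls) (hpos : 1 ≤ ls.length)
    {es : List (V × V)} (he : N.IsEdgeList es) :
    (orderLines N.rot N.vertices ls es).steps ≤ 1005 * (es.length ^ 2 * ls.length) := by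
  have h1 := treatEdges_steps hN hN' hls hall hpos he [] es rfl _ progress_nil
  have h2 := length_lines_le hN hls he
  have hm : 1 ≤ es.length := by omega
  have h3 : es.length ≤ es.length ^ 2 * ls.length := by nlinarith [Nat.mul_pos hm hm]
  -- Besides the main term there remain `2 * |E| + 3` steps for the list of edges and the calls,
  -- which is at most five times `|E| ^ 2 * |L|`.
  have e : es.length * (1000 * (es.length * ls.length) + 1) =
      1000 * (es.length ^ 2 * ls.length) + es.length := by ring
  simp only [orderLines, steps_bind, val_length, steps_tick, steps_length]
  omega

end LineOrdering

/-! ### The theorem -/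

theorem mainTheorem1 :
    ∃ C : ℝ, ∀ (V L : Type) [DecidableEq V] [DecidableEq L] [Fintype L]
      (N : MetroNetwork V L),
      N.PathTerminalProperty → N.PathIntersectionProperty →
      ∀ (ls : List L) (es : List (V × V)),
        ls.Nodup → (∀ l, l ∈ ls) → N.IsEdgeList es →
        N.IsFeasible (LineOrdering.orderLines N.rot N.vertices ls es).val ∧
        N.IsMonotone (LineOrdering.orderLines N.rot N.vertices ls es).val es ∧
        (MetroNetwork.blockCrossings (LineOrdering.orderLines N.rot N.vertices ls es).val es : ℝ) ≤
          C * (Fintype.card L * Real.sqrt N.sharedEdges.ncard) ∧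
        (Nonempty L →
          ((LineOrdering.orderLines N.rot N.vertices ls es).steps : ℝ) ≤
            C * ((N.graph.edgeSet.ncard : ℝ) ^ 2 * Fintype.card L)) := by
  -- The constant comes from the running time; for the block crossings `2` would do.
  refine ⟨1005, ?_⟩
  intro V L _ _ _ N hN hN' ls es hls hall he
  have hP := MetroNetwork.progress_orderLines hN hN' hls hall he
  have hlen : ls.length = Fintype.card L := by
    rw [← List.toFinset_card_of_nodup hls, ← Finset.card_univ]
    congr 1
    ext l
    simp [hall l]
  refine ⟨hP.isFeasible he, hP.isMonotone he, ?_, fun hL => ?_⟩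
  · refine (hP.blockCrossings_le he).trans ?_
    gcongr
    norm_num
  · obtain ⟨l⟩ := hL
    have := LineOrdering.orderLines_steps hN hN' hls hall
      (List.length_pos_of_mem (hall l)) he
    rw [he.ncard, ← hlen]
    exact_mod_cast this
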